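/- Let $n\ge 3$, let $(M^n,g)$ be a smooth Riemannian manifold, and let $f:M\to\mathbb R$ be a smooth nonconstant function and $\rho,\lambda\in\mathbb R$ constants with $$Ric+\nabla^2 f=(\rho R+\lambda)g ,$$ where $Ric$ and $R$ are the Ricci tensor and the scalar curvature of $g$ (a nontrivial gradient $\rho$-Einstein soliton). If $\rho=0$, assume in addition that $dR\wedge df=0$ on $M$. Let $\mathcal R=\{p\in M: df(p)\neq 0\}$, and let $B$ be the Bach tensor of $g$, that is, $B_{ij}=\nabla^kC_{kij}$ if $n=3$ and $B_{ij}=\frac1{n-3}\nabla^k\nabla^lW_{ikjl}+\frac1{n-2}R_{kl}W_{i\ j}^{\ k\ l}$ if $n\ge4$, where $W$ is the Weyl tensor, $C_{ijk}=\nabla_iR_{jk}-\nabla_jR_{ik}-\frac1{2(n-1)}(g_{jk}\nabla_iR-g_{ik}\nabla_jR)$ is the Cotton tensor, and the sign convention of the curvature is such that $R_{ik}=g^{jl}R_{ijkl}$. (1) Let $p\in\mathcal R$. Then $T_pM$ has an orthonormal basis $e_1=\nabla f/|\nabla f|,e_2,\dots,e_n$ that diagonalizes $Ric$. With $\xi_1=Ric(\nabla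 f,\nabla f)/|\nabla f|^2$ and $$\mu=n\xi_1^2-2R\xi_1-\big((n-1)|Ric|^2-R^2\big),$$ the vector $\nabla f$ is an eigenvector of the Bach tensor, $$B(\nabla f,X)=\frac{\mu}{(n-1)(n-2)^2}\,g(\nabla f,X)\qquad\text{for all }X\in T_pM,$$ and for every such basis, with $Ric(e_i,\cdot)=\xi_i\,g(e_i,\cdot)$, $$\mu=\Big(\sum_{i=2}^n\xi_i\Big)^2-(n-1)\sum_{i=2}^n\xi_i^2\le 0 .$$ (2) If $B(\nabla f,\nabla f)\ge0$ on all of $M$, then there are functions $\xi_1,\xi_2$, smooth on $\mathcal R$, such that at every point of $\mathcal R$ one has $Ric(\nabla f,\cdot)=\xi_1\,g(\nabla f,\cdot)$ and $Ric(u,\cdot)=\xi_2\,g(u,\cdot)$ for every $u\perp\nabla f$; that is, $Ric$ has at most the two eigenvalues $\xi_1$ and $\xi_2$, with multiplicities $1$ and $n-1$. Moreover, $\xi_1$ and $\xi_2$ are constant on each connected component of every regular level $f^{-1}(c)\cap\mathcal R$, $c\in\mathbb R$. -/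

import Mathlib

open scoped Manifold ContDiff Bundle Topology

noncomputable section

namespace RhoSoliton

/-! ### Tensor calculus in a coordinate domain of `ℝⁿ`

A covariant tensor field written in coordinates is a function of the point `x` and of vectors of
`ℝⁿ`; a vector `v` of `ℝⁿ` is also regarded as the coordinate vector field with constant
components `v`, so that index expressions are obtained by inserting the basis vectors `∂ i`. -/

/-- The coordinate space `ℝⁿ`. -/
abbrev Coord (n : ℕ) := EuclideanSpace ℝ (Fin n)

variable {n : ℕ}

/-- The coordinate basis vector `∂ᵢ`. -/
def basisVec (i : Fin n) : Coord n := EuclideanSpace.single i (1 : ℝ)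

/-- The components `g^{kl}` of the inverse of the metric `G`. -/
def invMetric (G : Coord n → Coord n → Coord n → ℝ) (x : Coord n) : Matrix (Fin n) (Fin n) ℝ :=
  (Matrix.of fun k l => G x (basisVec k) (basisVec l))⁻¹

/-- Raising the index of a covector: `(α^♯)^k = g^{kl} α_l`. -/
def sharp (G : Coord n → Coord n → Coord n → ℝ) (x : Coord n) (α : Coord n → ℝ) : Coord n :=
  ∑ k, ∑ l, (invMetric G x k l * α (basisVec l)) • basisVec k

/-- Metric contraction of two arguments: `g^{kl} T_{kl}`. -/
def contract (G : Coord n → Coord n → Coord n → ℝ) (x : Coord n)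
    (T : Coord n → Coord n → ℝ) : ℝ :=
  ∑ k, ∑ l, invMetric G x k l * T (basisVec k) (basisVec l)

/-- The directional derivative `∂_u F` at `x`. -/
def dir (F : Coord n → ℝ) (x u : Coord n) : ℝ := fderiv ℝ F x u

/-- The Christoffel symbols of the Levi-Civita connection:
`∇_u v = Γ(u, v)` for constant-coefficient fields `u`, `v`, with
`g(Γ(u, v), w) = (∂_u g(v, w) + ∂_v g(u, w) - ∂_w g(u, v)) / 2`. -/
def christoffel (G : Coord n → Coord n → Coord n → ℝ) (x u v : Coord n) : Coord n :=
  sharp G x fun w =>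
    (1 / 2 : ℝ) * (dir (fun y => G y v w) x u + dir (fun y => G y u w) x v
      - dir (fun y => G y u v) x w)

/-- The Hessian `∇²F (u, v) = ∂_u ∂_v F - dF (Γ(u, v))` of a function. -/
def hess (G : Coord n → Coord n → Coord n → ℝ) (F : Coord n → ℝ) (x u v : Coord n) : ℝ :=
  dir (fun y => dir F y v) x u - dir F x (christoffel G x u v)

/-- `Rm(u, v) w = ∇_v ∇_u w - ∇_u ∇_v w` for constant-coefficient fields (which commute). -/
def curvOp (G : Coord n → Coord n → Coord n → ℝ) (x u v w : Coord n) : Coord n :=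
  (fderiv ℝ (fun y => christoffel G y u w) x v + christoffel G x v (christoffel G x u w))
    - (fderiv ℝ (fun y => christoffel G y v w) x u + christoffel G x u (christoffel G x v w))

/-- The curvature tensor `R_{ijkl} = g(Rm(∂ᵢ, ∂ⱼ) ∂ₖ, ∂ₗ)`. -/
def curv (G : Coord n → Coord n → Coord n → ℝ) (x u v w z : Coord n) : ℝ :=
  G x (curvOp G x u v w) z

/-- The Ricci tensor `R_{ik} = g^{jl} R_{ijkl}`. -/
def ric (G : Coord n → Coord n → Coord n → ℝ) (x u w : Coord n) : ℝ :=
  contract G x fun v z => curv G x u v w z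

/-- The scalar curvature `R = g^{ik} R_{ik}`. -/
def scal (G : Coord n → Coord n → Coord n → ℝ) (x : Coord n) : ℝ :=
  contract G x fun u w => ric G x u w

/-- The squared norm `|Ric|² = g^{ik} g^{jl} R_{ij} R_{kl}` of the Ricci tensor. -/
def ricNormSq (G : Coord n → Coord n → Coord n → ℝ) (x : Coord n) : ℝ :=
  contract G x fun a c => contract G x fun b d => ric G x a b * ric G x c d

/-- Covariant derivative of a 2-tensor: `nabla₂ G T x a u v = (∇_a T)(u, v)`. -/
def nabla₂ (G : Coord n → Coord n → Coord n → ℝ) (T : Coord n → Coord n → Coord n → ℝ)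
    (x a u v : Coord n) : ℝ :=
  dir (fun y => T y u v) x a - T x (christoffel G x a u) v - T x u (christoffel G x a v)

/-- Covariant derivative of a 3-tensor: `nabla₃ G T x a u v w = (∇_a T)(u, v, w)`. -/
def nabla₃ (G : Coord n → Coord n → Coord n → ℝ)
    (T : Coord n → Coord n → Coord n → Coord n → ℝ) (x a u v w : Coord n) : ℝ :=
  dir (fun y => T y u v w) x a - T x (christoffel G x a u) v w
    - T x u (christoffel G x a v) w - T x u v (christoffel G x a w)

/-- Covariant derivative of a 4-tensor: `nabla₄ G T x a u v w z = (∇_a T)(u, v, w, z)`. -/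
def nabla₄ (G : Coord n → Coord n → Coord n → ℝ)
    (T : Coord n → Coord n → Coord n → Coord n → Coord n → ℝ) (x a u v w z : Coord n) : ℝ :=
  dir (fun y => T y u v w z) x a - T x (christoffel G x a u) v w z
    - T x u (christoffel G x a v) w z - T x u v (christoffel G x a w) z
    - T x u v w (christoffel G x a z)

/-- The Weyl tensor `W_{ijkl}`, for the arguments `(u, v, w, z) = (∂ᵢ, ∂ⱼ, ∂ₖ, ∂ₗ)`. -/
def weyl (G : Coord n → Coord n → Coord n → ℝ) (x u v w z : Coord n) : ℝ :=
  curv G x u v w z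
    - 1 / ((n : ℝ) - 2) * (G x u w * ric G x v z - G x u z * ric G x v w
        - G x v w * ric G x u z + G x v z * ric G x u w)
    + scal G x / (((n : ℝ) - 1) * ((n : ℝ) - 2)) * (G x u w * G x v z - G x u z * G x v w)

/-- The Cotton tensor
`C_{ijk} = ∇ᵢ R_{jk} - ∇ⱼ R_{ik} - (g_{jk} ∇ᵢ R - g_{ik} ∇ⱼ R) / (2 (n - 1))`. -/
def cotton (G : Coord n → Coord n → Coord n → ℝ) (x u v w : Coord n) : ℝ :=
  nabla₂ G (ric G) x u v w - nabla₂ G (ric G) x v u w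
    - 1 / (2 * ((n : ℝ) - 1)) * (G x v w * dir (scal G) x u - G x u w * dir (scal G) x v)

/-- The divergence `∇^l W_{ijkl}` of the Weyl tensor. -/
def divWeyl (G : Coord n → Coord n → Coord n → ℝ) (x u v w : Coord n) : ℝ :=
  contract G x fun a z => nabla₄ G (weyl G) x a u v w z

/-- The Bach tensor: for `n = 3`, `B_{ij} = ∇^k C_{kij}`; for `n ≥ 4`,
`B_{ij} = ∇^k ∇^l W_{ikjl} / (n - 3) + R_{kl} W_i^k_j^l / (n - 2)`. -/
def bachCoord (G : Coord n → Coord n → Coord n → ℝ) (x u v : Coord n) : ℝ :=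
  if n = 3 then
    contract G x fun a k => nabla₃ G (cotton G) x a k u v
  else
    1 / ((n : ℝ) - 3) * (contract G x fun a k => nabla₃ G (divWeyl G) x a u k v)
      + 1 / ((n : ℝ) - 2) *
        contract G x fun k a => contract G x fun l b => ric G x k l * weyl G x u a v b

/-! ### Riemannian manifolds

`M` is a smooth `n`-manifold and `g` a smooth Riemannian metric on it. Tensors at a point `p` are
computed in the preferred chart at `p`. -/

variable {M : Type*} [TopologicalSpace M] [ChartedSpace (Coord n) M] [IsManifold (𝓡 n) ∞ M]

/-- Smooth Riemannian metrics on `M`. -/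
abbrev Metric (n : ℕ) (M : Type*) [TopologicalSpace M] [ChartedSpace (Coord n) M]
    [IsManifold (𝓡 n) ∞ M] :=
  Bundle.ContMDiffRiemannianMetric (𝓡 n) ∞ (Coord n) (fun p : M => TangentSpace (𝓡 n) p)

/-- The coordinates of `p` in the chart at `p`. -/
def coordPt (p : M) : Coord n := extChartAt (𝓡 n) p p

/-- The components of a tangent vector at `p` in the chart at `p`. -/
def coordVec (p : M) (v : TangentSpace (𝓡 n) p) : Coord n :=
  mfderiv (𝓡 n) 𝓘(ℝ, Coord n) (extChartAt (𝓡 n) p) p v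

/-- The tangent vector of `M` with components `u` at the point with coordinates `x` in the chart
at `p`. -/
def chartVec (p : M) (x u : Coord n) : TangentSpace (𝓡 n) ((extChartAt (𝓡 n) p).symm x) :=
  mfderiv 𝓘(ℝ, Coord n) (𝓡 n) (extChartAt (𝓡 n) p).symm x u

/-- The metric written in the chart at `p`. -/
def chartMetric (g : Metric n M) (p : M) (x u v : Coord n) : ℝ :=
  g.inner ((extChartAt (𝓡 n) p).symm x) (chartVec p x u) (chartVec p x v)

/-- The Ricci tensor of `(M, g)`. -/
def Ricci (g : Metric n M) (p : M) (u v : TangentSpace (𝓡 n) p) : ℝ :=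
  ric (chartMetric g p) (coordPt p) (coordVec p u) (coordVec p v)

/-- The scalar curvature of `(M, g)`. -/
def scalarCurv (g : Metric n M) (p : M) : ℝ := scal (chartMetric g p) (coordPt p)

/-- The squared norm of the Ricci tensor of `(M, g)`. -/
def RicciNormSq (g : Metric n M) (p : M) : ℝ := ricNormSq (chartMetric g p) (coordPt p)

/-- The Bach tensor of `(M, g)`. -/
def Bach (g : Metric n M) (p : M) (u v : TangentSpace (𝓡 n) p) : ℝ :=
  bachCoord (chartMetric g p) (coordPt p) (coordVec p u) (coordVec p v)

/-- The Hessian `∇²f` of a function on `(M, g)`. -/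
def Hessian (g : Metric n M) (f : M → ℝ) (p : M) (u v : TangentSpace (𝓡 n) p) : ℝ :=
  hess (chartMetric g p) (fun x => f ((extChartAt (𝓡 n) p).symm x)) (coordPt p)
    (coordVec p u) (coordVec p v)

/-- The differential of a function, as a covector at `p`. -/
def differential (f : M → ℝ) (p : M) : TangentSpace (𝓡 n) p →L[ℝ] ℝ :=
  mfderiv (𝓡 n) 𝓘(ℝ, ℝ) f p

/-- The metric at `p` as a bilinear form. -/
def metricForm (g : Metric n M) (p : M) : LinearMap.BilinForm ℝ (TangentSpace (𝓡 n) p) :=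
  LinearMap.mk₂ ℝ (fun u v => g.inner p u v) (by simp) (by simp) (by simp) (by simp)

theorem metricForm_nondegenerate (g : Metric n M) (p : M) : (metricForm g p).Nondegenerate := by
  have key : ∀ v : TangentSpace (𝓡 n) p, g.inner p v v = 0 → v = 0 := fun v hv => by
    by_contra h
    exact (g.pos p v h).ne' hv
  exact ⟨fun v hv => key v (hv v), fun v hv => key v (hv v)⟩

instance (p : M) : FiniteDimensional ℝ (TangentSpace (𝓡 n) p) :=
  inferInstanceAs (FiniteDimensional ℝ (Coord n))

/-- The gradient `∇f`: the vector dual to `df` with respect to `g`. -/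
def gradient (g : Metric n M) (f : M → ℝ) (p : M) : TangentSpace (𝓡 n) p :=
  (LinearMap.BilinForm.toDual (metricForm g p) (metricForm_nondegenerate g p)).symm
    (differential (n := n) f p).toLinearMap

theorem inner_gradient (g : Metric n M) (f : M → ℝ) (p : M) (v : TangentSpace (𝓡 n) p) :
    g.inner p (gradient g f p) v = differential f p v :=
  LinearMap.BilinForm.apply_toDual_symm_apply
    (hB := metricForm_nondegenerate g p)
    (differential (n := n) f p).toLinearMap v

/-- The set `𝓡` of regular points of `f`. -/
def regularSet (n : ℕ) {M : Type*} [TopologicalSpace M] [ChartedSpace (Coord n) M]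
    (f : M → ℝ) : Set M :=
  {p | mfderiv (𝓡 n) 𝓘(ℝ, ℝ) f p ≠ 0}

/-- `(M, g, f, lam)` is a gradient `ρ`-Einstein soliton: `f` is smooth and
`Ric + ∇²f = (ρ R + lam) g`. -/
def IsGradientRhoEinsteinSoliton (g : Metric n M) (f : M → ℝ) (ρ lam : ℝ) : Prop :=
  ContMDiff (𝓡 n) 𝓘(ℝ, ℝ) ∞ f ∧
    ∀ (p : M) (u v : TangentSpace (𝓡 n) p),
      Ricci g p u v + Hessian g f p u v = (ρ * scalarCurv g p + lam) * g.inner p u v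

/-- `e` is a `g`-orthonormal basis of `T_pM` that diagonalizes `Ric` with eigenvalues `ξ`, and
`e i₁ = ∇f / |∇f|`. -/
structure IsAdaptedRicciBasis (g : Metric n M) (f : M → ℝ) (p : M) (i₁ : Fin n)
    (e : Fin n → TangentSpace (𝓡 n) p) (ξ : Fin n → ℝ) : Prop where
  orthonormal : ∀ i j, g.inner p (e i) (e j) = if i = j then 1 else 0
  eigen : ∀ i u, Ricci g p (e i) u = ξ i * g.inner p (e i) u
  first : e i₁ = (Real.sqrt (g.inner p (gradient g f p) (gradient g f p)))⁻¹ • gradient g f p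

/-- The function `μ = n ξ₁² - 2 R ξ₁ - ((n - 1) |Ric|² - R²)` at a regular point, where
`ξ₁ = Ric(∇f, ∇f) / |∇f|²`. -/
def bachMu (g : Metric n M) (f : M → ℝ) (p : M) : ℝ :=
  let ξ₁ := Ricci g p (gradient g f p) (gradient g f p)
    / g.inner p (gradient g f p) (gradient g f p)
  n * ξ₁ ^ 2 - 2 * scalarCurv g p * ξ₁ - ((n - 1) * RicciNormSq g p - scalarCurv g p ^ 2)

end RhoSoliton

end

/-!
Write `N = ∇F` for the gradient of the potential, in the coordinates of a chart.

The soliton equation makes the skew part of `∇Ric` equal to that of `(ρ R + λ) g - ∇²F`, and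
commuting derivatives of `N` turns the latter into curvature (`IsSolitonOn.nabla₂_ric_sub`). Its
trace, together with the contracted Bianchi identity, is `Ric(N, ·) = (1 - 2 (n - 1) ρ) / 2 dR`
(`IsSolitonOn.ric_grad`). If `ρ ≠ 0`, this and `d|N|² = 2 (ρ R + λ) dF - 2 Ric(N, ·)` make
`(ρ R + λ) dF` exact, whence `dR ∧ dF = 0` (`IsSolitonOn.rect`); if `ρ = 0` this is assumed. So
`Ric(N, ·)` is proportional to `dF`, that is, `N` is an eigenvector of `Ric`, and `Ric` has an
orthonormal eigenbasis that starts with `N / |N|` (`exists_isAdaptedRicciBasis`).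

The Cotton tensor is now
`C(u, v, w) = -Rm(u, v, w, N) + (ρ - 1 / (2 (n - 1))) (dR(u) g(v, w) - dR(v) g(u, w))`, so
`C(·, ·, N) = 0`, and its divergence is symmetric (`IsSolitonOn.div_cotton_comm`). Hence
`div C (N, v)` may be computed with `N` in the last slot; differentiating `C(·, ·, N) = 0` there
leaves the algebraic expression `∑ Ric(eᵢ, eⱼ) C(eᵢ, v, eⱼ)` (`IsSolitonOn.div_cotton_grad`). As
`div W = -(n - 3) / (n - 2) C` (`IsMetricOn.divWeyl_eq`), and `W = 0` if `n = 3`, the Bach tensor is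
in every dimension `B(N, v) = (div C (N, v) + ⟨Ric, W(N, ·, v, ·)⟩) / (n - 2)`. The full curvature
cancels in this sum, and what remains is `μ g(N, v) / ((n - 1) (n - 2)²)`
(`IsSolitonOn.bachCoord_grad`).

In an eigenbasis `μ = (∑ ξᵢ)² - (n - 1) ∑ ξᵢ²`, the sums over the `n - 1` directions orthogonal to
`N`, is nonpositive by the Cauchy-Schwarz inequality. If `B(N, N) ≥ 0`, equality holds, and all
these `ξᵢ` coincide. Finally `ξ₁ dF = (1 - 2 (n - 1) ρ) / 2 dR` gives `dξ₁ ∧ dF = 0` on taking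
exterior derivatives; since also `dR ∧ dF = 0`, both eigenvalues are locally constant along regular
level sets (`eventually_eq_of_level_eq`), thus constant on their components.

The tensors of the statement are evaluated at each point in the preferred chart of that point. The
computations above differentiate the soliton equation, so they need it on a neighbourhood in a
single chart; this is provided by the invariance of curvature and Hessian under transition maps,
which are isometries of the coordinate metrics (`IsIsometryOn`, `isSolitonOn_chart`).
-/

noncomputable section

namespace RhoSoliton

section

variable {n : ℕ} {V : Type*} [NormedAddCommGroup V] [NormedSpace ℝ V]

/-! ### Smooth fields of linear maps -/

/-- A smooth field of `V`-valued linear forms on `U`, given by its values on constant vectors.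
Tensor fields of higher rank are handled one slot at a time. -/
structure IsTensor₁ (U : Set (Coord n)) (T : Coord n → Coord n → V) : Prop where
  lin : ∀ x ∈ U, IsLinearMap ℝ (T x)
  smooth : ∀ u, ContDiffOn ℝ ∞ (fun x => T x u) U

theorem sum_smul_basisVec (u : Coord n) : ∑ i, u i • basisVec i = u := by
  ext j
  simp [basisVec, Finset.sum_apply, Pi.single_apply]

theorem IsLinearMap.eq_sum_basisVec {T : Coord n → V} (hT : IsLinearMap ℝ T) (u : Coord n) :
    T u = ∑ i, u i • T (basisVec i) := by
  conv_lhs => rw [← sum_smul_basisVec u]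
  refine (map_sum (hT.mk' T) (fun i => u i • basisVec i) Finset.univ).trans ?_
  exact Finset.sum_congr rfl fun i _ => hT.map_smul _ _

namespace IsTensor₁

variable {U : Set (Coord n)} {T S : Coord n → Coord n → V} {X : Coord n → Coord n} {x : Coord n}

theorem add (hT : IsTensor₁ U T) (hS : IsTensor₁ U S) :
    IsTensor₁ U (fun x u => T x u + S x u) where
  lin x hx := (((hT.lin x hx).mk' _) + ((hS.lin x hx).mk' _)).isLinear
  smooth u := (hT.smooth u).add (hS.smooth u)

theorem sub (hT : IsTensor₁ U T) (hS : IsTensor₁ U S) :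
    IsTensor₁ U (fun x u => T x u - S x u) where
  lin x hx := (((hT.lin x hx).mk' _) - ((hS.lin x hx).mk' _)).isLinear
  smooth u := (hT.smooth u).sub (hS.smooth u)

theorem smul {c : Coord n → ℝ} (hT : IsTensor₁ U T) (hc : ContDiffOn ℝ ∞ c U) :
    IsTensor₁ U (fun x u => c x • T x u) where
  lin x hx := (c x • ((hT.lin x hx).mk' _)).isLinear
  smooth u := hc.smul (hT.smooth u)

theorem congr (hT : IsTensor₁ U T) (h : ∀ x ∈ U, ∀ u, S x u = T x u) : IsTensor₁ U S where
  lin x hx := by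
    have : S x = T x := funext (h x hx)
    rw [this]; exact hT.lin x hx
  smooth u := (hT.smooth u).congr fun x hx => h x hx u

theorem smooth_apply_field (hT : IsTensor₁ U T) (hX : ContDiffOn ℝ ∞ X U) :
    ContDiffOn ℝ ∞ (fun x => T x (X x)) U := by
  have h : ContDiffOn ℝ ∞ (fun x => ∑ i, X x i • T x (basisVec i)) U :=
    ContDiffOn.sum fun i _ => ((contDiffOn_euclidean.1 hX) i).smul (hT.smooth _)
  exact h.congr fun x hx => IsLinearMap.eq_sum_basisVec (hT.lin x hx) _

theorem differentiableAt (hT : IsTensor₁ U T) (hU : IsOpen U) (hx : x ∈ U) (u : Coord n) :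
    DifferentiableAt ℝ (fun y => T y u) x :=
  ((hT.smooth u).contDiffAt (hU.mem_nhds hx)).differentiableAt (by simp)

/-- The product rule for a tensor field evaluated on a vector field. -/
theorem fderiv_apply_field (hT : IsTensor₁ U T) (hU : IsOpen U) (hx : x ∈ U)
    (hX : DifferentiableAt ℝ X x) (a : Coord n) :
    fderiv ℝ (fun y => T y (X y)) x a
      = fderiv ℝ (fun y => T y (X x)) x a + T x (fderiv ℝ X x a) := by
  have hXi : ∀ i, HasFDerivAt (fun y => X y i)
      ((EuclideanSpace.proj i).comp (fderiv ℝ X x) : Coord n →L[ℝ] ℝ) x := fun i =>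
    ((EuclideanSpace.proj i : Coord n →L[ℝ] ℝ).hasFDerivAt).comp x hX.hasFDerivAt
  have hTi : ∀ u, HasFDerivAt (fun y => T y u) (fderiv ℝ (fun y => T y u) x) x := fun u =>
    (hT.differentiableAt hU hx u).hasFDerivAt
  have h1 : HasFDerivAt (fun y => ∑ i, X y i • T y (basisVec i)) _ x :=
    HasFDerivAt.fun_sum fun i (_ : i ∈ Finset.univ) => (hXi i).smul (hTi (basisVec i))
  have h2 : HasFDerivAt (fun y => ∑ i, X x i • T y (basisVec i)) _ x :=
    HasFDerivAt.fun_sum fun i (_ : i ∈ Finset.univ) => (hTi (basisVec i)).const_smul (X x i)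
  have e1 : (fun y => T y (X y)) =ᶠ[𝓝 x] fun y => ∑ i, X y i • T y (basisVec i) := by
    filter_upwards [hU.mem_nhds hx] with y hy
    exact IsLinearMap.eq_sum_basisVec (hT.lin y hy) _
  have e2 : (fun y => T y (X x)) =ᶠ[𝓝 x] fun y => ∑ i, X x i • T y (basisVec i) := by
    filter_upwards [hU.mem_nhds hx] with y hy
    exact IsLinearMap.eq_sum_basisVec (hT.lin y hy) _
  rw [e1.fderiv_eq, e2.fderiv_eq, h1.fderiv, h2.fderiv,
    IsLinearMap.eq_sum_basisVec (hT.lin x hx) (fderiv ℝ X x a)]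
  simp [Finset.sum_add_distrib]

/-- The directional derivative of the components of a tensor field is a tensor in the remaining
slot. -/
theorem fderiv_const (hT : IsTensor₁ U T) (hU : IsOpen U) (a : Coord n) :
    IsTensor₁ U (fun x u => fderiv ℝ (fun y => T y u) x a) where
  lin x hx := by
    constructor
    · intro u v
      have : (fun y => T y (u + v)) =ᶠ[𝓝 x] fun y => T y u + T y v := by
        filter_upwards [hU.mem_nhds hx] with y hy using (hT.lin y hy).map_add u v
      rw [this.fderiv_eq,
        fderiv_fun_add (hT.differentiableAt hU hx u) (hT.differentiableAt hU hx v)]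
      rfl
    · intro c u
      have : (fun y => T y (c • u)) =ᶠ[𝓝 x] fun y => c • T y u := by
        filter_upwards [hU.mem_nhds hx] with y hy using (hT.lin y hy).map_smul c u
      rw [this.fderiv_eq, fderiv_fun_const_smul (hT.differentiableAt hU hx u)]
      rfl
  smooth u := ((hT.smooth u).fderiv_of_isOpen hU (m := ∞) (by simp)).clm_apply contDiffOn_const

end IsTensor₁

/-- The differential of a smooth function is a tensor field. -/
theorem isTensor₁_fderiv {U : Set (Coord n)} (hU : IsOpen U) {F : Coord n → V}
    (hF : ContDiffOn ℝ ∞ F U) : IsTensor₁ U (fun x a => fderiv ℝ F x a) where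
  lin x _ := (fderiv ℝ F x).toLinearMap.isLinear
  smooth u := (hF.fderiv_of_isOpen hU (m := ∞) (by simp)).clm_apply contDiffOn_const

theorem fderiv_fderiv_apply_comm {U : Set (Coord n)} (hU : IsOpen U) {F : Coord n → V}
    (hF : ContDiffOn ℝ ∞ F U) {x : Coord n} (hx : x ∈ U) (a b : Coord n) :
    fderiv ℝ (fun y => fderiv ℝ F y b) x a = fderiv ℝ (fun y => fderiv ℝ F y a) x b := by
  have hc := hF.contDiffAt (hU.mem_nhds hx)
  have hd : DifferentiableAt ℝ (fderiv ℝ F) x :=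
    ((hF.fderiv_of_isOpen hU (m := ∞) (by simp)).contDiffAt (hU.mem_nhds hx)).differentiableAt
      (by simp)
  have hs := hc.isSymmSndFDerivAt (n := ∞)
    (by simpa using WithTop.coe_le_coe.2 (le_top (a := (2 : ℕ∞))))
  rw [fderiv_clm_apply hd (by fun_prop), fderiv_clm_apply hd (by fun_prop)]
  simpa using hs a b

/-- A bilinear form given as a bare function. -/
structure IsBilin (T : Coord n → Coord n → ℝ) : Prop where
  left : ∀ v, IsLinearMap ℝ (fun u => T u v)
  right : ∀ u, IsLinearMap ℝ (T u)

/-- A smooth field of bilinear maps on `U`. -/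
structure IsTensor₂ (U : Set (Coord n)) (T : Coord n → Coord n → Coord n → V) : Prop where
  left : ∀ v, IsTensor₁ U (fun x u => T x u v)
  right : ∀ u, IsTensor₁ U (fun x v => T x u v)

/-- A smooth field of trilinear maps on `U`. -/
structure IsTensor₃ (U : Set (Coord n)) (T : Coord n → Coord n → Coord n → Coord n → V) :
    Prop where
  fst : ∀ v w, IsTensor₁ U (fun x u => T x u v w)
  snd : ∀ u w, IsTensor₁ U (fun x v => T x u v w)
  thd : ∀ u v, IsTensor₁ U (fun x w => T x u v w)

theorem IsTensor₂.isBilin {U : Set (Coord n)} {T : Coord n → Coord n → Coord n → ℝ}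
    (hT : IsTensor₂ U T) {x : Coord n} (hx : x ∈ U) : IsBilin (T x) :=
  ⟨fun v => (hT.left v).lin x hx, fun u => (hT.right u).lin x hx⟩

theorem IsTensor₂.smul {U : Set (Coord n)} {T : Coord n → Coord n → Coord n → V}
    {c : Coord n → ℝ} (hT : IsTensor₂ U T) (hc : ContDiffOn ℝ ∞ c U) :
    IsTensor₂ U (fun x u v => c x • T x u v) :=
  ⟨fun v => (hT.left v).smul hc, fun v => (hT.right v).smul hc⟩

/-! ### Metrics on a coordinate domain -/

/-- `G` is a smooth Riemannian metric on the open set `U`. -/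
structure IsMetricOn (U : Set (Coord n)) (G : Coord n → Coord n → Coord n → ℝ) : Prop where
  isOpen : IsOpen U
  tensor : IsTensor₂ U G
  symm : ∀ x ∈ U, ∀ u v, G x u v = G x v u
  pos : ∀ x ∈ U, ∀ v, v ≠ 0 → 0 < G x v v

theorem IsBilin.smul_left {T : Coord n → Coord n → ℝ} (hT : IsBilin T) (c : ℝ) (u v : Coord n) :
    T (c • u) v = c * T u v := (hT.left v).map_smul c u

/-- The Gram matrix of the coordinate basis. -/
def gram (G : Coord n → Coord n → Coord n → ℝ) (x : Coord n) : Matrix (Fin n) (Fin n) ℝ :=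
  Matrix.of fun k l => G x (basisVec k) (basisVec l)

theorem invMetric_eq (G : Coord n → Coord n → Coord n → ℝ) (x : Coord n) :
    invMetric G x = (gram G x)⁻¹ := rfl

namespace IsMetricOn

variable {U : Set (Coord n)} {G : Coord n → Coord n → Coord n → ℝ} {x : Coord n}

theorem isBilin (hG : IsMetricOn U G) (hx : x ∈ U) : IsBilin (G x) := hG.tensor.isBilin hx

theorem ext (hG : IsMetricOn U G) (hx : x ∈ U) {u v : Coord n} (h : ∀ w, G x u w = G x v w) :
    u = v := by
  by_contra hne
  have h1 := hG.pos x hx (u - v) (sub_ne_zero.2 hne)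
  have h2 := ((hG.isBilin hx).left (u - v)).map_sub u v
  simp only [h, sub_self] at h2
  exact h1.ne' h2

theorem det_gram_ne_zero (hG : IsMetricOn U G) (hx : x ∈ U) : (gram G x).det ≠ 0 := by
  intro h0
  obtain ⟨c, hc, hMc⟩ := Matrix.exists_mulVec_eq_zero_iff.2 h0
  have hne : (WithLp.toLp 2 c : Coord n) ≠ 0 := by
    intro h
    apply hc
    funext i
    simpa using congrArg (fun v : Coord n => v i) h
  refine hne (hG.ext hx fun w => ?_)
  rw [hG.symm x hx]
  have hb := hG.isBilin hx
  rw [show G x 0 w = 0 from (hb.left w).map_zero, IsLinearMap.eq_sum_basisVec (hb.left _) w]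
  refine Finset.sum_eq_zero fun i _ => ?_
  have : G x (basisVec i) (WithLp.toLp 2 c) = (gram G x).mulVec c i := by
    rw [IsLinearMap.eq_sum_basisVec (hb.right _)]
    simp [Matrix.mulVec, dotProduct, gram, mul_comm]
  rw [this, hMc]
  simp

theorem inv_mul_gram (hG : IsMetricOn U G) (hx : x ∈ U) : invMetric G x * gram G x = 1 :=
  Matrix.nonsing_inv_mul _ (isUnit_iff_ne_zero.2 (hG.det_gram_ne_zero hx))

theorem gram_symm (hG : IsMetricOn U G) (hx : x ∈ U) : (gram G x).IsSymm := by
  ext i j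
  exact hG.symm x hx _ _

theorem invMetric_symm (hG : IsMetricOn U G) (hx : x ∈ U) (k l : Fin n) :
    invMetric G x k l = invMetric G x l k := by
  have h : (invMetric G x).transpose = invMetric G x := by
    rw [invMetric_eq, Matrix.transpose_nonsing_inv, hG.gram_symm hx]
  exact congrFun (congrFun h l) k

theorem contDiffOn_det {m : ℕ} {A : Coord n → Matrix (Fin m) (Fin m) ℝ}
    (hA : ∀ i j, ContDiffOn ℝ ∞ (fun x => A x i j) U) : ContDiffOn ℝ ∞ (fun x => (A x).det) U := by
  simp only [Matrix.det_apply]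
  refine ContDiffOn.sum fun σ _ => ?_
  exact ContDiffOn.const_smul _ (contDiffOn_prod fun i _ => hA _ _)

theorem smooth_invMetric (hG : IsMetricOn U G) (k l : Fin n) :
    ContDiffOn ℝ ∞ (fun x => invMetric G x k l) U := by
  have hg : ∀ i j, ContDiffOn ℝ ∞ (fun x => gram G x i j) U := fun i j =>
    (hG.tensor.left (basisVec j)).smooth (basisVec i)
  have : ∀ x, invMetric G x k l = ((gram G x).det)⁻¹ * (gram G x).adjugate k l := fun x => by
    rw [invMetric_eq, Matrix.inv_def, Ring.inverse_eq_inv', Matrix.smul_apply, smul_eq_mul]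
  simp only [this, Matrix.adjugate_apply]
  refine (ContDiffOn.inv (contDiffOn_det hg) fun x hx => hG.det_gram_ne_zero hx).mul
    (contDiffOn_det fun i j => ?_)
  by_cases h : i = l
  · subst h
    simpa using contDiffOn_const
  · simpa [Matrix.updateRow_ne h] using hg i j

/-! ### Raising indices and contraction -/

theorem sharp_apply (G : Coord n → Coord n → Coord n → ℝ) (x : Coord n) (α : Coord n → ℝ)
    (k : Fin n) : sharp G x α k = ∑ l, invMetric G x k l * α (basisVec l) := by
  simp only [sharp, ← Finset.sum_smul]
  have := sum_smul_basisVec (WithLp.toLp 2 fun k => ∑ l, invMetric G x k l * α (basisVec l) : Coord n)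
  simp only at this
  rw [this]

theorem inner_sharp (hG : IsMetricOn U G) (hx : x ∈ U) {α : Coord n → ℝ} (hα : IsLinearMap ℝ α)
    (v : Coord n) : G x (sharp G x α) v = α v := by
  have hb := hG.isBilin hx
  have key : ∀ j, G x (sharp G x α) (basisVec j) = α (basisVec j) := fun j => by
    rw [IsLinearMap.eq_sum_basisVec (hb.left _)]
    simp only [sharp_apply, smul_eq_mul]
    have h1 : ∀ l, ∑ k, invMetric G x k l * G x (basisVec k) (basisVec j)
        = (1 : Matrix (Fin n) (Fin n) ℝ) l j := fun l => by
      rw [← hG.inv_mul_gram hx, Matrix.mul_apply]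
      exact Finset.sum_congr rfl fun k _ => by rw [hG.invMetric_symm hx k l]; rfl
    simp only [Finset.sum_mul]
    rw [Finset.sum_comm]
    calc _ = ∑ l, α (basisVec l) * ∑ k, invMetric G x k l * G x (basisVec k) (basisVec j) := by
            refine Finset.sum_congr rfl fun l _ => ?_
            rw [Finset.mul_sum]
            exact Finset.sum_congr rfl fun k _ => by ring
      _ = _ := by simp [h1, Matrix.one_apply]
  rw [IsLinearMap.eq_sum_basisVec (hb.right _) v, IsLinearMap.eq_sum_basisVec hα v]
  simp only [key]

theorem sharp_eq (hG : IsMetricOn U G) (hx : x ∈ U) {α : Coord n → ℝ} {u : Coord n}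
    (h : ∀ v, G x u v = α v) : sharp G x α = u := by
  have hα : IsLinearMap ℝ α := by
    have : α = G x u := funext fun v => (h v).symm
    rw [this]; exact (hG.isBilin hx).right u
  exact hG.ext hx fun w => by rw [hG.inner_sharp hx hα, h]

theorem smooth_sharp (hG : IsMetricOn U G) {α : Coord n → Coord n → ℝ} (hα : IsTensor₁ U α) :
    ContDiffOn ℝ ∞ (fun x => sharp G x (α x)) U := by
  unfold sharp
  exact ContDiffOn.sum fun k _ => ContDiffOn.sum fun l _ =>
    ((hG.smooth_invMetric k l).mul (hα.smooth _)).smul contDiffOn_const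

theorem isTensor₁_sharp (hG : IsMetricOn U G) {T : Coord n → Coord n → Coord n → ℝ}
    (hT : IsTensor₂ U T) : IsTensor₁ U (fun x u => sharp G x (T x u)) where
  lin x hx := by
    have h := hT.isBilin hx
    constructor
    · intro u v
      refine hG.sharp_eq hx fun w => ?_
      rw [((hG.isBilin hx).left w).map_add, hG.inner_sharp hx (h.right _),
        hG.inner_sharp hx (h.right _)]
      exact ((h.left w).map_add u v).symm
    · intro c u
      refine hG.sharp_eq hx fun w => ?_
      rw [(hG.isBilin hx).smul_left, hG.inner_sharp hx (h.right _)]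
      exact ((h.left w).map_smul c u).symm
  smooth u := hG.smooth_sharp (hT.right u)

/-- The metric contraction is the trace of the associated endomorphism. -/
theorem contract_eq_sum_sharp (G : Coord n → Coord n → Coord n → ℝ) (x : Coord n)
    (T : Coord n → Coord n → ℝ) : contract G x T = ∑ k, sharp G x (T (basisVec k)) k := by
  simp only [contract, sharp_apply]

theorem smooth_contract (hG : IsMetricOn U G) {T : Coord n → Coord n → Coord n → ℝ}
    (hT : ∀ u v, ContDiffOn ℝ ∞ (fun x => T x u v) U) :
    ContDiffOn ℝ ∞ (fun x => contract G x (T x)) U := by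
  unfold contract
  exact ContDiffOn.sum fun k _ => ContDiffOn.sum fun l _ => (hG.smooth_invMetric k l).mul (hT _ _)

end IsMetricOn

/-- Contraction against any orthonormal basis. -/
theorem contract_eq_sum_orthonormal {G : Coord n → Coord n → Coord n → ℝ} {x : Coord n}
    (hb : IsBilin (G x)) {e : Fin n → Coord n}
    (he : ∀ i j, G x (e i) (e j) = if i = j then 1 else 0) {T : Coord n → Coord n → ℝ}
    (hT : IsBilin T) : contract G x T = ∑ i, T (e i) (e i) := by
  set A : Matrix (Fin n) (Fin n) ℝ := Matrix.of fun i k => e i k with hA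
  have expand : ∀ {S : Coord n → Coord n → ℝ}, IsBilin S → ∀ i j,
      S (e i) (e j) = ∑ k, ∑ l, A i k * A j l * S (basisVec k) (basisVec l) := by
    intro S hS i j
    rw [IsLinearMap.eq_sum_basisVec (hS.left _)]
    refine Finset.sum_congr rfl fun k _ => ?_
    rw [IsLinearMap.eq_sum_basisVec (hS.right _), smul_eq_mul, Finset.mul_sum]
    refine Finset.sum_congr rfl fun l _ => ?_
    simp only [hA, Matrix.of_apply, smul_eq_mul]; ring
  have h1 : A * (gram G x * A.transpose) = 1 := by
    ext i j
    rw [Matrix.one_apply, ← he i j, expand hb i j, Matrix.mul_apply]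
    refine Finset.sum_congr rfl fun k _ => ?_
    rw [Matrix.mul_apply, Finset.mul_sum]
    refine Finset.sum_congr rfl fun l _ => ?_
    simp only [gram, Matrix.of_apply, Matrix.transpose_apply]; ring
  have h2 : gram G x * (A.transpose * A) = 1 := by
    rw [← Matrix.mul_assoc]; exact mul_eq_one_comm.1 h1
  have h3 : invMetric G x = A.transpose * A := Matrix.inv_eq_right_inv h2
  simp only [contract, h3, expand hT, Matrix.mul_apply, Matrix.transpose_apply, Finset.sum_mul]
  rw [Finset.sum_comm' (t' := Finset.univ) (s' := fun _ => Finset.univ) (by simp)]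
  rw [Finset.sum_comm]
  conv_rhs => rw [Finset.sum_comm]
  refine Finset.sum_congr rfl fun k _ => ?_
  rw [Finset.sum_comm]

end

section

/-! ### Orthonormal bases -/

section OrthonormalBases

variable {W : Type*} [AddCommGroup W] [Module ℝ W] [FiniteDimensional ℝ W]

/-- The inner product space structure defined by a positive definite symmetric form. -/
abbrev innerCore (B : LinearMap.BilinForm ℝ W) (hs : ∀ u v, B u v = B v u)
    (hp : ∀ v, v ≠ 0 → 0 < B v v) : InnerProductSpace.Core ℝ W where
  inner u v := B u v
  conj_inner_symm u v := by simpa using hs v u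
  re_inner_nonneg v := by
    by_cases h : v = 0
    · simp [h]
    · simpa using (hp v h).le
  add_left u v w := by simp
  smul_left u v r := by simp
  definite v hv := by
    by_contra h
    exact (hp v h).ne' hv

theorem exists_orthonormal (B : LinearMap.BilinForm ℝ W) (hs : ∀ u v, B u v = B v u)
    (hp : ∀ v, v ≠ 0 → 0 < B v v) {m : ℕ} (hm : Module.finrank ℝ W = m) :
    ∃ e : Fin m → W, ∀ i j, B (e i) (e j) = if i = j then 1 else 0 := by
  let core := innerCore B hs hp
  let : NormedAddCommGroup W := core.toNormedAddCommGroup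
  let : InnerProductSpace ℝ W := InnerProductSpace.ofCore core.toCore
  subst hm
  have h := (stdOrthonormalBasis ℝ W).orthonormal
  exact ⟨stdOrthonormalBasis ℝ W, fun i j => orthonormal_iff_ite.1 h i j⟩

/-- An eigenvector `N` of a symmetric form extends, after normalization, to an orthonormal
eigenbasis, with `N` at any prescribed position. -/
theorem exists_orthonormal_eigenbasis (B S : LinearMap.BilinForm ℝ W) (hs : ∀ u v, B u v = B v u)
    (hp : ∀ v, v ≠ 0 → 0 < B v v) (hS : ∀ u v, S u v = S v u) {N : W} (hN : N ≠ 0) {t : ℝ}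
    (ht : ∀ v, S N v = t * B N v) {m : ℕ} (hm : Module.finrank ℝ W = m) (i₁ : Fin m) :
    ∃ (e : Fin m → W) (ξ : Fin m → ℝ), (∀ i j, B (e i) (e j) = if i = j then 1 else 0) ∧
      (∀ i u, S (e i) u = ξ i * B (e i) u) ∧ e i₁ = (Real.sqrt (B N N))⁻¹ • N := by
  let core := innerCore B hs hp
  let : NormedAddCommGroup W := core.toNormedAddCommGroup
  let : InnerProductSpace ℝ W := InnerProductSpace.ofCore core.toCore
  have inner_eq : ∀ u v : W, inner ℝ u v = B u v := fun _ _ => rfl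
  have key : ∀ v, B v v = 0 → v = 0 := fun v hv => by
    by_contra h
    exact (hp v h).ne' hv
  have hnd : B.Nondegenerate := ⟨fun v hv => key v (hv v), fun v hv => key v (hv v)⟩
  let A : W →ₗ[ℝ] W := (LinearMap.BilinForm.toDual B hnd).symm.toLinearMap ∘ₗ S
  have hA : ∀ u v, B (A u) v = S u v := fun u v =>
    LinearMap.BilinForm.apply_toDual_symm_apply (hB := hnd) (S u) v
  have hAs : A.IsSymmetric := fun u v => by
    rw [inner_eq, inner_eq, hA, hs, hA, hS]
  obtain ⟨k, rfl⟩ : ∃ k, m = k + 1 := ⟨m - 1, by have := i₁.2; omega⟩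
  have : Fact (Module.finrank ℝ W = k + 1) := ⟨hm⟩
  -- `A` is the symmetric endomorphism of `S`; it preserves the complement of its eigenvector `N`,
  -- where the spectral theorem applies
  set K : Submodule ℝ W := (Submodule.span ℝ {N})ᗮ with hK
  have hmem : ∀ u, u ∈ K ↔ B N u = 0 := fun u => by
    rw [hK, Submodule.mem_orthogonal_singleton_iff_inner_right, inner_eq]
  have hinv : ∀ u ∈ K, A u ∈ K := fun u hu => by
    rw [hmem] at hu ⊢
    rw [hs, hA, hS, ht, hu, mul_zero]
  have hfin : Module.finrank ℝ K = k := Submodule.finrank_orthogonal_span_singleton hN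
  have hres := hAs.restrict_invariant hinv
  let b := hres.eigenvectorBasis hfin
  have hbo : ∀ i j, B (b i : W) (b j : W) = if i = j then 1 else 0 := fun i j =>
    orthonormal_iff_ite.1 b.orthonormal i j
  have hbN : ∀ j, B N (b j : W) = 0 := fun j => (hmem _).1 (b j).2
  have hNN : 0 < B N N := hp N hN
  have hbe : ∀ j u, S (b j : W) u = hres.eigenvalues hfin j * B (b j : W) u := fun j u => by
    have h1 := congrArg (Subtype.val) (hres.apply_eigenvectorBasis hfin j)
    have h2 : A (b j : W) = hres.eigenvalues hfin j • (b j : W) := h1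
    rw [← hA, h2]; simp
  refine ⟨Fin.insertNth (α := fun _ => W) i₁ ((Real.sqrt (B N N))⁻¹ • N) fun j => (b j : W),
    Fin.insertNth (α := fun _ => ℝ) i₁ t fun j => hres.eigenvalues hfin j, ?_, ?_, ?_⟩
  · rw [Fin.forall_iff_succAbove i₁]
    refine ⟨?_, fun i => ?_⟩
    · rw [Fin.forall_iff_succAbove i₁]
      refine ⟨?_, fun j => ?_⟩
      · have h := Real.mul_self_sqrt hNN.le
        have h' : Real.sqrt (B N N) ≠ 0 := (Real.sqrt_pos.2 hNN).ne'
        simp only [Fin.insertNth_apply_same, map_smul, LinearMap.smul_apply, smul_eq_mul, if_true]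
        field_simp
        rw [sq, h]
      · simp [hbN, (Fin.succAbove_ne i₁ j).symm]
    · rw [Fin.forall_iff_succAbove i₁]
      refine ⟨?_, fun j => ?_⟩
      · simp [hs _ N, hbN, Fin.succAbove_ne i₁ i]
      · simp [hbo]
  · rw [Fin.forall_iff_succAbove i₁]
    refine ⟨fun u => ?_, fun i u => ?_⟩
    · simp [ht]; ring
    · simp [hbe]
  · simp

end OrthonormalBases

variable {n : ℕ} {V : Type*} [NormedAddCommGroup V] [NormedSpace ℝ V]
variable {U : Set (Coord n)} {G : Coord n → Coord n → Coord n → ℝ} {x : Coord n}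

theorem IsMetricOn.exists_orthonormal (hG : IsMetricOn U G) (hx : x ∈ U) :
    ∃ e : Fin n → Coord n, ∀ i j, G x (e i) (e j) = if i = j then 1 else 0 := by
  have hb := hG.isBilin hx
  exact RhoSoliton.exists_orthonormal
    (LinearMap.mk₂ ℝ (G x) (fun u v w => (hb.left w).map_add u v)
      (fun c u w => (hb.left w).map_smul c u) (fun u v w => (hb.right u).map_add v w)
      (fun c u w => (hb.right u).map_smul c w)) (hG.symm x hx) (hG.pos x hx) (by simp)

/-! ### Plugging vector fields into tensor fields -/

theorem IsTensor₁.comp {T : Coord n → Coord n → V} {S : Coord n → Coord n → Coord n}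
    (hT : IsTensor₁ U T) (hS : IsTensor₁ U S) : IsTensor₁ U (fun x u => T x (S x u)) where
  lin x hx := (((hT.lin x hx).mk' _) ∘ₗ ((hS.lin x hx).mk' _)).isLinear
  smooth u := hT.smooth_apply_field (hS.smooth u)

theorem IsTensor₂.apply_right {T : Coord n → Coord n → Coord n → V} {X : Coord n → Coord n}
    (hT : IsTensor₂ U T) (hX : ContDiffOn ℝ ∞ X U) : IsTensor₁ U (fun x u => T x u (X x)) where
  lin x hx := (hT.left (X x)).lin x hx
  smooth u := (hT.right u).smooth_apply_field hX

theorem IsTensor₂.apply_left {T : Coord n → Coord n → Coord n → V} {X : Coord n → Coord n}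
    (hT : IsTensor₂ U T) (hX : ContDiffOn ℝ ∞ X U) : IsTensor₁ U (fun x u => T x (X x) u) where
  lin x hx := (hT.right (X x)).lin x hx
  smooth u := (hT.left u).smooth_apply_field hX

theorem contract_add (G : Coord n → Coord n → Coord n → ℝ) (x : Coord n)
    (T S : Coord n → Coord n → ℝ) :
    contract G x (fun u v => T u v + S u v) = contract G x T + contract G x S := by
  simp only [contract, mul_add, Finset.sum_add_distrib]

theorem contract_sub (G : Coord n → Coord n → Coord n → ℝ) (x : Coord n)
    (T S : Coord n → Coord n → ℝ) :
    contract G x (fun u v => T u v - S u v) = contract G x T - contract G x S := by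
  simp only [contract, mul_sub, Finset.sum_sub_distrib]

theorem contract_mul_left (G : Coord n → Coord n → Coord n → ℝ) (x : Coord n) (c : ℝ)
    (T : Coord n → Coord n → ℝ) :
    contract G x (fun u v => c * T u v) = c * contract G x T := by
  simp only [contract, Finset.mul_sum]
  exact Finset.sum_congr rfl fun _ _ => Finset.sum_congr rfl fun _ _ => by ring

theorem IsMetricOn.isTensor₁_contract (hG : IsMetricOn U G)
    {T : Coord n → Coord n → Coord n → Coord n → ℝ}
    (hT : ∀ v w, IsTensor₁ U (fun x u => T x u v w)) :
    IsTensor₁ U (fun x u => contract G x (T x u)) where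
  lin x hx := by
    constructor
    · intro u v
      rw [← contract_add]
      congr 1; funext a b
      exact ((hT a b).lin x hx).map_add u v
    · intro c u
      rw [smul_eq_mul, ← contract_mul_left]
      congr 1; funext a b
      exact ((hT a b).lin x hx).map_smul c u
  smooth u := hG.smooth_contract fun v w => (hT v w).smooth u

/-! ### The Levi-Civita connection -/

namespace IsMetricOn

theorem isTensor₂_lowered_christoffel_fst (hG : IsMetricOn U G) (v : Coord n) :
    IsTensor₂ U (fun x u w => (1 / 2 : ℝ) • (dir (fun y => G y v w) x u
      + dir (fun y => G y u w) x v - dir (fun y => G y u v) x w)) := by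
  have hT := hG.tensor
  have hU := hG.isOpen
  have hf : ∀ a b, IsTensor₁ U (fun x u => dir (fun y => G y a b) x u) := fun a b =>
    isTensor₁_fderiv hU ((hT.left b).smooth a)
  refine IsTensor₂.smul ⟨fun w => ?_, fun u => ?_⟩ contDiffOn_const
  · exact ((hf v w).add ((hT.left w).fderiv_const hU v)).sub ((hT.left v).fderiv_const hU w)
  · exact (((hT.right v).fderiv_const hU u).add ((hT.right u).fderiv_const hU v)).sub (hf u v)

theorem fderiv_symm (hG : IsMetricOn U G) (hx : x ∈ U) (u v : Coord n) :
    dir (fun y => G y u v) x = dir (fun y => G y v u) x := by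
  have h : (fun y => G y u v) =ᶠ[𝓝 x] fun y => G y v u := by
    filter_upwards [hG.isOpen.mem_nhds hx] with y hy using hG.symm y hy u v
  funext a
  simp only [dir, h.fderiv_eq]

theorem christoffel_comm (hG : IsMetricOn U G) (hx : x ∈ U) (u v : Coord n) :
    christoffel G x u v = christoffel G x v u := by
  unfold christoffel
  congr 1
  funext w
  rw [hG.fderiv_symm hx u v]
  ring

theorem isTensor₂_christoffel (hG : IsMetricOn U G) : IsTensor₂ U (christoffel G) := by
  have h : ∀ v, IsTensor₁ U (fun x u => christoffel G x u v) := fun v =>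
    hG.isTensor₁_sharp (hG.isTensor₂_lowered_christoffel_fst v)
  exact ⟨h, fun u => (h u).congr fun x hx v => hG.christoffel_comm hx u v⟩

theorem inner_christoffel (hG : IsMetricOn U G) (hx : x ∈ U) (u v w : Coord n) :
    G x (christoffel G x u v) w = (1 / 2 : ℝ) * (dir (fun y => G y v w) x u
      + dir (fun y => G y u w) x v - dir (fun y => G y u v) x w) :=
  hG.inner_sharp hx (((hG.isTensor₂_lowered_christoffel_fst v).right u).lin x hx) w

/-- The Levi-Civita connection is metric. -/
theorem fderiv_metric (hG : IsMetricOn U G) (hx : x ∈ U) (a u v : Coord n) :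
    fderiv ℝ (fun y => G y u v) x a
      = G x (christoffel G x a u) v + G x u (christoffel G x a v) := by
  rw [hG.symm x hx u, hG.inner_christoffel hx, hG.inner_christoffel hx, hG.fderiv_symm hx v u]
  simp only [dir]
  ring

/-- The metric paired with two vectors, one of which is a field: product rule with the metric
connection. -/
theorem fderiv_inner_field (hG : IsMetricOn U G) (hx : x ∈ U) {X : Coord n → Coord n}
    (hX : DifferentiableAt ℝ X x) (a v : Coord n) :
    fderiv ℝ (fun y => G y (X y) v) x a
      = G x (fderiv ℝ X x a + christoffel G x a (X x)) v + G x (X x) (christoffel G x a v) := by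
  rw [(hG.tensor.left v).fderiv_apply_field hG.isOpen hx hX, hG.fderiv_metric hx,
    ((hG.isBilin hx).left v).map_add]
  ring

end IsMetricOn

theorem sum_comp_apply_comm {A B : Coord n → Coord n} (hA : IsLinearMap ℝ A)
    (hB : IsLinearMap ℝ B) :
    ∑ k, A (B (basisVec k)) k = ∑ k, B (A (basisVec k)) k := by
  have h : ∀ {A B : Coord n → Coord n}, IsLinearMap ℝ A → ∀ k,
      A (B (basisVec k)) k = ∑ j, B (basisVec k) j * A (basisVec j) k := fun {A B} hA k => by
    rw [IsLinearMap.eq_sum_basisVec hA (B (basisVec k))]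
    simp [Finset.sum_apply]
  simp only [h hA, h hB]
  rw [Finset.sum_comm]
  exact Finset.sum_congr rfl fun _ _ => Finset.sum_congr rfl fun _ _ => mul_comm _ _

theorem differentiableAt_of_contDiffOn (hU : IsOpen U) {F : Coord n → V} (hF : ContDiffOn ℝ ∞ F U)
    (hx : x ∈ U) : DifferentiableAt ℝ F x :=
  (hF.contDiffAt (hU.mem_nhds hx)).differentiableAt (by simp)

namespace IsMetricOn

/-- Contraction commutes with covariant differentiation: the trace of the derivative of the
associated endomorphism field is unaffected by the commutator with the connection form. -/
theorem dir_contract (hG : IsMetricOn U G) (hx : x ∈ U) {T : Coord n → Coord n → Coord n → ℝ}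
    (hT : IsTensor₂ U T) (a : Coord n) :
    dir (fun y => contract G y (T y)) x a = contract G x (nabla₂ G T x a) := by
  have hS := hG.isTensor₁_sharp hT
  have hU := hG.isOpen
  set S : Coord n → Coord n → Coord n := fun y u => sharp G y (T y u) with hSdef
  have hSd : ∀ u, DifferentiableAt ℝ (fun y => S y u) x := fun u => hS.differentiableAt hU hx u
  have key : ∀ u, sharp G x (nabla₂ G T x a u)
      = fderiv ℝ (fun y => S y u) x a + christoffel G x a (S x u)
        - S x (christoffel G x a u) := fun u => by
    refine hG.sharp_eq hx fun v => ?_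
    have e : (fun y => T y u v) =ᶠ[𝓝 x] fun y => G y (S y u) v := by
      filter_upwards [hU.mem_nhds hx] with y hy
      exact (hG.inner_sharp hy ((hT.right u).lin y hy) v).symm
    have h1 : G x (S x (christoffel G x a u)) v = T x (christoffel G x a u) v :=
      hG.inner_sharp hx ((hT.right _).lin x hx) v
    have h2 : G x (S x u) (christoffel G x a v) = T x u (christoffel G x a v) :=
      hG.inner_sharp hx ((hT.right _).lin x hx) _
    rw [nabla₂, dir, e.fderiv_eq, hG.fderiv_inner_field hx (hSd u),
      ((hG.isBilin hx).left v).map_sub, h1, h2]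
    ring
  have hd : HasFDerivAt (fun y => contract G y (T y))
      (∑ k, (EuclideanSpace.proj k : Coord n →L[ℝ] ℝ).comp
        (fderiv ℝ (fun y => S y (basisVec k)) x)) x := by
    simp only [contract_eq_sum_sharp]
    exact HasFDerivAt.fun_sum fun k _ =>
      ((EuclideanSpace.proj k : Coord n →L[ℝ] ℝ).hasFDerivAt).comp x (hSd (basisVec k)).hasFDerivAt
  have hcomm := sum_comp_apply_comm ((hG.isTensor₂_christoffel.right a).lin x hx) (hS.lin x hx)
  rw [contract_eq_sum_sharp, dir, hd.fderiv]
  simp only [key, PiLp.sub_apply, PiLp.add_apply, Finset.sum_add_distrib, Finset.sum_sub_distrib]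
  simp only [hcomm]
  simp

end IsMetricOn

end

section

variable {n : ℕ} {V : Type*} [NormedAddCommGroup V] [NormedSpace ℝ V]
variable {U : Set (Coord n)} {G : Coord n → Coord n → Coord n → ℝ} {x : Coord n}

/-! ### The curvature tensor -/

/-- A smooth field of quadrilinear maps on `U`. -/
structure IsTensor₄ (U : Set (Coord n)) (T : Coord n → Coord n → Coord n → Coord n → Coord n → V) :
    Prop where
  fst : ∀ v w z, IsTensor₁ U (fun x u => T x u v w z)
  snd : ∀ u w z, IsTensor₁ U (fun x v => T x u v w z)
  thd : ∀ u v z, IsTensor₁ U (fun x w => T x u v w z)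
  fth : ∀ u v w, IsTensor₁ U (fun x z => T x u v w z)

/-- The second covariant derivative `∇_v ∇_u w` of a constant field `w` along constant fields. -/
def secondCov (G : Coord n → Coord n → Coord n → ℝ) (x u v w : Coord n) : Coord n :=
  fderiv ℝ (fun y => christoffel G y u w) x v + christoffel G x v (christoffel G x u w)

theorem curvOp_eq (G : Coord n → Coord n → Coord n → ℝ) (x u v w : Coord n) :
    curvOp G x u v w = secondCov G x u v w - secondCov G x v u w := rfl

/-- `(∇_a Rm)(u, v) w`, for constant vectors. -/
def covCurvOp (G : Coord n → Coord n → Coord n → ℝ) (x a u v w : Coord n) : Coord n :=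
  fderiv ℝ (fun y => curvOp G y u v w) x a + christoffel G x a (curvOp G x u v w)
    - curvOp G x (christoffel G x a u) v w - curvOp G x u (christoffel G x a v) w
    - curvOp G x u v (christoffel G x a w)

theorem curvOp_anti (G : Coord n → Coord n → Coord n → ℝ) (x u v w : Coord n) :
    curvOp G x u v w = -curvOp G x v u w := (neg_sub _ _).symm

namespace IsMetricOn

theorem christoffel_add_right (hG : IsMetricOn U G) (hx : x ∈ U) (u v w : Coord n) :
    christoffel G x u (v + w) = christoffel G x u v + christoffel G x u w :=
  ((hG.isTensor₂_christoffel.right u).lin x hx).map_add v w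

theorem christoffel_sub_right (hG : IsMetricOn U G) (hx : x ∈ U) (u v w : Coord n) :
    christoffel G x u (v - w) = christoffel G x u v - christoffel G x u w :=
  ((hG.isTensor₂_christoffel.right u).lin x hx).map_sub v w

theorem smooth_christoffel (hG : IsMetricOn U G) (u v : Coord n) :
    ContDiffOn ℝ ∞ (fun x => christoffel G x u v) U :=
  (hG.isTensor₂_christoffel.left v).smooth u

theorem isTensor₃_secondCov (hG : IsMetricOn U G) : IsTensor₃ U (secondCov G) := by
  have hΓ := hG.isTensor₂_christoffel
  have hU := hG.isOpen
  refine ⟨fun v w => ?_, fun u w => ?_, fun u v => ?_⟩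
  · exact ((hΓ.left w).fderiv_const hU v).add ((hΓ.right v).comp (hΓ.left w))
  · exact (isTensor₁_fderiv hU (hG.smooth_christoffel u w)).add
      (hΓ.apply_right (hG.smooth_christoffel u w))
  · exact ((hΓ.right u).fderiv_const hU v).add ((hΓ.right v).comp (hΓ.right u))

theorem isTensor₃_curvOp (hG : IsMetricOn U G) : IsTensor₃ U (curvOp G) := by
  have h := hG.isTensor₃_secondCov
  exact ⟨fun v w => (h.fst v w).sub (h.snd v w), fun u w => (h.snd u w).sub (h.fst u w),
    fun u v => (h.thd u v).sub (h.thd v u)⟩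

theorem isTensor₄_curv (hG : IsMetricOn U G) : IsTensor₄ U (curv G) := by
  have h := hG.isTensor₃_curvOp
  exact ⟨fun v w z => (hG.tensor.left z).comp (h.fst v w),
    fun u w z => (hG.tensor.left z).comp (h.snd u w),
    fun u v z => (hG.tensor.left z).comp (h.thd u v),
    fun u v w => hG.tensor.apply_left ((h.thd u v).smooth w)⟩

theorem curv_anti_left (hG : IsMetricOn U G) (hx : x ∈ U) (u v w z : Coord n) :
    curv G x u v w z = -curv G x v u w z := by
  unfold curv
  rw [curvOp_anti, ((hG.isBilin hx).left z).map_neg]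

/-- The curvature is skew in its last two arguments: differentiate `g(w, z)` twice. -/
theorem curv_anti_right (hG : IsMetricOn U G) (hx : x ∈ U) (u v w z : Coord n) :
    curv G x u v w z = -curv G x u v z w := by
  have hU := hG.isOpen
  have hsecond : ∀ u v, fderiv ℝ (fun y => fderiv ℝ (fun t => G t w z) y u) x v
      = G x (secondCov G x u v w) z + G x w (secondCov G x u v z)
        + (G x (christoffel G x u w) (christoffel G x v z)
          + G x (christoffel G x v w) (christoffel G x u z)) := fun u v => by
    have e : (fun y => fderiv ℝ (fun t => G t w z) y u) =ᶠ[𝓝 x] fun y =>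
        G y (christoffel G y u w) z + G y (christoffel G y u z) w := by
      filter_upwards [hU.mem_nhds hx] with y hy
      rw [hG.fderiv_metric hy, hG.symm y hy w]
    have d : ∀ w z, DifferentiableAt ℝ (fun y => G y (christoffel G y u w) z) x := fun w z =>
      differentiableAt_of_contDiffOn hU
        ((hG.tensor.left z).smooth_apply_field (hG.smooth_christoffel u w)) hx
    have dΓ : ∀ w, DifferentiableAt ℝ (fun y => christoffel G y u w) x := fun w =>
      differentiableAt_of_contDiffOn hU (hG.smooth_christoffel u w) hx
    rw [e.fderiv_eq, fderiv_fun_add (d w z) (d z w), add_apply,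
      hG.fderiv_inner_field hx (dΓ w), hG.fderiv_inner_field hx (dΓ z),
      hG.symm x hx w, hG.symm x hx (christoffel G x v w)]
    simp only [secondCov]
    ring
  have hc := fderiv_fderiv_apply_comm hU ((hG.tensor.left z).smooth w) hx v u
  rw [hsecond, hsecond] at hc
  have hb := hG.isBilin hx
  rw [curv, curv, curvOp_eq, curvOp_eq, (hb.left _).map_sub, (hb.left _).map_sub,
    hG.symm x hx _ w, hG.symm x hx _ w]
  linarith

theorem secondCov_comm (hG : IsMetricOn U G) (hx : x ∈ U) (u v w : Coord n) :
    secondCov G x u v w = secondCov G x w v u := by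
  have e : (fun y => christoffel G y u w) =ᶠ[𝓝 x] fun y => christoffel G y w u := by
    filter_upwards [hG.isOpen.mem_nhds hx] with y hy using hG.christoffel_comm hy u w
  rw [secondCov, secondCov, e.fderiv_eq, hG.christoffel_comm hx u w]

/-- The first Bianchi identity. -/
theorem curv_cyclic (hG : IsMetricOn U G) (hx : x ∈ U) (u v w z : Coord n) :
    curv G x u v w z + curv G x v w u z + curv G x w u v z = 0 := by
  have hb := hG.isBilin hx
  unfold curv
  rw [← (hb.left z).map_add, ← (hb.left z).map_add, curvOp_eq, curvOp_eq, curvOp_eq,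
    hG.secondCov_comm hx w v u, hG.secondCov_comm hx v u w, hG.secondCov_comm hx u w v]
  rw [← (hb.left z).map_zero]
  congr 1
  abel

theorem curv_pair (hG : IsMetricOn U G) (hx : x ∈ U) (u v w z : Coord n) :
    curv G x u v w z = curv G x w z u v := by
  have h1 := hG.curv_cyclic hx u v w z
  have h2 := hG.curv_cyclic hx v w z u
  have h3 := hG.curv_cyclic hx w z u v
  have h4 := hG.curv_cyclic hx z u v w
  have a1 := hG.curv_anti_right hx v w u z
  have a2 := hG.curv_anti_right hx w u v z
  have a3 := hG.curv_anti_right hx u v w z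
  have a4 := hG.curv_anti_right hx w z v u
  have a5 := hG.curv_anti_right hx z v w u
  have a6 := hG.curv_anti_right hx z u w v
  have a7 := hG.curv_anti_right hx u w z v
  have a8 := hG.curv_anti_right hx v z u w
  have b1 := hG.curv_anti_left hx w u v z
  have b2 := hG.curv_anti_left hx w u z v
  have b3 := hG.curv_anti_left hx v z u w
  have b4 := hG.curv_anti_left hx v z w u
  have b5 := hG.curv_anti_left hx v w z u
  linarith

/-- The covariant derivative of the curvature tensor through that of the curvature operator. -/
theorem nabla₄_curv (hG : IsMetricOn U G) (hx : x ∈ U) (a u v w z : Coord n) :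
    nabla₄ G (curv G) x a u v w z = G x (covCurvOp G x a u v w) z := by
  have hb := hG.isBilin hx
  have hd : DifferentiableAt ℝ (fun y => curvOp G y u v w) x :=
    differentiableAt_of_contDiffOn hG.isOpen ((hG.isTensor₃_curvOp.fst v w).smooth u) hx
  rw [nabla₄, dir]
  simp only [curv]
  rw [hG.fderiv_inner_field hx hd, covCurvOp]
  simp only [(hb.left z).map_sub]
  ring

/-- The second Bianchi identity for the curvature operator: second derivatives of the connection
cancel by symmetry, and the torsion terms by symmetry of the connection. -/
theorem covCurvOp_cyclic (hG : IsMetricOn U G) (hx : x ∈ U) (a u v w : Coord n) :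
    covCurvOp G x a u v w + covCurvOp G x u v a w + covCurvOp G x v a u w = 0 := by
  have hU := hG.isOpen
  have hΓ := hG.isTensor₂_christoffel
  have hS : ∀ a u v w, fderiv ℝ (fun y => secondCov G y u v w) x a
      = fderiv ℝ (fun y => fderiv ℝ (fun t => christoffel G t u w) y v) x a
        + fderiv ℝ (fun y => christoffel G y v (christoffel G x u w)) x a
        + christoffel G x v (fderiv ℝ (fun y => christoffel G y u w) x a) := fun a u v w => by
    have d1 : DifferentiableAt ℝ (fun y => fderiv ℝ (fun t => christoffel G t u w) y v) x :=
      (isTensor₁_fderiv hU (hG.smooth_christoffel u w)).differentiableAt hU hx v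
    have d2 : DifferentiableAt ℝ (fun y => christoffel G y v (christoffel G y u w)) x :=
      differentiableAt_of_contDiffOn hU
        ((hΓ.right v).smooth_apply_field (hG.smooth_christoffel u w)) hx
    simp only [secondCov]
    rw [fderiv_fun_add d1 d2, add_apply,
      (hΓ.right v).fderiv_apply_field hU hx
        (differentiableAt_of_contDiffOn hU (hG.smooth_christoffel u w) hx), add_assoc]
  have hR : ∀ a u v w, fderiv ℝ (fun y => curvOp G y u v w) x a
      = fderiv ℝ (fun y => secondCov G y u v w) x a
        - fderiv ℝ (fun y => secondCov G y v u w) x a := fun a u v w => by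
    have d : ∀ u v, DifferentiableAt ℝ (fun y => secondCov G y u v w) x := fun u v =>
      (hG.isTensor₃_secondCov.fst v w).differentiableAt hU hx u
    simp only [curvOp_eq]
    rw [fderiv_fun_sub (d u v) (d v u), sub_apply]
  have hsymm : ∀ a u v, fderiv ℝ (fun y => fderiv ℝ (fun t => christoffel G t u w) y v) x a
      = fderiv ℝ (fun y => fderiv ℝ (fun t => christoffel G t u w) y a) x v := fun a u v =>
    fderiv_fderiv_apply_comm hU (hG.smooth_christoffel u w) hx a v
  have htor : ∀ a u v, curvOp G x (christoffel G x a u) v w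
      + curvOp G x v (christoffel G x u a) w = 0 := fun a u v => by
    rw [hG.christoffel_comm hx u a, curvOp_anti G x v, add_neg_cancel]
  have t1 := htor a u v
  have t2 := htor u v a
  have t3 := htor v a u
  have hrest : ∀ a u v, fderiv ℝ (fun y => curvOp G y u v w) x a
      + christoffel G x a (curvOp G x u v w) - curvOp G x u v (christoffel G x a w)
      = (fderiv ℝ (fun y => fderiv ℝ (fun t => christoffel G t u w) y v) x a
          - fderiv ℝ (fun y => fderiv ℝ (fun t => christoffel G t v w) y u) x a)
        + (fderiv ℝ (fun y => christoffel G y v (christoffel G x u w)) x a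
          - fderiv ℝ (fun y => christoffel G y u (christoffel G x v w)) x a)
        + (christoffel G x v (fderiv ℝ (fun y => christoffel G y u w) x a)
          - christoffel G x u (fderiv ℝ (fun y => christoffel G y v w) x a))
        + (christoffel G x a (fderiv ℝ (fun y => christoffel G y u w) x v)
          + christoffel G x a (christoffel G x v (christoffel G x u w))
          - christoffel G x a (fderiv ℝ (fun y => christoffel G y v w) x u)
          - christoffel G x a (christoffel G x u (christoffel G x v w)))
        - (fderiv ℝ (fun y => christoffel G y u (christoffel G x a w)) x v
          + christoffel G x v (christoffel G x u (christoffel G x a w))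
          - fderiv ℝ (fun y => christoffel G y v (christoffel G x a w)) x u
          - christoffel G x u (christoffel G x v (christoffel G x a w))) := fun a u v => by
    rw [hR, hS, hS, curvOp_eq, curvOp_eq, hG.christoffel_sub_right hx]
    simp only [secondCov, hG.christoffel_add_right hx]
    abel
  have hsum : covCurvOp G x a u v w + covCurvOp G x u v a w + covCurvOp G x v a u w
      = (fderiv ℝ (fun y => curvOp G y u v w) x a
          + christoffel G x a (curvOp G x u v w) - curvOp G x u v (christoffel G x a w))
        + (fderiv ℝ (fun y => curvOp G y v a w) x u
          + christoffel G x u (curvOp G x v a w) - curvOp G x v a (christoffel G x u w))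
        + (fderiv ℝ (fun y => curvOp G y a u w) x v
          + christoffel G x v (curvOp G x a u w) - curvOp G x a u (christoffel G x v w))
        - (curvOp G x (christoffel G x a u) v w + curvOp G x v (christoffel G x u a) w)
        - (curvOp G x (christoffel G x u v) a w + curvOp G x a (christoffel G x v u) w)
        - (curvOp G x (christoffel G x v a) u w + curvOp G x u (christoffel G x a v) w) := by
    simp only [covCurvOp]
    abel
  rw [hsum, t1, t2, t3, hrest, hrest, hrest, hsymm a u v, hsymm a v u, hsymm u a v]
  abel

theorem second_bianchi (hG : IsMetricOn U G) (hx : x ∈ U) (a u v w z : Coord n) :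
    nabla₄ G (curv G) x a u v w z + nabla₄ G (curv G) x u v a w z
      + nabla₄ G (curv G) x v a u w z = 0 := by
  have hb := hG.isBilin hx
  rw [hG.nabla₄_curv hx, hG.nabla₄_curv hx, hG.nabla₄_curv hx, ← (hb.left z).map_add,
    ← (hb.left z).map_add, hG.covCurvOp_cyclic hx, (hb.left z).map_zero]

end IsMetricOn

end

section

variable {n : ℕ} {V : Type*} [NormedAddCommGroup V] [NormedSpace ℝ V]
variable {U : Set (Coord n)} {G : Coord n → Coord n → Coord n → ℝ} {x : Coord n}

/-! ### Covariant derivatives of tensor fields -/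

namespace IsMetricOn

theorem isTensor₃_nabla₂ (hG : IsMetricOn U G) {T : Coord n → Coord n → Coord n → ℝ}
    (hT : IsTensor₂ U T) : IsTensor₃ U (nabla₂ G T) := by
  have hΓ := hG.isTensor₂_christoffel
  have hU := hG.isOpen
  have hs := hG.smooth_christoffel
  refine ⟨fun u v => ?_, fun a v => ?_, fun a u => ?_⟩
  · exact ((isTensor₁_fderiv hU ((hT.left v).smooth u)).sub
      ((hT.left v).comp (hΓ.left u))).sub ((hT.right u).comp (hΓ.left v))
  · exact (((hT.left v).fderiv_const hU a).sub ((hT.left v).comp (hΓ.right a))).sub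
      (hT.apply_right (hs a v))
  · exact (((hT.right u).fderiv_const hU a).sub (hT.apply_left (hs a u))).sub
      ((hT.right u).comp (hΓ.right a))

theorem isTensor₄_nabla₃ (hG : IsMetricOn U G) {T : Coord n → Coord n → Coord n → Coord n → ℝ}
    (hT : IsTensor₃ U T) : IsTensor₄ U (nabla₃ G T) := by
  have hΓ := hG.isTensor₂_christoffel
  have hU := hG.isOpen
  have hs := hG.smooth_christoffel
  have h12 : ∀ w, IsTensor₂ U (fun x u v => T x u v w) := fun w =>
    ⟨fun v => hT.fst v w, fun u => hT.snd u w⟩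
  have h13 : ∀ v, IsTensor₂ U (fun x u w => T x u v w) := fun v =>
    ⟨fun w => hT.fst v w, fun u => hT.thd u v⟩
  have h23 : ∀ u, IsTensor₂ U (fun x v w => T x u v w) := fun u =>
    ⟨fun w => hT.snd u w, fun v => hT.thd u v⟩
  refine ⟨fun u v w => ?_, fun a v w => ?_, fun a u w => ?_, fun a u v => ?_⟩
  · exact (((isTensor₁_fderiv hU ((hT.fst v w).smooth u)).sub
      ((hT.fst v w).comp (hΓ.left u))).sub ((hT.snd u w).comp (hΓ.left v))).sub
      ((hT.thd u v).comp (hΓ.left w))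
  · exact ((((hT.fst v w).fderiv_const hU a).sub ((hT.fst v w).comp (hΓ.right a))).sub
      ((h12 w).apply_right (hs a v))).sub ((h13 v).apply_right (hs a w))
  · exact ((((hT.snd u w).fderiv_const hU a).sub ((h12 w).apply_left (hs a u))).sub
      ((hT.snd u w).comp (hΓ.right a))).sub ((h23 u).apply_right (hs a w))
  · exact ((((hT.thd u v).fderiv_const hU a).sub ((h13 v).apply_left (hs a u))).sub
      ((h23 u).apply_left (hs a v))).sub ((hT.thd u v).comp (hΓ.right a))

end IsMetricOn

theorem dir_congr (hU : IsOpen U) (hx : x ∈ U) {F H : Coord n → ℝ} (h : ∀ y ∈ U, F y = H y) :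
    dir F x = dir H x := by
  have e : F =ᶠ[𝓝 x] H := by filter_upwards [hU.mem_nhds hx] with y hy using h y hy
  funext a
  simp only [dir, e.fderiv_eq]

theorem nabla₃_congr (hU : IsOpen U) (hx : x ∈ U) {T S : Coord n → Coord n → Coord n → Coord n → ℝ}
    (h : ∀ y ∈ U, ∀ u v w, T y u v w = S y u v w) : nabla₃ G T x = nabla₃ G S x := by
  funext a u v w
  simp only [nabla₃, h x hx, dir_congr hU hx fun y hy => h y hy u v w]

theorem dir_neg (F : Coord n → ℝ) (x a : Coord n) : dir (fun y => -F y) x a = -dir F x a := by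
  simp [dir, fderiv_fun_neg]

theorem dir_const_mul {F : Coord n → ℝ} (c : ℝ) (x a : Coord n) :
    dir (fun y => c * F y) x a = c * dir F x a := by
  have h := fderiv_const_smul_field (𝕜 := ℝ) (f := F) c
  exact congrArg (fun L => L x a) h

/-! ### Contractions -/

namespace IsMetricOn

theorem contract_swap (hG : IsMetricOn U G) (hx : x ∈ U) (T : Coord n → Coord n → ℝ) :
    contract G x (fun u v => T v u) = contract G x T := by
  unfold contract
  rw [Finset.sum_comm]
  exact Finset.sum_congr rfl fun k _ => Finset.sum_congr rfl fun l _ => by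
    rw [hG.invMetric_symm hx]

theorem contract_inner (hG : IsMetricOn U G) (hx : x ∈ U) {α : Coord n → ℝ}
    (hα : IsLinearMap ℝ α) (u : Coord n) : contract G x (fun a b => α a * G x u b) = α u := by
  rw [IsLinearMap.eq_sum_basisVec hα u, contract]
  have h : sharp G x (G x u) = u := hG.sharp_eq hx fun v => rfl
  refine Finset.sum_congr rfl fun k _ => ?_
  have hk : u k = ∑ l, invMetric G x k l * G x u (basisVec l) := by
    rw [← sharp_apply, h]
  rw [hk, smul_eq_mul, Finset.sum_mul]
  exact Finset.sum_congr rfl fun l _ => by ring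

/-- Expansion of a linear form in an orthonormal basis. -/
theorem sum_mul_inner (hG : IsMetricOn U G) (hx : x ∈ U) {e : Fin n → Coord n}
    (he : ∀ i j, G x (e i) (e j) = if i = j then 1 else 0) {α : Coord n → ℝ}
    (hα : IsLinearMap ℝ α) (u : Coord n) : ∑ i, α (e i) * G x u (e i) = α u := by
  have hb := hG.isBilin hx
  rw [← hG.contract_inner hx hα u, contract_eq_sum_orthonormal hb he]
  refine ⟨fun v => ?_, fun a => ?_⟩
  · exact ((LinearMap.mulRight ℝ (G x u v)) ∘ₗ (hα.mk' _)).isLinear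
  · exact ((LinearMap.mulLeft ℝ (α a)) ∘ₗ ((hb.right u).mk' _)).isLinear

/-! ### The Ricci tensor and the contracted Bianchi identities -/

theorem isTensor₂_ric (hG : IsMetricOn U G) : IsTensor₂ U (ric G) :=
  ⟨fun w => hG.isTensor₁_contract (T := fun x u v z => curv G x u v w z)
      fun v z => hG.isTensor₄_curv.fst v w z,
    fun u => hG.isTensor₁_contract (T := fun x w v z => curv G x u v w z)
      fun v z => hG.isTensor₄_curv.thd u v z⟩

theorem ric_comm (hG : IsMetricOn U G) (hx : x ∈ U) (u w : Coord n) :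
    ric G x u w = ric G x w u := by
  unfold ric
  rw [← hG.contract_swap hx]
  congr 1; funext v z
  exact hG.curv_pair hx u z w v

theorem smooth_scal (hG : IsMetricOn U G) : ContDiffOn ℝ ∞ (scal G) U :=
  hG.smooth_contract fun u v => (hG.isTensor₂_ric.left v).smooth u

theorem isTensor₂_curv_mid (hG : IsMetricOn U G) (u w : Coord n) :
    IsTensor₂ U (fun x v z => curv G x u v w z) :=
  ⟨fun z => hG.isTensor₄_curv.snd u w z, fun v => hG.isTensor₄_curv.fth u v w⟩

theorem nabla₂_ric (hG : IsMetricOn U G) (hx : x ∈ U) (a u w : Coord n) :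
    nabla₂ G (ric G) x a u w = contract G x fun v z => nabla₄ G (curv G) x a u v w z := by
  have h := hG.dir_contract hx (hG.isTensor₂_curv_mid u w) a
  have h' : dir (fun y => ric G y u w) x a
      = contract G x (nabla₂ G (fun x v z => curv G x u v w z) x a) := h
  rw [nabla₂, h', ric, ric, ← contract_sub, ← contract_sub]
  congr 1; funext v z
  simp only [nabla₂, nabla₄]
  ring

theorem nabla₂_ric_comm (hG : IsMetricOn U G) (hx : x ∈ U) (a u w : Coord n) :
    nabla₂ G (ric G) x a u w = nabla₂ G (ric G) x a w u := by
  have h := dir_congr hG.isOpen hx fun y hy => hG.ric_comm hy u w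
  simp only [nabla₂, h, hG.ric_comm hx _ w, hG.ric_comm hx u]
  ring

theorem dir_scal (hG : IsMetricOn U G) (hx : x ∈ U) (a : Coord n) :
    dir (scal G) x a = contract G x (nabla₂ G (ric G) x a) :=
  hG.dir_contract hx hG.isTensor₂_ric a

theorem nabla₄_curv_anti_left (hG : IsMetricOn U G) (hx : x ∈ U) (a u v w z : Coord n) :
    nabla₄ G (curv G) x a u v w z = -nabla₄ G (curv G) x a v u w z := by
  have h := dir_congr hG.isOpen hx fun y hy => hG.curv_anti_left hy u v w z
  simp only [nabla₄, h, dir_neg, hG.curv_anti_left hx _ v, hG.curv_anti_left hx u]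
  ring

theorem nabla₄_curv_anti_right (hG : IsMetricOn U G) (hx : x ∈ U) (a u v w z : Coord n) :
    nabla₄ G (curv G) x a u v w z = -nabla₄ G (curv G) x a u v z w := by
  have h := dir_congr hG.isOpen hx fun y hy => hG.curv_anti_right hy u v w z
  simp only [nabla₄, h, dir_neg, hG.curv_anti_right hx _ _ w, hG.curv_anti_right hx _ _ _ z]
  ring

theorem isBilin_nabla₄_curv (hG : IsMetricOn U G) (hx : x ∈ U) (a u w : Coord n) :
    IsBilin (fun v z => nabla₄ G (curv G) x a u v w z) := by
  have hb := hG.isBilin hx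
  have hC := hG.isTensor₄_curv
  have hΓ := hG.isTensor₂_christoffel
  have hU := hG.isOpen
  refine ⟨fun z => ?_, fun v => ?_⟩
  · have h12 : IsTensor₂ U (fun x u v => curv G x u v w z) :=
      ⟨fun v => hC.fst v w z, fun u => hC.snd u w z⟩
    have h23 : IsTensor₂ U (fun x v w => curv G x u v w z) :=
      ⟨fun w => hC.snd u w z, fun v => hC.thd u v z⟩
    have h24 : IsTensor₂ U (fun x v z => curv G x u v w z) :=
      ⟨fun z => hC.snd u w z, fun v => hC.fth u v w⟩
    exact ((((((hC.snd u w z).fderiv_const hU a).sub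
      (h12.apply_left (hG.smooth_christoffel a u))).sub ((hC.snd u w z).comp (hΓ.right a))).sub
      (h23.apply_right (hG.smooth_christoffel a w))).sub
      (h24.apply_right (hG.smooth_christoffel a z))).lin x hx
  · have h : (fun z => nabla₄ G (curv G) x a u v w z) = G x (covCurvOp G x a u v w) :=
      funext fun z => hG.nabla₄_curv hx a u v w z
    rw [h]; exact hb.right _

theorem isBilin_nabla₄_curv_div (hG : IsMetricOn U G) (hx : x ∈ U) (u v w : Coord n) :
    IsBilin (fun a z => nabla₄ G (curv G) x a u v w z) := by
  have hC := hG.isTensor₄_curv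
  have hΓ := hG.isTensor₂_christoffel
  have hU := hG.isOpen
  refine ⟨fun z => ?_, fun a => (hG.isBilin_nabla₄_curv hx a u w).right v⟩
  exact (((((isTensor₁_fderiv hU ((hC.fst v w z).smooth u)).sub
    ((hC.fst v w z).comp (hΓ.left u))).sub ((hC.snd u w z).comp (hΓ.left v))).sub
    ((hC.thd u v z).comp (hΓ.left w))).sub ((hC.fth u v w).comp (hΓ.left z))).lin x hx

/-- The contracted second Bianchi identity `∇^l R_{ijkl} = -(∇ᵢ R_{jk} - ∇ⱼ R_{ik})`. -/
theorem div_curv (hG : IsMetricOn U G) (hx : x ∈ U) (u v w : Coord n) :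
    (contract G x fun a z => nabla₄ G (curv G) x a u v w z)
      = -(nabla₂ G (ric G) x u v w - nabla₂ G (ric G) x v u w) := by
  obtain ⟨e, he⟩ := hG.exists_orthonormal hx
  have hb := hG.isBilin hx
  rw [contract_eq_sum_orthonormal hb he (hG.isBilin_nabla₄_curv_div hx u v w),
    hG.nabla₂_ric hx, hG.nabla₂_ric hx,
    contract_eq_sum_orthonormal hb he (hG.isBilin_nabla₄_curv hx u v w),
    contract_eq_sum_orthonormal hb he (hG.isBilin_nabla₄_curv hx v u w),
    ← Finset.sum_sub_distrib, ← Finset.sum_neg_distrib]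
  refine Finset.sum_congr rfl fun i _ => ?_
  have h1 := hG.second_bianchi hx (e i) u v w (e i)
  have h2 := hG.nabla₄_curv_anti_left hx v (e i) u w (e i)
  linarith

theorem isBilin_nabla₂_ric (hG : IsMetricOn U G) (hx : x ∈ U) (a : Coord n) :
    IsBilin (nabla₂ G (ric G) x a) := by
  have h := hG.isTensor₃_nabla₂ hG.isTensor₂_ric
  exact ⟨fun v => (h.snd a v).lin x hx, fun u => (h.thd a u).lin x hx⟩

theorem isBilin_nabla₂_ric_div (hG : IsMetricOn U G) (hx : x ∈ U) (u : Coord n) :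
    IsBilin (fun a v => nabla₂ G (ric G) x a u v) := by
  have h := hG.isTensor₃_nabla₂ hG.isTensor₂_ric
  exact ⟨fun v => (h.fst u v).lin x hx, fun a => (h.thd a u).lin x hx⟩

/-- The twice contracted second Bianchi identity `2 div Ric = dR`. -/
theorem div_ric (hG : IsMetricOn U G) (hx : x ∈ U) (u : Coord n) :
    (contract G x fun a v => nabla₂ G (ric G) x a u v) = 1 / 2 * dir (scal G) x u := by
  obtain ⟨e, he⟩ := hG.exists_orthonormal hx
  have hb := hG.isBilin hx
  have h1 : ∀ m, ∑ l, nabla₄ G (curv G) x (e l) u (e m) (e m) (e l)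
      = -(nabla₂ G (ric G) x u (e m) (e m) - nabla₂ G (ric G) x (e m) u (e m)) := fun m => by
    rw [← hG.div_curv hx, contract_eq_sum_orthonormal hb he (hG.isBilin_nabla₄_curv_div hx _ _ _)]
  have h2 : ∀ l, nabla₂ G (ric G) x (e l) u (e l)
      = -∑ m, nabla₄ G (curv G) x (e l) u (e m) (e m) (e l) := fun l => by
    rw [hG.nabla₂_ric hx, contract_eq_sum_orthonormal hb he (hG.isBilin_nabla₄_curv hx _ _ _),
      ← Finset.sum_neg_distrib]
    exact Finset.sum_congr rfl fun m _ => hG.nabla₄_curv_anti_right hx _ _ _ _ _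
  have h3 : ∑ l, ∑ m, nabla₄ G (curv G) x (e l) u (e m) (e m) (e l)
      = ∑ m, ∑ l, nabla₄ G (curv G) x (e l) u (e m) (e m) (e l) := Finset.sum_comm
  rw [contract_eq_sum_orthonormal hb he (hG.isBilin_nabla₂_ric_div hx u), hG.dir_scal hx,
    contract_eq_sum_orthonormal hb he (hG.isBilin_nabla₂_ric hx u)]
  have h4 := Finset.sum_congr rfl fun l (_ : l ∈ Finset.univ) => h2 l
  rw [Finset.sum_neg_distrib, h3] at h4
  simp only [h1, Finset.sum_neg_distrib, Finset.sum_sub_distrib] at h4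
  linarith

/-! ### The Weyl and Cotton tensors -/

/-- The Leibniz rule for the Weyl tensor. -/
theorem nabla₄_weyl (hG : IsMetricOn U G) (hx : x ∈ U) (a u v w z : Coord n) :
    nabla₄ G (weyl G) x a u v w z = nabla₄ G (curv G) x a u v w z
      - 1 / ((n : ℝ) - 2) * (G x u w * nabla₂ G (ric G) x a v z
        - G x u z * nabla₂ G (ric G) x a v w - G x v w * nabla₂ G (ric G) x a u z
        + G x v z * nabla₂ G (ric G) x a u w)
      + dir (scal G) x a / (((n : ℝ) - 1) * ((n : ℝ) - 2))
        * (G x u w * G x v z - G x u z * G x v w) := by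
  have hU := hG.isOpen
  have dG : ∀ u v, HasFDerivAt (fun y => G y u v) (fderiv ℝ (fun y => G y u v) x) x := fun u v =>
    ((hG.tensor.left v).differentiableAt hU hx u).hasFDerivAt
  have dr : ∀ u v, HasFDerivAt (fun y => ric G y u v) (fderiv ℝ (fun y => ric G y u v) x) x :=
    fun u v => ((hG.isTensor₂_ric.left v).differentiableAt hU hx u).hasFDerivAt
  have dc : HasFDerivAt (fun y => curv G y u v w z) (fderiv ℝ (fun y => curv G y u v w z) x) x :=
    ((hG.isTensor₄_curv.fst v w z).differentiableAt hU hx u).hasFDerivAt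
  have ds : HasFDerivAt (scal G) (fderiv ℝ (scal G) x) x :=
    (differentiableAt_of_contDiffOn hU hG.smooth_scal hx).hasFDerivAt
  have hd : HasFDerivAt (fun y => weyl G y u v w z) _ x :=
    (dc.sub ((((((dG u w).mul (dr v z)).sub ((dG u z).mul (dr v w))).sub
      ((dG v w).mul (dr u z))).add ((dG v z).mul (dr u w))).const_mul (1 / ((n : ℝ) - 2)))).add
      ((ds.mul_const ((((n : ℝ) - 1) * ((n : ℝ) - 2))⁻¹)).mul
        (((dG u w).mul (dG v z)).sub ((dG u z).mul (dG v w))))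
  rw [nabla₄, dir, hd.fderiv]
  simp only [add_apply, sub_apply, smul_apply, smul_eq_mul, hG.fderiv_metric hx]
  simp only [weyl, nabla₄, nabla₂, dir]
  ring

theorem isBilin_mul {α β : Coord n → ℝ} (hα : IsLinearMap ℝ α) (hβ : IsLinearMap ℝ β) :
    IsBilin (fun a b => α a * β b) :=
  ⟨fun v => ((LinearMap.mulRight ℝ (β v)) ∘ₗ (hα.mk' _)).isLinear,
    fun a => ((LinearMap.mulLeft ℝ (α a)) ∘ₗ (hβ.mk' _)).isLinear⟩

theorem isTensor₁_dir (hG : IsMetricOn U G) {F : Coord n → ℝ} (hF : ContDiffOn ℝ ∞ F U) :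
    IsTensor₁ U (dir F) := isTensor₁_fderiv hG.isOpen hF

/-- `∇^l W_{ijkl} = -(n - 3) / (n - 2) C_{ijk}`. -/
theorem divWeyl_eq (hG : IsMetricOn U G) (hx : x ∈ U) (hn : 3 ≤ n) (u v w : Coord n) :
    divWeyl G x u v w = -(((n : ℝ) - 3) / ((n : ℝ) - 2)) * cotton G x u v w := by
  have hn2 : (n : ℝ) - 2 ≠ 0 := by
    have : (3 : ℝ) ≤ n := by exact_mod_cast hn
    linarith
  have hn1 : (n : ℝ) - 1 ≠ 0 := by
    have : (3 : ℝ) ≤ n := by exact_mod_cast hn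
    linarith
  have hlin : ∀ v w, IsLinearMap ℝ (fun a => nabla₂ G (ric G) x a v w) := fun v w =>
    ((hG.isTensor₃_nabla₂ hG.isTensor₂_ric).fst v w).lin x hx
  have hR : IsLinearMap ℝ (dir (scal G) x) := (hG.isTensor₁_dir hG.smooth_scal).lin x hx
  have e : (fun a z => nabla₄ G (weyl G) x a u v w z) = fun a z =>
      nabla₄ G (curv G) x a u v w z
      - 1 / ((n : ℝ) - 2) * (G x u w * nabla₂ G (ric G) x a v z
        - nabla₂ G (ric G) x a v w * G x u z - G x v w * nabla₂ G (ric G) x a u z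
        + nabla₂ G (ric G) x a u w * G x v z)
      + 1 / (((n : ℝ) - 1) * ((n : ℝ) - 2)) * (G x u w * (dir (scal G) x a * G x v z)
        - G x v w * (dir (scal G) x a * G x u z)) := by
    funext a z
    rw [hG.nabla₄_weyl hx]
    ring
  rw [divWeyl, e, contract_add, contract_sub, hG.div_curv hx, contract_mul_left, contract_add,
    contract_sub, contract_sub, contract_mul_left, contract_mul_left, hG.div_ric hx, hG.div_ric hx,
    hG.contract_inner hx (hlin _ _), hG.contract_inner hx (hlin _ _), contract_mul_left,
    contract_sub, contract_mul_left, contract_mul_left, hG.contract_inner hx hR,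
    hG.contract_inner hx hR, cotton]
  field_simp
  ring

theorem isTensor₃_cotton (hG : IsMetricOn U G) : IsTensor₃ U (cotton G) := by
  have h := hG.isTensor₃_nabla₂ hG.isTensor₂_ric
  have hs := hG.isTensor₁_dir hG.smooth_scal
  have hT := hG.tensor
  have hc : ∀ {T : Coord n → Coord n → ℝ}, IsTensor₁ U T →
      IsTensor₁ U (fun x u => 1 / (2 * ((n : ℝ) - 1)) * T x u) := fun hT =>
    hT.smul contDiffOn_const
  have hsw : ∀ {S : Coord n → Coord n → ℝ} {c : Coord n → ℝ}, IsTensor₁ U S →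
      ContDiffOn ℝ ∞ c U → IsTensor₁ U (fun x u => S x u * c x) := fun hS hc =>
    (hS.smul hc).congr fun x _ u => mul_comm _ _
  refine ⟨fun v w => ?_, fun u w => ?_, fun u v => ?_⟩
  · exact ((h.fst v w).sub (h.snd v w)).sub (hc ((hs.smul ((hT.left w).smooth v)).sub
      (hsw (hT.left w) (hs.smooth v))))
  · exact ((h.snd u w).sub (h.fst u w)).sub (hc ((hsw (hT.left w) (hs.smooth u)).sub
      (hs.smul ((hT.left w).smooth u))))
  · exact ((h.thd u v).sub (h.thd v u)).sub (hc ((hsw (hT.right v) (hs.smooth u)).sub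
      (hsw (hT.right u) (hs.smooth v))))

theorem cotton_anti (G : Coord n → Coord n → Coord n → ℝ) (x u v w : Coord n) :
    cotton G x u v w = -cotton G x v u w := by
  simp only [cotton]; ring

theorem cotton_cyclic (hG : IsMetricOn U G) (hx : x ∈ U) (u v w : Coord n) :
    cotton G x u v w + cotton G x v w u + cotton G x w u v = 0 := by
  simp only [cotton]
  rw [hG.nabla₂_ric_comm hx u w v, hG.nabla₂_ric_comm hx v w u, hG.nabla₂_ric_comm hx w v u,
    hG.symm x hx w v, hG.symm x hx w u, hG.symm x hx v u]
  ring

theorem nabla₃_cotton_anti (hG : IsMetricOn U G) (hx : x ∈ U) (a u v w : Coord n) :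
    nabla₃ G (cotton G) x a u v w = -nabla₃ G (cotton G) x a v u w := by
  have h := dir_congr hG.isOpen hx fun y _ => cotton_anti G y u v w
  simp only [nabla₃, h, dir_neg, cotton_anti G x _ v, cotton_anti G x u]
  ring

theorem nabla₃_cotton_cyclic (hG : IsMetricOn U G) (hx : x ∈ U) (a u v w : Coord n) :
    nabla₃ G (cotton G) x a u v w + nabla₃ G (cotton G) x a v w u
      + nabla₃ G (cotton G) x a w u v = 0 := by
  have h : ∀ y ∈ U, cotton G y u v w = -(cotton G y v w u + cotton G y w u v) := fun y hy => by
    have := hG.cotton_cyclic hy u v w; linarith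
  have d : ∀ u v w, DifferentiableAt ℝ (fun y => cotton G y u v w) x := fun u v w =>
    (hG.isTensor₃_cotton.fst v w).differentiableAt hG.isOpen hx u
  have h' : dir (fun y => cotton G y u v w) x a
      = -(dir (fun y => cotton G y v w u) x a + dir (fun y => cotton G y w u v) x a) := by
    rw [dir_congr hG.isOpen hx h, dir_neg]
    simp only [dir]
    rw [fderiv_fun_add (d v w u) (d w u v)]; rfl
  have c1 := hG.cotton_cyclic hx (christoffel G x a u) v w
  have c2 := hG.cotton_cyclic hx u (christoffel G x a v) w
  have c3 := hG.cotton_cyclic hx u v (christoffel G x a w)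
  simp only [nabla₃, h']
  linarith

end IsMetricOn

end

section

variable {n : ℕ}
variable {U : Set (Coord n)} {G : Coord n → Coord n → Coord n → ℝ} {x : Coord n}
variable {F : Coord n → ℝ} {ρ lam : ℝ}

/-! ### Gradients and Hessians in coordinates -/

/-- The gradient of `F` with respect to `G`. -/
def grad (G : Coord n → Coord n → Coord n → ℝ) (F : Coord n → ℝ) (x : Coord n) : Coord n :=
  sharp G x (dir F x)

/-- The covariant derivative `∇_a ∇F` of the gradient. -/
def covGrad (G : Coord n → Coord n → Coord n → ℝ) (F : Coord n → ℝ) (x a : Coord n) : Coord n :=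
  fderiv ℝ (grad G F) x a + christoffel G x a (grad G F x)

namespace IsMetricOn

theorem inner_grad (hG : IsMetricOn U G) (hF : ContDiffOn ℝ ∞ F U) (hx : x ∈ U) (v : Coord n) :
    G x (grad G F x) v = dir F x v :=
  hG.inner_sharp hx ((hG.isTensor₁_dir hF).lin x hx) v

theorem smooth_grad (hG : IsMetricOn U G) (hF : ContDiffOn ℝ ∞ F U) :
    ContDiffOn ℝ ∞ (grad G F) U := hG.smooth_sharp (hG.isTensor₁_dir hF)

theorem hess_comm (hG : IsMetricOn U G) (hF : ContDiffOn ℝ ∞ F U) (hx : x ∈ U) (u v : Coord n) :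
    hess G F x u v = hess G F x v u := by
  have h := fderiv_fderiv_apply_comm hG.isOpen hF hx u v
  simp only [hess, dir, h, hG.christoffel_comm hx u v]

theorem isTensor₂_hess (hG : IsMetricOn U G) (hF : ContDiffOn ℝ ∞ F U) :
    IsTensor₂ U (hess G F) := by
  have hd := hG.isTensor₁_dir hF
  have hΓ := hG.isTensor₂_christoffel
  exact ⟨fun v => (isTensor₁_fderiv hG.isOpen (hd.smooth v)).sub (hd.comp (hΓ.left v)),
    fun u => (hd.fderiv_const hG.isOpen u).sub (hd.comp (hΓ.right u))⟩

theorem inner_covGrad (hG : IsMetricOn U G) (hF : ContDiffOn ℝ ∞ F U) (hx : x ∈ U)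
    (a v : Coord n) : G x (covGrad G F x a) v = hess G F x a v := by
  have h := dir_congr hG.isOpen hx fun y hy => hG.inner_grad hF hy v
  have h' := congrFun h a
  simp only [dir] at h'
  rw [hG.fderiv_inner_field hx (differentiableAt_of_contDiffOn hG.isOpen (hG.smooth_grad hF) hx),
    hG.inner_grad hF hx] at h'
  simp only [hess, dir, covGrad] at h' ⊢
  linarith

/-- Commuting covariant derivatives of the gradient produces curvature. -/
theorem nabla₂_hess_sub (hG : IsMetricOn U G) (hF : ContDiffOn ℝ ∞ F U) (hx : x ∈ U)
    (a u v : Coord n) : nabla₂ G (hess G F) x a u v - nabla₂ G (hess G F) x u a v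
      = curv G x a u v (grad G F x) := by
  have hU := hG.isOpen
  have hd := hG.isTensor₁_dir hF
  have hdx := hd.lin x hx
  have expand : ∀ a u, dir (fun y => hess G F y u v) x a
      = fderiv ℝ (fun y => fderiv ℝ (fun t => dir F t v) y u) x a
        - (fderiv ℝ (fun y => dir F y (christoffel G x u v)) x a
          + dir F x (fderiv ℝ (fun y => christoffel G y u v) x a)) := fun a u => by
    have d1 : DifferentiableAt ℝ (fun y => fderiv ℝ (fun t => dir F t v) y u) x :=
      (isTensor₁_fderiv hU (hd.smooth v)).differentiableAt hU hx u
    have d2 : DifferentiableAt ℝ (fun y => dir F y (christoffel G y u v)) x :=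
      differentiableAt_of_contDiffOn hU (hd.smooth_apply_field (hG.smooth_christoffel u v)) hx
    rw [← hd.fderiv_apply_field hU hx
      (differentiableAt_of_contDiffOn hU (hG.smooth_christoffel u v) hx)]
    change fderiv ℝ (fun y => fderiv ℝ (fun t => dir F t v) y u
      - dir F y (christoffel G y u v)) x a = _
    rw [fderiv_fun_sub d1 d2, sub_apply]
  have hsym := fderiv_fderiv_apply_comm hU (hd.smooth v) hx a u
  have hcurv : curv G x a u v (grad G F x)
      = dir F x (fderiv ℝ (fun y => christoffel G y a v) x u)
        + dir F x (christoffel G x u (christoffel G x a v))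
        - (dir F x (fderiv ℝ (fun y => christoffel G y u v) x a)
          + dir F x (christoffel G x a (christoffel G x u v))) := by
    rw [curv, hG.symm x hx, hG.inner_grad hF hx, curvOp, hdx.map_sub, hdx.map_add, hdx.map_add]
  rw [hcurv, nabla₂, nabla₂, expand, expand, hsym, hG.christoffel_comm hx u a]
  simp only [hess, dir]
  ring

end IsMetricOn

/-- If `p dF = dH` then `dp ∧ dF = 0`: differentiate once more. -/
theorem dir_mul_dir_comm_of_mul_dir_eq (hU : IsOpen U) {p H : Coord n → ℝ}
    (hp : ContDiffOn ℝ ∞ p U) (hF : ContDiffOn ℝ ∞ F U) (hH : ContDiffOn ℝ ∞ H U)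
    (h : ∀ y ∈ U, ∀ u, p y * dir F y u = dir H y u) (hx : x ∈ U) (u v : Coord n) :
    dir p x u * dir F x v = dir p x v * dir F x u := by
  have hdF := isTensor₁_fderiv hU hF
  have key : ∀ u v, fderiv ℝ (fun y => fderiv ℝ H y v) x u
      = p x * fderiv ℝ (fun y => fderiv ℝ F y v) x u + dir F x v * dir p x u := fun u v => by
    have e : (fun y => fderiv ℝ H y v) =ᶠ[𝓝 x] fun y => p y * fderiv ℝ F y v := by
      filter_upwards [hU.mem_nhds hx] with y hy using (h y hy v).symm
    rw [e.fderiv_eq, fderiv_fun_mul (differentiableAt_of_contDiffOn hU hp hx)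
      (hdF.differentiableAt hU hx v)]
    simp [dir]
  have h1 := fderiv_fderiv_apply_comm hU hH hx u v
  rw [key, key, fderiv_fderiv_apply_comm hU hF hx u v] at h1
  linarith

/-! ### Gradient `ρ`-Einstein solitons in coordinates -/

/-- The soliton equation on a coordinate domain, with rectifiability as a hypothesis
when `ρ = 0`. -/
structure IsSolitonOn (U : Set (Coord n)) (G : Coord n → Coord n → Coord n → ℝ)
    (F : Coord n → ℝ) (ρ lam : ℝ) : Prop where
  metric : IsMetricOn U G
  smooth : ContDiffOn ℝ ∞ F U
  eq : ∀ x ∈ U, ∀ u v, ric G x u v + hess G F x u v = (ρ * scal G x + lam) * G x u v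
  rectifiable : ρ = 0 → ∀ x ∈ U, ∀ u v,
    dir (scal G) x u * dir F x v - dir (scal G) x v * dir F x u = 0

theorem dir_factor (G : Coord n → Coord n → Coord n → ℝ) (ρ lam : ℝ) (x a : Coord n) :
    dir (fun y => ρ * scal G y + lam) x a = ρ * dir (scal G) x a := by
  rw [← dir_const_mul]
  simp only [dir]
  rw [fderiv_add_const]

theorem dir_add {A B : Coord n → ℝ} (hA : DifferentiableAt ℝ A x) (hB : DifferentiableAt ℝ B x)
    (a : Coord n) : dir (fun y => A y + B y) x a = dir A x a + dir B x a := by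
  simp only [dir]
  rw [fderiv_fun_add hA hB]
  rfl

namespace IsSolitonOn

theorem hess_eq (h : IsSolitonOn U G F ρ lam) (hx : x ∈ U) (u v : Coord n) :
    hess G F x u v = (ρ * scal G x + lam) * G x u v - ric G x u v := by
  linarith [h.eq x hx u v]

theorem smooth_factor (h : IsSolitonOn U G F ρ lam) :
    ContDiffOn ℝ ∞ (fun y => ρ * scal G y + lam) U :=
  (contDiffOn_const.mul h.metric.smooth_scal).add contDiffOn_const

/-- The skew part of `∇Ric` for a soliton. -/
theorem nabla₂_ric_sub (h : IsSolitonOn U G F ρ lam) (hx : x ∈ U) (a u v : Coord n) :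
    nabla₂ G (ric G) x a u v - nabla₂ G (ric G) x u a v
      = ρ * (dir (scal G) x a * G x u v - dir (scal G) x u * G x a v)
        - curv G x a u v (grad G F x) := by
  have hG := h.metric
  have hU := hG.isOpen
  have key : ∀ a u, nabla₂ G (ric G) x a u v
      = ρ * dir (scal G) x a * G x u v - nabla₂ G (hess G F) x a u v := fun a u => by
    have e : (fun y => ric G y u v) =ᶠ[𝓝 x] fun y =>
        (ρ * scal G y + lam) * G y u v - hess G F y u v := by
      filter_upwards [hU.mem_nhds hx] with y hy
      linarith [h.eq y hy u v]
    have d1 : DifferentiableAt ℝ (fun y => ρ * scal G y + lam) x :=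
      differentiableAt_of_contDiffOn hU h.smooth_factor hx
    have d2 : DifferentiableAt ℝ (fun y => G y u v) x :=
      (hG.tensor.left v).differentiableAt hU hx u
    have d3 : DifferentiableAt ℝ (fun y => hess G F y u v) x :=
      ((hG.isTensor₂_hess h.smooth).left v).differentiableAt hU hx u
    have h1 := dir_factor G ρ lam x a
    rw [nabla₂, dir, e.fderiv_eq, fderiv_fun_sub (d1.fun_mul d2) d3, fderiv_fun_mul d1 d2]
    simp only [sub_apply, add_apply, smul_apply, smul_eq_mul, hG.fderiv_metric hx]
    simp only [nabla₂, dir] at h1 ⊢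
    rw [h1]
    linear_combination -h.eq x hx (christoffel G x a u) v - h.eq x hx u (christoffel G x a v)
  rw [key, key, ← hG.nabla₂_hess_sub h.smooth hx]
  ring

/-- `Ric(∇F, ·) = (1 - 2 (n - 1) ρ) / 2 dR`: the trace of `nabla₂_ric_sub`, with the twice
contracted Bianchi identity on the left. -/
theorem ric_grad (h : IsSolitonOn U G F ρ lam) (hx : x ∈ U) (a : Coord n) :
    ric G x (grad G F x) a = (1 - 2 * ((n : ℝ) - 1) * ρ) / 2 * dir (scal G) x a := by
  have hG := h.metric
  have hb := hG.isBilin hx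
  have hR : IsLinearMap ℝ (dir (scal G) x) := (hG.isTensor₁_dir hG.smooth_scal).lin x hx
  have h1 := hG.dir_scal hx a
  have h2 := hG.div_ric hx a
  have htr : (contract G x fun u v => nabla₂ G (ric G) x a u v - nabla₂ G (ric G) x u a v)
      = 1 / 2 * dir (scal G) x a := by
    rw [contract_sub, h2]
    rw [← h1]; ring
  have e : (fun u v => nabla₂ G (ric G) x a u v - nabla₂ G (ric G) x u a v) = fun u v =>
      ρ * (dir (scal G) x a * G x u v - dir (scal G) x u * G x a v)
        + curv G x a u (grad G F x) v := by
    funext u v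
    rw [h.nabla₂_ric_sub hx, hG.curv_anti_right hx a u v]
    ring
  have hn : contract G x (G x) = n := by
    obtain ⟨e, he⟩ := hG.exists_orthonormal hx
    rw [contract_eq_sum_orthonormal hb he hb]
    simp [he]
  have hric : (contract G x fun u v => curv G x a u (grad G F x) v) = ric G x a (grad G F x) := rfl
  rw [e, contract_add, contract_mul_left, contract_sub, contract_mul_left,
    hG.contract_inner hx hR, hric, hG.ric_comm hx a] at htr
  change ρ * (dir (scal G) x a * contract G x (G x) - _) + _ = _ at htr
  rw [hn] at htr
  linarith

/-- `d|∇F|² = 2 (ρ R + λ) dF - 2 Ric(∇F, ·)`. -/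
theorem dir_grad_sq (h : IsSolitonOn U G F ρ lam) (hx : x ∈ U) (a : Coord n) :
    dir (fun y => dir F y (grad G F y)) x a
      = 2 * ((ρ * scal G x + lam) * dir F x a - ric G x (grad G F x) a) := by
  have hG := h.metric
  have hd := hG.isTensor₁_dir h.smooth
  have hdx := hd.lin x hx
  have h1 : dir F x (covGrad G F x a) = hess G F x a (grad G F x) := by
    rw [← hG.inner_grad h.smooth hx, hG.symm x hx, hG.inner_covGrad h.smooth hx]
  have h2 := hd.fderiv_apply_field hG.isOpen hx
    (differentiableAt_of_contDiffOn hG.isOpen (hG.smooth_grad h.smooth) hx) a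
  have h3 : hess G F x a (grad G F x)
      = fderiv ℝ (fun y => dir F y (grad G F x)) x a
        - dir F x (christoffel G x a (grad G F x)) := rfl
  have h4 := h.hess_eq hx a (grad G F x)
  rw [hG.symm x hx, hG.inner_grad h.smooth hx, hG.ric_comm hx] at h4
  rw [covGrad, hdx.map_add] at h1
  change fderiv ℝ _ x a = _
  linarith

/-- Rectifiability `dR ∧ dF = 0`. For `ρ ≠ 0`, `dir_grad_sq` and `ric_grad` present
`2 (ρ R + λ) dF` as the differential of `|∇F|² + (1 - 2 (n - 1) ρ) R`, so that its exterior
derivative `2 ρ dR ∧ dF` vanishes. -/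
theorem rect (h : IsSolitonOn U G F ρ lam) (hx : x ∈ U) (u v : Coord n) :
    dir (scal G) x u * dir F x v = dir (scal G) x v * dir F x u := by
  by_cases hρ : ρ = 0
  · linarith [h.rectifiable hρ x hx u v]
  have hG := h.metric
  have hU := hG.isOpen
  have hd := hG.isTensor₁_dir h.smooth
  have hs1 : ContDiffOn ℝ ∞ (fun y => dir F y (grad G F y)) U :=
    hd.smooth_apply_field (hG.smooth_grad h.smooth)
  have hs2 : ContDiffOn ℝ ∞ (fun y => (1 - 2 * ((n : ℝ) - 1) * ρ) * scal G y) U :=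
    contDiffOn_const.mul hG.smooth_scal
  have key := dir_mul_dir_comm_of_mul_dir_eq hU (p := fun y => 2 * (ρ * scal G y + lam))
    (H := fun y => dir F y (grad G F y) + (1 - 2 * ((n : ℝ) - 1) * ρ) * scal G y)
    (contDiffOn_const.mul h.smooth_factor) h.smooth (hs1.add hs2) (fun y hy u => by
      have e1 := h.dir_grad_sq hy u
      have e2 := h.ric_grad hy u
      have e3 := dir_const_mul (F := scal G) (1 - 2 * ((n : ℝ) - 1) * ρ) y u
      have e4 : dir (fun y => dir F y (grad G F y) + (1 - 2 * ((n : ℝ) - 1) * ρ) * scal G y) y u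
          = dir (fun y => dir F y (grad G F y)) y u
            + dir (fun y => (1 - 2 * ((n : ℝ) - 1) * ρ) * scal G y) y u :=
        dir_add (differentiableAt_of_contDiffOn hU hs1 hy)
          (differentiableAt_of_contDiffOn hU hs2 hy) u
      rw [e4, e3, e1, e2]
      ring) hx u v
  rw [dir_const_mul, dir_const_mul, dir_factor, dir_factor] at key
  have h2 : (2 * ρ) * (dir (scal G) x u * dir F x v - dir (scal G) x v * dir F x u) = 0 := by
    linarith
  rcases mul_eq_zero.1 h2 with h3 | h3
  · exact absurd (by linarith : ρ = 0) hρ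
  · linarith

/-! ### The Cotton tensor of a soliton -/

/-- The Cotton tensor of a soliton contains no derivative of the curvature other than `dR`. -/
theorem cotton_eq (h : IsSolitonOn U G F ρ lam) (hx : x ∈ U) (u v w : Coord n) :
    cotton G x u v w = -curv G x u v w (grad G F x) + (ρ - 1 / (2 * ((n : ℝ) - 1)))
      * (dir (scal G) x u * G x v w - dir (scal G) x v * G x u w) := by
  rw [cotton, h.nabla₂_ric_sub hx]
  ring

/-- The curvature term vanishes by skew symmetry and the trace term by rectifiability. -/
theorem cotton_grad (h : IsSolitonOn U G F ρ lam) (hx : x ∈ U) (u v : Coord n) :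
    cotton G x u v (grad G F x) = 0 := by
  have hG := h.metric
  have h1 := hG.curv_anti_right hx u v (grad G F x) (grad G F x)
  rw [h.cotton_eq hx, hG.symm x hx v, hG.symm x hx u, hG.inner_grad h.smooth hx,
    hG.inner_grad h.smooth hx, h.rect hx u v]
  linarith

/-- Differentiating `C(u, v, ∇F) = 0`. -/
theorem nabla₃_cotton_grad (h : IsSolitonOn U G F ρ lam) (hx : x ∈ U) (a u v : Coord n) :
    nabla₃ G (cotton G) x a u v (grad G F x) = -cotton G x u v (covGrad G F x a) := by
  have hG := h.metric
  have h0 := dir_congr (H := fun _ => 0) hG.isOpen hx fun y hy => h.cotton_grad hy u v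
  have h1 : fderiv ℝ (fun y => cotton G y u v (grad G F y)) x a = 0 := by
    have := congrFun h0 a
    simpa [dir] using this
  rw [(hG.isTensor₃_cotton.thd u v).fderiv_apply_field hG.isOpen hx
    (differentiableAt_of_contDiffOn hG.isOpen (hG.smooth_grad h.smooth) hx)] at h1
  rw [nabla₃, h.cotton_grad hx, h.cotton_grad hx, covGrad,
    ((hG.isTensor₃_cotton.thd u v).lin x hx).map_add]
  simp only [dir]
  linarith

theorem nabla₃_cotton_eq (h : IsSolitonOn U G F ρ lam) (hx : x ∈ U) (a u v w : Coord n) :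
    nabla₃ G (cotton G) x a u v w = -(nabla₄ G (curv G) x a u v w (grad G F x)
      + curv G x u v w (covGrad G F x a)) + (ρ - 1 / (2 * ((n : ℝ) - 1)))
      * (hess G (scal G) x a u * G x v w - hess G (scal G) x a v * G x u w) := by
  have hG := h.metric
  have hU := hG.isOpen
  have hT := hG.isTensor₄_curv.fth u v w
  have dG : ∀ u v, DifferentiableAt ℝ (fun y => G y u v) x := fun u v =>
    (hG.tensor.left v).differentiableAt hU hx u
  have dR : ∀ u, DifferentiableAt ℝ (fun y => dir (scal G) y u) x := fun u =>
    (hG.isTensor₁_dir hG.smooth_scal).differentiableAt hU hx u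
  have dC : DifferentiableAt ℝ (fun y => curv G y u v w (grad G F y)) x :=
    differentiableAt_of_contDiffOn hU (hT.smooth_apply_field (hG.smooth_grad h.smooth)) hx
  have h1 := hT.fderiv_apply_field hU hx
    (differentiableAt_of_contDiffOn hU (hG.smooth_grad h.smooth) hx) a
  have h2 := congrFun (dir_congr hU hx fun y hy => h.cotton_eq hy u v w) a
  have hd : HasFDerivAt (fun y => -curv G y u v w (grad G F y) + (ρ - 1 / (2 * ((n : ℝ) - 1)))
      * (dir (scal G) y u * G y v w - dir (scal G) y v * G y u w)) _ x :=
    dC.hasFDerivAt.neg.add ((((dR u).hasFDerivAt.mul (dG v w).hasFDerivAt).sub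
      ((dR v).hasFDerivAt.mul (dG u w).hasFDerivAt)).const_mul _)
  rw [dir, dir, hd.fderiv] at h2
  simp only [add_apply, sub_apply, smul_apply, neg_apply, smul_eq_mul, hG.fderiv_metric hx] at h2
  rw [h1] at h2
  rw [nabla₃, dir, h2, covGrad, (hT.lin x hx).map_add]
  simp only [h.cotton_eq hx, nabla₄, hess, dir]
  ring

/-- The divergence of the Cotton tensor in its last slot vanishes. -/
theorem div_cotton_last (h : IsSolitonOn U G F ρ lam) (hx : x ∈ U) (u v : Coord n) :
    (contract G x fun a w => nabla₃ G (cotton G) x a u v w) = 0 := by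
  have hG := h.metric
  have hb := hG.isBilin hx
  obtain ⟨e, he⟩ := hG.exists_orthonormal hx
  have hC4 := hG.isTensor₄_curv
  have hH := (hG.isTensor₂_hess hG.smooth_scal).isBilin hx
  have h4 := hG.isTensor₄_nabla₃ hG.isTensor₃_cotton
  rw [contract_eq_sum_orthonormal hb he
    ⟨fun w => (h4.fst u v w).lin x hx, fun a => (h4.fth a u v).lin x hx⟩]
  simp only [h.nabla₃_cotton_eq hx]
  -- the divergence of the curvature, contracted with the gradient
  have h1 : ∑ i, nabla₄ G (curv G) x (e i) u v (e i) (grad G F x) = 0 := by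
    have e1 : ∑ i, nabla₄ G (curv G) x (e i) u v (e i) (grad G F x)
        = -contract G x fun a z => nabla₄ G (curv G) x a u v (grad G F x) z := by
      rw [contract_eq_sum_orthonormal hb he (hG.isBilin_nabla₄_curv_div hx _ _ _),
        ← Finset.sum_neg_distrib]
      exact Finset.sum_congr rfl fun i _ => hG.nabla₄_curv_anti_right hx _ _ _ _ _
    have h5 := hG.curv_anti_right hx u v (grad G F x) (grad G F x)
    rw [e1, hG.div_curv hx, h.nabla₂_ric_sub hx, hG.symm x hx v, hG.symm x hx u,
      hG.inner_grad h.smooth hx, hG.inner_grad h.smooth hx, h.rect hx u v]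
    linarith
  -- a skew form contracted with the symmetric Hessian
  have h2 : ∑ i, curv G x u v (e i) (covGrad G F x (e i)) = 0 := by
    have e1 : ∀ i, curv G x u v (e i) (covGrad G F x (e i))
        = ∑ j, curv G x u v (e i) (e j) * hess G F x (e i) (e j) := fun i => by
      rw [← hG.sum_mul_inner hx he ((hC4.fth u v (e i)).lin x hx)]
      exact Finset.sum_congr rfl fun j _ => by rw [hG.inner_covGrad h.smooth hx]
    simp only [e1]
    have e2 : ∑ i, ∑ j, curv G x u v (e i) (e j) * hess G F x (e i) (e j)
        = -∑ i, ∑ j, curv G x u v (e i) (e j) * hess G F x (e i) (e j) := by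
      conv_lhs => rw [Finset.sum_comm]
      rw [← Finset.sum_neg_distrib]
      refine Finset.sum_congr rfl fun i _ => ?_
      rw [← Finset.sum_neg_distrib]
      refine Finset.sum_congr rfl fun j _ => ?_
      rw [hG.curv_anti_right hx u v (e j), hG.hess_comm h.smooth hx (e j)]
      ring
    linarith
  have h3 : ∀ v w, ∑ i, hess G (scal G) x (e i) w * G x v (e i) = hess G (scal G) x v w :=
    fun v w => hG.sum_mul_inner hx he (hH.left w) v
  rw [Finset.sum_add_distrib, Finset.sum_neg_distrib, Finset.sum_add_distrib, h1, h2,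
    ← Finset.mul_sum, Finset.sum_sub_distrib, h3, h3, hG.hess_comm hG.smooth_scal hx u v]
  ring

/-- The divergence of the Cotton tensor in its first slot is symmetric: by cyclicity its skew part
is the divergence in the last slot. -/
theorem div_cotton_comm (h : IsSolitonOn U G F ρ lam) (hx : x ∈ U) (u v : Coord n) :
    (contract G x fun a k => nabla₃ G (cotton G) x a k u v)
      = contract G x fun a k => nabla₃ G (cotton G) x a k v u := by
  have hG := h.metric
  have h0 := h.div_cotton_last hx u v
  have e : (fun a w => nabla₃ G (cotton G) x a u v w) = fun a w =>
      nabla₃ G (cotton G) x a w v u - nabla₃ G (cotton G) x a w u v := by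
    funext a w
    have h1 := hG.nabla₃_cotton_cyclic hx a u v w
    have h2 := hG.nabla₃_cotton_anti hx a v w u
    linarith
  rw [e, contract_sub] at h0
  linarith

end IsSolitonOn

end

section

variable {n : ℕ}
variable {U : Set (Coord n)} {G : Coord n → Coord n → Coord n → ℝ} {x : Coord n}
variable {F : Coord n → ℝ} {ρ lam : ℝ}

/-! ### Algebra of the Weyl tensor -/

theorem isBilin_sum {T : Fin n → Coord n → Coord n → ℝ} (hT : ∀ i, IsBilin (T i)) :
    IsBilin (fun a b => ∑ i, T i a b) := by
  refine ⟨fun v => ?_, fun u => ?_⟩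
  · have : (fun u => ∑ i, T i u v) = ⇑(∑ i, ((hT i).left v).mk' _) := by
      funext u; simp
    rw [this]; exact LinearMap.isLinear _
  · have : (fun v => ∑ i, T i u v) = ⇑(∑ i, ((hT i).right u).mk' _) := by
      funext v; simp
    rw [this]; exact LinearMap.isLinear _

namespace IsMetricOn

theorem weyl_anti_left (hG : IsMetricOn U G) (hx : x ∈ U) (u v w z : Coord n) :
    weyl G x u v w z = -weyl G x v u w z := by
  simp only [weyl, hG.curv_anti_left hx u v]
  ring

theorem weyl_anti_right (hG : IsMetricOn U G) (hx : x ∈ U) (u v w z : Coord n) :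
    weyl G x u v w z = -weyl G x u v z w := by
  simp only [weyl, hG.curv_anti_right hx u v w]
  ring

theorem weyl_pair (hG : IsMetricOn U G) (hx : x ∈ U) (u v w z : Coord n) :
    weyl G x u v w z = weyl G x w z u v := by
  simp only [weyl, hG.curv_pair hx u v w]
  rw [hG.symm x hx w u, hG.symm x hx z v, hG.symm x hx w v, hG.symm x hx z u,
    hG.ric_comm hx z v, hG.ric_comm hx z u, hG.ric_comm hx w v, hG.ric_comm hx w u]
  ring

theorem isLinearMap_weyl_fst (hG : IsMetricOn U G) (hx : x ∈ U) (v w z : Coord n) :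
    IsLinearMap ℝ (fun u => weyl G x u v w z) := by
  have hC := (hG.isTensor₄_curv.fst v w z).lin x hx
  have hb := hG.isBilin hx
  have hr := hG.isTensor₂_ric.isBilin hx
  have : (fun u => weyl G x u v w z) = ⇑((hC.mk' _)
      - (1 / ((n : ℝ) - 2)) • (ric G x v z • ((hb.left w).mk' _) - ric G x v w • ((hb.left z).mk' _)
        - G x v w • ((hr.left z).mk' _) + G x v z • ((hr.left w).mk' _))
      + (scal G x / (((n : ℝ) - 1) * ((n : ℝ) - 2))) • (G x v z • ((hb.left w).mk' _)
        - G x v w • ((hb.left z).mk' _))) := by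
    funext u
    simp only [weyl, LinearMap.add_apply, LinearMap.sub_apply, LinearMap.smul_apply, smul_eq_mul,
      IsLinearMap.mk'_apply]
    ring
  rw [this]; exact LinearMap.isLinear _

theorem isLinearMap_weyl_snd (hG : IsMetricOn U G) (hx : x ∈ U) (u w z : Coord n) :
    IsLinearMap ℝ (fun v => weyl G x u v w z) := by
  have : (fun v => weyl G x u v w z) = ⇑(-((hG.isLinearMap_weyl_fst hx u w z).mk' _)) := by
    funext v; simp [hG.weyl_anti_left hx u v]
  rw [this]; exact LinearMap.isLinear _

theorem isLinearMap_weyl_thd (hG : IsMetricOn U G) (hx : x ∈ U) (u v z : Coord n) :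
    IsLinearMap ℝ (fun w => weyl G x u v w z) := by
  simp only [fun w => hG.weyl_pair hx u v w z]
  exact hG.isLinearMap_weyl_fst hx z u v

theorem isLinearMap_weyl_fth (hG : IsMetricOn U G) (hx : x ∈ U) (u v w : Coord n) :
    IsLinearMap ℝ (fun z => weyl G x u v w z) := by
  simp only [fun z => hG.weyl_pair hx u v w z]
  exact hG.isLinearMap_weyl_snd hx w u v

section OrthonormalFrame

variable {e : Fin n → Coord n}

theorem ric_eq_sum (hG : IsMetricOn U G) (hx : x ∈ U)
    (he : ∀ i j, G x (e i) (e j) = if i = j then 1 else 0) (u w : Coord n) :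
    ric G x u w = ∑ i, curv G x u (e i) w (e i) :=
  contract_eq_sum_orthonormal (hG.isBilin hx) he ((hG.isTensor₂_curv_mid u w).isBilin hx)

theorem scal_eq_sum (hG : IsMetricOn U G) (hx : x ∈ U)
    (he : ∀ i j, G x (e i) (e j) = if i = j then 1 else 0) :
    scal G x = ∑ i, ric G x (e i) (e i) :=
  contract_eq_sum_orthonormal (hG.isBilin hx) he (hG.isTensor₂_ric.isBilin hx)

theorem ricNormSq_eq_sum (hG : IsMetricOn U G) (hx : x ∈ U)
    (he : ∀ i j, G x (e i) (e j) = if i = j then 1 else 0) :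
    ricNormSq G x = ∑ i, ∑ j, ric G x (e i) (e j) * ric G x (e i) (e j) := by
  have hb := hG.isBilin hx
  have hr := hG.isTensor₂_ric.isBilin hx
  have e1 : (fun a c => contract G x fun b d => ric G x a b * ric G x c d)
      = fun a c => ∑ j, ric G x a (e j) * ric G x c (e j) := by
    funext a c
    exact contract_eq_sum_orthonormal hb he (isBilin_mul (hr.right a) (hr.right c))
  rw [ricNormSq, e1, contract_eq_sum_orthonormal hb he
    (isBilin_sum fun j => isBilin_mul (hr.left (e j)) (hr.left (e j)))]

theorem contract_ric_weyl_eq_sum (hG : IsMetricOn U G) (hx : x ∈ U)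
    (he : ∀ i j, G x (e i) (e j) = if i = j then 1 else 0) (u v : Coord n) :
    (contract G x fun k a => contract G x fun l b => ric G x k l * weyl G x u a v b)
      = ∑ i, ∑ j, ric G x (e i) (e j) * weyl G x u (e i) v (e j) := by
  have hb := hG.isBilin hx
  have hr := hG.isTensor₂_ric.isBilin hx
  have e1 : (fun k a => contract G x fun l b => ric G x k l * weyl G x u a v b)
      = fun k a => ∑ j, ric G x k (e j) * weyl G x u a v (e j) := by
    funext k a
    exact contract_eq_sum_orthonormal hb he
      (isBilin_mul (hr.right k) (hG.isLinearMap_weyl_fth hx u a v))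
  rw [e1, contract_eq_sum_orthonormal hb he
    (isBilin_sum fun j => isBilin_mul (hr.left (e j)) (hG.isLinearMap_weyl_snd hx u v (e j)))]

/-- The Weyl tensor is trace free. -/
theorem sum_weyl_eq_zero (hG : IsMetricOn U G) (hx : x ∈ U) (hn : 3 ≤ n)
    (he : ∀ i j, G x (e i) (e j) = if i = j then 1 else 0) (u w : Coord n) :
    ∑ i, weyl G x u (e i) w (e i) = 0 := by
  have hn' : (3 : ℝ) ≤ n := by exact_mod_cast hn
  have hn2 : (n : ℝ) - 2 ≠ 0 := by linarith
  have hn1 : (n : ℝ) - 1 ≠ 0 := by linarith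
  have hb := hG.isBilin hx
  have hr := hG.isTensor₂_ric.isBilin hx
  have e1 : ∀ i, weyl G x u (e i) w (e i) = curv G x u (e i) w (e i)
      - 1 / ((n : ℝ) - 2) * (G x u w * ric G x (e i) (e i) - ric G x (e i) w * G x u (e i)
        - ric G x u (e i) * G x w (e i) + ric G x u w)
      + scal G x / (((n : ℝ) - 1) * ((n : ℝ) - 2)) * (G x u w - G x (e i) w * G x u (e i)) :=
    fun i => by
      rw [weyl, he i i, if_pos rfl, hG.symm x hx w]
      ring
  simp only [e1, Finset.sum_add_distrib, Finset.sum_sub_distrib, ← Finset.mul_sum,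
    ← hG.ric_eq_sum hx he, ← hG.scal_eq_sum hx he, hG.sum_mul_inner hx he (hr.left w),
    hG.sum_mul_inner hx he (hr.right u), hG.sum_mul_inner hx he (hb.left w), Finset.sum_const,
    Finset.card_univ, Fintype.card_fin, nsmul_eq_mul]
  field_simp
  ring

end OrthonormalFrame

end IsMetricOn

/-- A trace-free algebraic curvature tensor in dimension three vanishes. -/
theorem eq_zero_of_trace_free_fin_three {W : Fin 3 → Fin 3 → Fin 3 → Fin 3 → ℝ}
    (hl : ∀ i j k l, W i j k l = -W j i k l) (hr : ∀ i j k l, W i j k l = -W i j l k)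
    (hp : ∀ i j k l, W i j k l = W k l i j) (ht : ∀ i k, ∑ j, W i j k j = 0)
    (i j k l : Fin 3) : W i j k l = 0 := by
  have zl : ∀ i k l, W i i k l = 0 := fun i k l => by linarith [hl i i k l]
  have zr : ∀ i j k, W i j k k = 0 := fun i j k => by linarith [hr i j k k]
  simp only [Fin.sum_univ_three] at ht
  have d0 := ht 0 0
  have d1 := ht 1 1
  have d2 := ht 2 2
  have o1 := ht 0 1
  have o2 := ht 0 2
  have o3 := ht 1 2
  simp only [zl, zr, zero_add, add_zero] at d0 d1 d2 o1 o2 o3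
  have f1 : W 1 0 1 0 = W 0 1 0 1 := by rw [hl, hr, neg_neg]
  have f2 : W 2 0 2 0 = W 0 2 0 2 := by rw [hl, hr, neg_neg]
  have f3 : W 2 1 2 1 = W 1 2 1 2 := by rw [hl, hr, neg_neg]
  have f4 : W 1 0 2 0 = W 0 1 0 2 := by rw [hl, hr, neg_neg]
  have f5 : W 0 1 2 1 = -W 0 1 1 2 := hr _ _ _ _
  have main : ∀ i j k l : Fin 3, i < j → k < l → W i j k l = 0 := by
    have p1 := hp 0 2 0 1
    have p2 := hp 1 2 0 1
    have p3 := hp 1 2 0 2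
    intro i j k l hij hkl
    fin_cases i <;> fin_cases j <;> first
      | exact absurd hij (by decide)
      | (fin_cases k <;> fin_cases l <;> first
          | exact absurd hkl (by decide)
          | (simp only [Fin.zero_eta, Fin.mk_one, Fin.reduceFinMk]; linarith))
  have main' : ∀ i j k l : Fin 3, i < j → W i j k l = 0 := fun i j k l hij => by
    rcases lt_trichotomy k l with h | h | h
    · exact main i j k l hij h
    · rw [h, zr]
    · rw [hr, main i j l k hij h, neg_zero]
  rcases lt_trichotomy i j with h | h | h
  · exact main' i j k l h
  · rw [h, zl]
  · rw [hl, main' j i k l h, neg_zero]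

theorem IsMetricOn.weyl_eq_zero_of_three {G : Coord 3 → Coord 3 → Coord 3 → ℝ} {U : Set (Coord 3)}
    {x : Coord 3} (hG : IsMetricOn U G) (hx : x ∈ U) {e : Fin 3 → Coord 3}
    (he : ∀ i j, G x (e i) (e j) = if i = j then 1 else 0) (u w : Coord 3) (i j : Fin 3) :
    weyl G x u (e i) w (e j) = 0 := by
  have h0 := eq_zero_of_trace_free_fin_three (W := fun i j k l => weyl G x (e i) (e j) (e k) (e l))
    (fun _ _ _ _ => hG.weyl_anti_left hx _ _ _ _) (fun _ _ _ _ => hG.weyl_anti_right hx _ _ _ _)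
    (fun _ _ _ _ => hG.weyl_pair hx _ _ _ _) fun i k => hG.sum_weyl_eq_zero hx le_rfl he _ _
  rw [← hG.sum_mul_inner hx he (hG.isLinearMap_weyl_fst hx (e i) w (e j)) u]
  refine Finset.sum_eq_zero fun a _ => ?_
  rw [← hG.sum_mul_inner hx he (hG.isLinearMap_weyl_thd hx (e a) (e i) (e j)) w]
  rw [Finset.sum_eq_zero fun b _ => by rw [h0, zero_mul], zero_mul]

/-! ### The Bach tensor of a soliton in the direction of the gradient -/

/-- The Ricci eigenvalue `Ric(∇F, ∇F) / |∇F|²` in the direction of the gradient. -/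
def radialRic (G : Coord n → Coord n → Coord n → ℝ) (F : Coord n → ℝ) (x : Coord n) : ℝ :=
  ric G x (grad G F x) (grad G F x) / G x (grad G F x) (grad G F x)

namespace IsSolitonOn

theorem ric_grad_eq (h : IsSolitonOn U G F ρ lam) (hx : x ∈ U) (hN : grad G F x ≠ 0)
    (v : Coord n) : ric G x (grad G F x) v = radialRic G F x * G x (grad G F x) v := by
  have hG := h.metric
  have hpos := hG.pos x hx _ hN
  have h1 := h.rect hx v (grad G F x)
  have h2 := hG.inner_grad h.smooth hx (grad G F x)
  rw [radialRic, div_mul_eq_mul_div, eq_div_iff hpos.ne', h.ric_grad hx, h.ric_grad hx,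
    hG.inner_grad h.smooth hx v, h2]
  linear_combination (1 - 2 * ((n : ℝ) - 1) * ρ) / 2 * h1

theorem radialRic_mul_dir (h : IsSolitonOn U G F ρ lam) (hx : x ∈ U) (hN : grad G F x ≠ 0)
    (v : Coord n) : radialRic G F x * dir F x v
      = (1 - 2 * ((n : ℝ) - 1) * ρ) / 2 * dir (scal G) x v := by
  rw [← h.ric_grad hx, h.ric_grad_eq hx hN, h.metric.inner_grad h.smooth hx]

section OrthonormalFrame

variable {e : Fin n → Coord n}

/-- The Cotton tensor is trace free; the other traces vanish by skew symmetry or follow from it. -/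
theorem sum_cotton_eq_zero (h : IsSolitonOn U G F ρ lam) (hx : x ∈ U) (hn : 3 ≤ n)
    (he : ∀ i j, G x (e i) (e j) = if i = j then 1 else 0) (v : Coord n) :
    ∑ i, cotton G x (e i) v (e i) = 0 := by
  have hG := h.metric
  have hn' : (3 : ℝ) ≤ n := by exact_mod_cast hn
  have hn1 : (n : ℝ) - 1 ≠ 0 := by linarith
  have hR : IsLinearMap ℝ (dir (scal G) x) := (hG.isTensor₁_dir hG.smooth_scal).lin x hx
  have e1 : ∀ i, cotton G x (e i) v (e i) = -curv G x v (e i) (grad G F x) (e i)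
      + (ρ - 1 / (2 * ((n : ℝ) - 1))) * (dir (scal G) x (e i) * G x v (e i)
        - dir (scal G) x v) := fun i => by
    rw [h.cotton_eq hx, he i i, if_pos rfl, hG.curv_anti_left hx (e i), hG.curv_anti_right hx v]
    ring
  simp only [e1, Finset.sum_add_distrib, Finset.sum_sub_distrib, ← Finset.mul_sum,
    Finset.sum_neg_distrib, ← hG.ric_eq_sum hx he, hG.sum_mul_inner hx he hR, Finset.sum_const,
    Finset.card_univ, Fintype.card_fin, nsmul_eq_mul]
  rw [hG.ric_comm hx, h.ric_grad hx]
  field_simp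
  ring

/-- The divergence of the Cotton tensor along the gradient, as an algebraic expression: by symmetry
of the divergence the gradient may be moved to the last slot, where `C(·, ·, ∇F) = 0` trades the
derivative of `C` for `∇²F = (ρ R + λ) g - Ric`. -/
theorem div_cotton_grad (h : IsSolitonOn U G F ρ lam) (hx : x ∈ U) (hn : 3 ≤ n)
    (he : ∀ i j, G x (e i) (e j) = if i = j then 1 else 0) (v : Coord n) :
    (contract G x fun a k => nabla₃ G (cotton G) x a k (grad G F x) v)
      = ∑ i, ∑ j, ric G x (e i) (e j) * cotton G x (e i) v (e j) := by
  have hG := h.metric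
  have hb := hG.isBilin hx
  have h4 := hG.isTensor₄_nabla₃ hG.isTensor₃_cotton
  have e1 : ∀ i, nabla₃ G (cotton G) x (e i) (e i) v (grad G F x)
      = ∑ j, ric G x (e i) (e j) * cotton G x (e i) v (e j)
        - (ρ * scal G x + lam) * cotton G x (e i) v (e i) := fun i => by
    have hl := (hG.isTensor₃_cotton.thd (e i) v).lin x hx
    rw [h.nabla₃_cotton_grad hx, ← hG.sum_mul_inner hx he hl (covGrad G F x (e i)),
      ← hG.sum_mul_inner hx he hl (e i), Finset.mul_sum, ← Finset.sum_neg_distrib,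
      ← Finset.sum_sub_distrib]
    refine Finset.sum_congr rfl fun j _ => ?_
    rw [hG.inner_covGrad h.smooth hx, h.hess_eq hx]
    ring
  rw [h.div_cotton_comm hx, contract_eq_sum_orthonormal hb he
    ⟨fun k => (h4.fst k v _).lin x hx, fun a => (h4.snd a v _).lin x hx⟩]
  simp only [e1, Finset.sum_sub_distrib, ← Finset.mul_sum, h.sum_cotton_eq_zero hx hn he]
  ring

/-- The Weyl part of the curvature in the Cotton term cancels against the Weyl term of the Bach
tensor; what remains is a multiple of the gradient. -/
theorem sum_cotton_add_sum_weyl (h : IsSolitonOn U G F ρ lam) (hx : x ∈ U) (hn : 3 ≤ n)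
    (hN : grad G F x ≠ 0) (he : ∀ i j, G x (e i) (e j) = if i = j then 1 else 0) (v : Coord n) :
    (∑ i, ∑ j, ric G x (e i) (e j) * cotton G x (e i) v (e j))
      + ∑ i, ∑ j, ric G x (e i) (e j) * weyl G x (grad G F x) (e i) v (e j)
      = (n * radialRic G F x ^ 2 - 2 * scal G x * radialRic G F x
          - (((n : ℝ) - 1) * ricNormSq G x - scal G x ^ 2)) / (((n : ℝ) - 1) * ((n : ℝ) - 2))
        * G x (grad G F x) v := by
  have hG := h.metric
  have hn' : (3 : ℝ) ≤ n := by exact_mod_cast hn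
  have hn2 : (n : ℝ) - 2 ≠ 0 := by linarith
  have hn1 : (n : ℝ) - 1 ≠ 0 := by linarith
  have hb := hG.isBilin hx
  have hr := hG.isTensor₂_ric.isBilin hx
  set N := grad G F x with hNdef
  set k := radialRic G F x with hk
  have hNv : ∀ v, ric G x N v = k * G x N v := h.ric_grad_eq hx hN
  have hvN : ∀ v, ric G x v N = k * G x N v := fun v => by rw [hG.ric_comm hx, hNv]
  have s1 : ∀ i w, ∑ j, ric G x (e i) (e j) * G x w (e j) = ric G x (e i) w := fun i w =>
    hG.sum_mul_inner hx he (hr.right (e i)) w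
  -- the coefficient of the trace part of the Cotton tensor, through the radial eigenvalue
  have hc' : ∀ w, (ρ - 1 / (2 * ((n : ℝ) - 1))) * dir (scal G) x w
      = -(k / ((n : ℝ) - 1)) * G x N w := fun w => by
    have h1 := h.radialRic_mul_dir hx hN w
    rw [← hk] at h1
    rw [hG.inner_grad h.smooth hx]
    field_simp
    linear_combination 2 * h1
  have c1 : ∀ i, ∑ j, ric G x (e i) (e j) * cotton G x (e i) v (e j)
      = -(∑ j, ric G x (e i) (e j) * curv G x (e i) v (e j) N)
        - k / ((n : ℝ) - 1) * (ric G x (e i) v * G x N (e i) - G x N v * ric G x (e i) (e i)) :=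
    fun i => by
      have e1 : ∀ j, ric G x (e i) (e j) * cotton G x (e i) v (e j)
          = -(ric G x (e i) (e j) * curv G x (e i) v (e j) N)
            - k / ((n : ℝ) - 1) * (G x N (e i) * (ric G x (e i) (e j) * G x v (e j))
              - G x N v * (ric G x (e i) (e j) * G x (e i) (e j))) := fun j => by
        rw [h.cotton_eq hx]
        linear_combination ric G x (e i) (e j) * G x v (e j) * hc' (e i)
          - ric G x (e i) (e j) * G x (e i) (e j) * hc' v
      simp only [e1, Finset.sum_sub_distrib, ← Finset.mul_sum, Finset.sum_neg_distrib, s1]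
      ring
  have w1 : ∀ i, ∑ j, ric G x (e i) (e j) * weyl G x N (e i) v (e j)
      = (∑ j, ric G x (e i) (e j) * curv G x N (e i) v (e j))
        - 1 / ((n : ℝ) - 2) * (G x N v * (∑ j, ric G x (e i) (e j) * ric G x (e i) (e j))
          - k * (ric G x (e i) v * G x N (e i)) - k ^ 2 * (G x v (e i) * G x N (e i))
          + k * G x N v * ric G x (e i) (e i))
        + scal G x / (((n : ℝ) - 1) * ((n : ℝ) - 2)) * (G x N v * ric G x (e i) (e i)
          - k * (G x v (e i) * G x N (e i))) := fun i => by
    have e1 : ∀ j, ric G x (e i) (e j) * weyl G x N (e i) v (e j)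
        = ric G x (e i) (e j) * curv G x N (e i) v (e j)
        - 1 / ((n : ℝ) - 2) * (G x N v * (ric G x (e i) (e j) * ric G x (e i) (e j))
          - ric G x (e i) v * (ric G x (e i) (e j) * G x N (e j))
          - k * G x v (e i) * (ric G x (e i) (e j) * G x N (e j))
          + k * G x N v * (ric G x (e i) (e j) * G x (e i) (e j)))
        + scal G x / (((n : ℝ) - 1) * ((n : ℝ) - 2))
          * (G x N v * (ric G x (e i) (e j) * G x (e i) (e j))
          - G x v (e i) * (ric G x (e i) (e j) * G x N (e j))) := fun j => by
      rw [weyl, hNv, hNv, hG.symm x hx (e i) v]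
      ring
    simp only [e1, Finset.sum_add_distrib, Finset.sum_sub_distrib, ← Finset.mul_sum, s1, hvN]
    ring
  -- pair symmetry matches the two curvature terms
  have hK : ∑ i, ∑ j, ric G x (e i) (e j) * curv G x N (e i) v (e j)
      = ∑ i, ∑ j, ric G x (e i) (e j) * curv G x (e i) v (e j) N := by
    rw [Finset.sum_comm]
    refine Finset.sum_congr rfl fun i _ => Finset.sum_congr rfl fun j _ => ?_
    rw [hG.ric_comm hx, hG.curv_pair hx, hG.curv_anti_left hx, hG.curv_anti_right hx, neg_neg]
  simp only [c1, w1, Finset.sum_add_distrib, Finset.sum_sub_distrib, ← Finset.mul_sum,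
    Finset.sum_neg_distrib, hG.sum_mul_inner hx he (hr.left v),
    hG.sum_mul_inner hx he (hb.right v), ← hG.scal_eq_sum hx he, ← hG.ricNormSq_eq_sum hx he, hNv,
    hK, hG.symm x hx v N]
  field_simp
  ring

end OrthonormalFrame

/-- The gradient of a soliton potential is an eigenvector of the Bach tensor. -/
theorem bachCoord_grad (h : IsSolitonOn U G F ρ lam) (hx : x ∈ U) (hn : 3 ≤ n)
    (hN : grad G F x ≠ 0) (v : Coord n) :
    bachCoord G x (grad G F x) v
      = (n * radialRic G F x ^ 2 - 2 * scal G x * radialRic G F x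
          - (((n : ℝ) - 1) * ricNormSq G x - scal G x ^ 2)) / (((n : ℝ) - 1) * ((n : ℝ) - 2) ^ 2)
        * G x (grad G F x) v := by
  have hG := h.metric
  have hn' : (3 : ℝ) ≤ n := by exact_mod_cast hn
  have hn2 : (n : ℝ) - 2 ≠ 0 := by linarith
  have hn1 : (n : ℝ) - 1 ≠ 0 := by linarith
  obtain ⟨e, he⟩ := hG.exists_orthonormal hx
  have hsum := h.sum_cotton_add_sum_weyl hx hn hN he v
  have hD := h.div_cotton_grad hx hn he v
  have hB : bachCoord G x (grad G F x) v = 1 / ((n : ℝ) - 2)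
      * ((∑ i, ∑ j, ric G x (e i) (e j) * cotton G x (e i) v (e j))
        + ∑ i, ∑ j, ric G x (e i) (e j) * weyl G x (grad G F x) (e i) v (e j)) := by
    by_cases h3 : n = 3
    · subst h3
      rw [bachCoord, if_pos rfl, hD]
      simp only [hG.weyl_eq_zero_of_three hx he, mul_zero, Finset.sum_const_zero]
      norm_num
    · have hn3 : (n : ℝ) - 3 ≠ 0 := by
        intro h0
        apply h3
        have : (n : ℝ) = 3 := by linarith
        exact_mod_cast this
      have hdiv : ∀ y ∈ U, ∀ u v w, divWeyl G y u v w
          = -(((n : ℝ) - 3) / ((n : ℝ) - 2)) * cotton G y u v w := fun y hy => hG.divWeyl_eq hy hn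
      have e1 : (fun a k => nabla₃ G (divWeyl G) x a (grad G F x) k v) = fun a k =>
          (((n : ℝ) - 3) / ((n : ℝ) - 2)) * nabla₃ G (cotton G) x a k (grad G F x) v := by
        funext a k
        rw [nabla₃_congr hG.isOpen hx hdiv]
        have h1 := hG.nabla₃_cotton_anti hx a k (grad G F x) v
        rw [h1]
        simp only [nabla₃, dir_const_mul]
        ring
      rw [bachCoord, if_neg h3, e1, contract_mul_left, hD, hG.contract_ric_weyl_eq_sum hx he]
      field_simp
  rw [hB, hsum]
  field_simp

end IsSolitonOn

end

section

variable {n : ℕ} {V : Type*} [NormedAddCommGroup V] [NormedSpace ℝ V]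
variable {U U' : Set (Coord n)} {G G' : Coord n → Coord n → Coord n → ℝ} {x : Coord n}
variable {φ : Coord n → Coord n} {F : Coord n → ℝ}

/-! ### Invariance under changes of coordinates -/

/-- `φ` maps `U'` to `U` and pulls the metric `G` back to `G'`. -/
structure IsIsometryOn (φ : Coord n → Coord n) (U' : Set (Coord n))
    (G' : Coord n → Coord n → Coord n → ℝ) (U : Set (Coord n))
    (G : Coord n → Coord n → Coord n → ℝ) : Prop where
  dom : IsMetricOn U' G'
  cod : IsMetricOn U G
  smooth : ContDiffOn ℝ ∞ φ U'
  mapsTo : ∀ x ∈ U', φ x ∈ U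
  pullback : ∀ x ∈ U', ∀ u v, G' x u v = G (φ x) (fderiv ℝ φ x u) (fderiv ℝ φ x v)

namespace IsIsometryOn

theorem isTensor₁_fderiv (h : IsIsometryOn φ U' G' U G) :
    IsTensor₁ U' (fun x u => fderiv ℝ φ x u) := RhoSoliton.isTensor₁_fderiv h.dom.isOpen h.smooth

theorem isTensor₁_comp (h : IsIsometryOn φ U' G' U G) {T : Coord n → Coord n → V}
    (hT : IsTensor₁ U T) : IsTensor₁ U' (fun x u => T (φ x) u) :=
  ⟨fun x hx => hT.lin _ (h.mapsTo x hx), fun u => (hT.smooth u).comp h.smooth h.mapsTo⟩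

theorem fderiv_comp_apply (h : IsIsometryOn φ U' G' U G) (hx : x ∈ U') {f : Coord n → V}
    (hf : ContDiffOn ℝ ∞ f U) (a : Coord n) :
    fderiv ℝ (fun y => f (φ y)) x a = fderiv ℝ f (φ x) (fderiv ℝ φ x a) := by
  have h1 := (differentiableAt_of_contDiffOn h.cod.isOpen hf (h.mapsTo x hx)).hasFDerivAt
  have h2 := (differentiableAt_of_contDiffOn h.dom.isOpen h.smooth hx).hasFDerivAt
  have h3 : HasFDerivAt (fun y => f (φ y)) _ x := h1.comp x h2
  rw [h3.fderiv]
  rfl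

theorem fderiv_surjective (h : IsIsometryOn φ U' G' U G) (hx : x ∈ U') :
    Function.Surjective (fderiv ℝ φ x) := by
  have hinj : Function.Injective (fderiv ℝ φ x).toLinearMap := by
    rw [← LinearMap.ker_eq_bot, LinearMap.ker_eq_bot']
    intro v hv
    by_contra hne
    have h1 := h.dom.pos x hx v hne
    have hv' : fderiv ℝ φ x v = 0 := hv
    rw [h.pullback x hx, hv', ((h.cod.isBilin (h.mapsTo x hx)).left 0).map_zero] at h1
    exact lt_irrefl _ h1
  exact LinearMap.surjective_of_injective hinj

/-- The product rule for the metric of two vector fields along `φ`. -/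
theorem fderiv_inner_fields (h : IsIsometryOn φ U' G' U G) (hx : x ∈ U')
    {X Y : Coord n → Coord n} (hX : ContDiffOn ℝ ∞ X U') (hY : ContDiffOn ℝ ∞ Y U')
    (a : Coord n) : fderiv ℝ (fun y => G (φ y) (X y) (Y y)) x a
      = G (φ x) (fderiv ℝ X x a + christoffel G (φ x) (fderiv ℝ φ x a) (X x)) (Y x)
        + G (φ x) (X x) (fderiv ℝ Y x a + christoffel G (φ x) (fderiv ℝ φ x a) (Y x)) := by
  have hU := h.dom.isOpen
  have hφx := h.mapsTo x hx
  have hb := h.cod.isBilin hφx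
  have hT : IsTensor₂ U' (fun y u v => G (φ y) u v) :=
    ⟨fun v => h.isTensor₁_comp (h.cod.tensor.left v), fun u => h.isTensor₁_comp (h.cod.tensor.right u)⟩
  rw [(hT.apply_right hY).fderiv_apply_field hU hx (differentiableAt_of_contDiffOn hU hX hx),
    (hT.right (X x)).fderiv_apply_field hU hx (differentiableAt_of_contDiffOn hU hY hx),
    h.fderiv_comp_apply hx ((h.cod.tensor.left (Y x)).smooth (X x)), h.cod.fderiv_metric hφx,
    (hb.left _).map_add, (hb.right _).map_add]
  ring

/-- The transformation law of the Christoffel symbols. -/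
theorem map_christoffel (h : IsIsometryOn φ U' G' U G) (hx : x ∈ U') (u v : Coord n) :
    fderiv ℝ φ x (christoffel G' x u v) = fderiv ℝ (fun y => fderiv ℝ φ y v) x u
      + christoffel G (φ x) (fderiv ℝ φ x u) (fderiv ℝ φ x v) := by
  have hU := h.dom.isOpen
  have hφx := h.mapsTo x hx
  have hP := h.isTensor₁_fderiv
  have hD : ∀ a v w, dir (fun y => G' y v w) x a
      = G (φ x) (fderiv ℝ (fun y => fderiv ℝ φ y v) x a
          + christoffel G (φ x) (fderiv ℝ φ x a) (fderiv ℝ φ x v)) (fderiv ℝ φ x w)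
        + G (φ x) (fderiv ℝ φ x v) (fderiv ℝ (fun y => fderiv ℝ φ y w) x a
          + christoffel G (φ x) (fderiv ℝ φ x a) (fderiv ℝ φ x w)) := fun a v w => by
    rw [dir_congr hU hx fun y hy => h.pullback y hy v w]
    exact h.fderiv_inner_fields hx (hP.smooth v) (hP.smooth w) a
  have hsym : ∀ a b, fderiv ℝ (fun y => fderiv ℝ φ y b) x a
      + christoffel G (φ x) (fderiv ℝ φ x a) (fderiv ℝ φ x b)
      = fderiv ℝ (fun y => fderiv ℝ φ y a) x b
      + christoffel G (φ x) (fderiv ℝ φ x b) (fderiv ℝ φ x a) := fun a b => by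
    rw [fderiv_fderiv_apply_comm hU h.smooth hx a b, h.cod.christoffel_comm hφx]
  refine h.cod.ext hφx fun w' => ?_
  obtain ⟨w, rfl⟩ := h.fderiv_surjective hx w'
  rw [← h.pullback x hx, h.dom.inner_christoffel hx, hD, hD, hD, hsym v u, hsym v w, hsym u w,
    h.cod.symm _ hφx (fderiv ℝ φ x u), h.cod.symm _ hφx (fderiv ℝ φ x v)]
  ring

/-- Derivatives of the transformation law of the Christoffel symbols: the inhomogeneous terms are
symmetric in `u` and `v`, so they disappear from the curvature. -/
theorem map_secondCov (h : IsIsometryOn φ U' G' U G) (hx : x ∈ U') (u v w : Coord n) :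
    fderiv ℝ φ x (secondCov G' x u v w)
      = secondCov G (φ x) (fderiv ℝ φ x u) (fderiv ℝ φ x v) (fderiv ℝ φ x w)
        + (fderiv ℝ (fun y => fderiv ℝ (fun t => fderiv ℝ φ t w) y u) x v
          + christoffel G (φ x) (fderiv ℝ (fun y => fderiv ℝ φ y u) x v) (fderiv ℝ φ x w)
          + (christoffel G (φ x) (fderiv ℝ φ x u) (fderiv ℝ (fun y => fderiv ℝ φ y w) x v)
            + christoffel G (φ x) (fderiv ℝ φ x v) (fderiv ℝ (fun y => fderiv ℝ φ y w) x u))) := by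
  have hU := h.dom.isOpen
  have hφx := h.mapsTo x hx
  have hP := h.isTensor₁_fderiv
  have hT : IsTensor₂ U' (fun y u v => christoffel G (φ y) u v) :=
    ⟨fun v => h.isTensor₁_comp (h.cod.isTensor₂_christoffel.left v),
      fun u => h.isTensor₁_comp (h.cod.isTensor₂_christoffel.right u)⟩
  have hdP : ∀ u, DifferentiableAt ℝ (fun y => fderiv ℝ φ y u) x := fun u =>
    hP.differentiableAt hU hx u
  have e : (fun y => fderiv ℝ φ y (christoffel G' y u w)) =ᶠ[𝓝 x] fun y =>
      fderiv ℝ (fun t => fderiv ℝ φ t w) y u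
        + christoffel G (φ y) (fderiv ℝ φ y u) (fderiv ℝ φ y w) := by
    filter_upwards [hU.mem_nhds hx] with y hy using h.map_christoffel hy u w
  have d1 : DifferentiableAt ℝ (fun y => fderiv ℝ (fun t => fderiv ℝ φ t w) y u) x :=
    (RhoSoliton.isTensor₁_fderiv hU (hP.smooth w)).differentiableAt hU hx u
  have d2 : DifferentiableAt ℝ
      (fun y => christoffel G (φ y) (fderiv ℝ φ y u) (fderiv ℝ φ y w)) x :=
    differentiableAt_of_contDiffOn hU
      ((hT.apply_right (hP.smooth w)).smooth_apply_field (hP.smooth u)) hx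
  have h1 := congrArg (fun L : Coord n →L[ℝ] Coord n => L v) e.fderiv_eq
  rw [hP.fderiv_apply_field hU hx
      (differentiableAt_of_contDiffOn hU (h.dom.smooth_christoffel u w) hx),
    fderiv_fun_add d1 d2, add_apply,
    (hT.apply_right (hP.smooth w)).fderiv_apply_field hU hx (hdP u),
    (hT.right (fderiv ℝ φ x u)).fderiv_apply_field hU hx (hdP w),
    h.fderiv_comp_apply hx (h.cod.smooth_christoffel _ _)] at h1
  have h2 := h.map_christoffel hx v (christoffel G' x u w)
  rw [h.map_christoffel hx u w, h.cod.christoffel_add_right hφx] at h2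
  have h3 := eq_sub_of_add_eq h2.symm
  rw [h3] at h1
  rw [secondCov, secondCov, (fderiv ℝ φ x).map_add]
  rw [sub_add_eq_add_sub, sub_eq_iff_eq_add] at h1
  rw [add_comm (fderiv ℝ φ x (fderiv ℝ (fun y => christoffel G' y u w) x v)), h1]
  abel

theorem map_curvOp (h : IsIsometryOn φ U' G' U G) (hx : x ∈ U') (u v w : Coord n) :
    fderiv ℝ φ x (curvOp G' x u v w)
      = curvOp G (φ x) (fderiv ℝ φ x u) (fderiv ℝ φ x v) (fderiv ℝ φ x w) := by
  have hU := h.dom.isOpen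
  rw [curvOp_eq, curvOp_eq, map_sub, h.map_secondCov hx, h.map_secondCov hx,
    fderiv_fderiv_apply_comm hU (h.isTensor₁_fderiv.smooth w) hx u v,
    fderiv_fderiv_apply_comm hU h.smooth hx u v]
  abel

theorem curv_eq (h : IsIsometryOn φ U' G' U G) (hx : x ∈ U') (u v w z : Coord n) :
    curv G' x u v w z = curv G (φ x) (fderiv ℝ φ x u) (fderiv ℝ φ x v) (fderiv ℝ φ x w)
      (fderiv ℝ φ x z) := by
  rw [curv, curv, h.pullback x hx, h.map_curvOp hx]

theorem ric_eq (h : IsIsometryOn φ U' G' U G) (hx : x ∈ U') (u w : Coord n) :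
    ric G' x u w = ric G (φ x) (fderiv ℝ φ x u) (fderiv ℝ φ x w) := by
  obtain ⟨e, he⟩ := h.dom.exists_orthonormal hx
  have he' : ∀ i j, G (φ x) (fderiv ℝ φ x (e i)) (fderiv ℝ φ x (e j)) = if i = j then 1 else 0 :=
    fun i j => by rw [← h.pullback x hx, he]
  rw [h.dom.ric_eq_sum hx he, h.cod.ric_eq_sum (h.mapsTo x hx) he']
  exact Finset.sum_congr rfl fun i _ => h.curv_eq hx _ _ _ _

theorem scal_eq (h : IsIsometryOn φ U' G' U G) (hx : x ∈ U') : scal G' x = scal G (φ x) := by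
  obtain ⟨e, he⟩ := h.dom.exists_orthonormal hx
  have he' : ∀ i j, G (φ x) (fderiv ℝ φ x (e i)) (fderiv ℝ φ x (e j)) = if i = j then 1 else 0 :=
    fun i j => by rw [← h.pullback x hx, he]
  rw [h.dom.scal_eq_sum hx he, h.cod.scal_eq_sum (h.mapsTo x hx) he']
  exact Finset.sum_congr rfl fun i _ => h.ric_eq hx _ _

theorem hess_eq (h : IsIsometryOn φ U' G' U G) (hF : ContDiffOn ℝ ∞ F U) (hx : x ∈ U')
    (u v : Coord n) : hess G' (fun y => F (φ y)) x u v
      = hess G F (φ x) (fderiv ℝ φ x u) (fderiv ℝ φ x v) := by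
  have hU := h.dom.isOpen
  have hd := h.cod.isTensor₁_dir hF
  have hP := h.isTensor₁_fderiv
  have e : ∀ y ∈ U', dir (fun t => F (φ t)) y v = dir F (φ y) (fderiv ℝ φ y v) := fun y hy =>
    h.fderiv_comp_apply hy hF v
  have h1 : dir (fun t => F (φ t)) x (christoffel G' x u v)
      = dir F (φ x) (fderiv ℝ φ x (christoffel G' x u v)) := h.fderiv_comp_apply hx hF _
  rw [hess, hess, dir_congr hU hx e, h1, h.map_christoffel hx,
    (hd.lin _ (h.mapsTo x hx)).map_add]
  have h2 := (h.isTensor₁_comp hd).fderiv_apply_field hU hx (hP.differentiableAt hU hx v) u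
  rw [h.fderiv_comp_apply hx (hd.smooth _)] at h2
  change fderiv ℝ (fun y => dir F (φ y) (fderiv ℝ φ y v)) x u - _ = _
  rw [h2]
  simp only [dir]
  ring

theorem map_grad (h : IsIsometryOn φ U' G' U G) (hF : ContDiffOn ℝ ∞ F U) (hx : x ∈ U') :
    fderiv ℝ φ x (grad G' (fun y => F (φ y)) x) = grad G F (φ x) := by
  have hφx := h.mapsTo x hx
  have hF' : ContDiffOn ℝ ∞ (fun y => F (φ y)) U' := hF.comp h.smooth h.mapsTo
  refine h.cod.ext hφx fun w' => ?_
  obtain ⟨w, rfl⟩ := h.fderiv_surjective hx w'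
  rw [← h.pullback x hx, h.dom.inner_grad hF' hx, h.cod.inner_grad hF hφx]
  exact h.fderiv_comp_apply hx hF w

theorem radialRic_eq (h : IsIsometryOn φ U' G' U G) (hF : ContDiffOn ℝ ∞ F U) (hx : x ∈ U') :
    radialRic G' (fun y => F (φ y)) x = radialRic G F (φ x) := by
  rw [radialRic, radialRic, h.ric_eq hx, h.pullback x hx, h.map_grad hF hx]

end IsIsometryOn

end

section

variable {n : ℕ} {U : Set (Coord n)} {G : Coord n → Coord n → Coord n → ℝ} {x : Coord n}
variable {F : Coord n → ℝ} {ρ lam : ℝ}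

/-! ### Functions that are constant along level sets -/

/-- If `dk ∧ dF = 0` and `dF` does not vanish, then `k` is locally constant along the level sets
of `F`. The map `y ↦ y + (F y - F x - dF_x (y - x)) • w` with `dF_x w = 1` straightens the level
set of `F` through `x` to a hyperplane. -/
theorem eventually_eq_of_level_eq (hU : IsOpen U) (hx : x ∈ U) {k : Coord n → ℝ}
    (hk : ContDiffOn ℝ ∞ k U) (hF : ContDiffOn ℝ ∞ F U) (hne : ∀ y ∈ U, ∃ v, dir F y v ≠ 0)
    (hw : ∀ y ∈ U, ∀ u v, dir k y u * dir F y v = dir k y v * dir F y u) :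
    ∀ᶠ y in 𝓝 x, F y = F x → k y = k x := by
  set ℓ : Coord n →L[ℝ] ℝ := fderiv ℝ F x with hℓ
  obtain ⟨v, hv⟩ := hne x hx
  set w : Coord n := (ℓ v)⁻¹ • v with hwdef
  have hℓw : ℓ w = 1 := by
    rw [hwdef, map_smul, smul_eq_mul]
    exact inv_mul_cancel₀ hv
  let Ψ : Coord n → Coord n := fun y => y + (F y - F x - ℓ (y - x)) • w
  have hFx := hF.contDiffAt (hU.mem_nhds hx)
  have hΨ : ContDiffAt ℝ ∞ Ψ x := by
    have hℓc : ContDiffAt ℝ ∞ (fun y => ℓ (y - x)) x :=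
      ℓ.contDiff.contDiffAt.comp x (contDiffAt_id.sub contDiffAt_const)
    exact contDiffAt_id.add (((hFx.sub contDiffAt_const).sub hℓc).smul contDiffAt_const)
  have hΨ' : HasFDerivAt Ψ ((ContinuousLinearEquiv.refl ℝ (Coord n) :
      Coord n ≃L[ℝ] Coord n) : Coord n →L[ℝ] Coord n) x := by
    have h1 : HasFDerivAt F ℓ x := (differentiableAt_of_contDiffOn hU hF hx).hasFDerivAt
    have h2 : HasFDerivAt (fun y => ℓ (y - x)) ℓ x :=
      ℓ.hasFDerivAt.comp x ((hasFDerivAt_id x).sub_const x)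
    have h3 : HasFDerivAt Ψ _ x :=
      (hasFDerivAt_id x).add (((h1.sub_const (F x)).sub h2).smul_const w)
    refine h3.congr_fderiv ?_
    ext1 z
    simp
  -- the inverse function theorem; `ℓ` is the coordinate that `F` becomes under the straightening
  set e := hΨ.toOpenPartialHomeomorph Ψ hΨ' (by simp) with he
  have hecoe : ∀ y, e y = Ψ y := fun y => by
    rw [he, hΨ.toOpenPartialHomeomorph_coe hΨ' (by simp)]
  have hΨx : Ψ x = x := by simp [Ψ]
  have hxs : x ∈ e.source := hΨ.mem_toOpenPartialHomeomorph_source hΨ' (by simp)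
  have hex : e x = x := by rw [hecoe, hΨx]
  have hxt : x ∈ e.target := by
    have := e.map_source hxs
    rwa [hex] at this
  have hsx : e.symm x = x := by
    have := e.left_inv hxs
    rwa [hex] at this
  have hsc : ContDiffAt ℝ 1 e.symm x := by
    have := e.contDiffAt_symm hxt (f₀' := ContinuousLinearEquiv.refl ℝ (Coord n))
      (n := ∞) (by rw [hsx]; exact hΨ'.congr_of_eventuallyEq (Filter.Eventually.of_forall hecoe))
      (by rw [hsx]; exact hΨ.congr_of_eventuallyEq (Filter.Eventually.of_forall hecoe))
    exact this.of_le (by exact_mod_cast le_top)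
  have hℓΨ : ∀ y, ℓ (Ψ y - x) = F y - F x := fun y => by
    have : Ψ y - x = (y - x) + (F y - F x - ℓ (y - x)) • w := by
      simp only [Ψ]; abel
    rw [this, map_add, map_smul, hℓw, smul_eq_mul]
    ring
  -- a ball on which the inverse of the straightening is differentiable with values in `U`
  have hball : ∀ᶠ y in 𝓝 x, y ∈ e.target ∧ e.symm y ∈ U ∧ DifferentiableAt ℝ e.symm y := by
    have h1 : ∀ᶠ y in 𝓝 x, y ∈ e.target := e.open_target.mem_nhds hxt
    have h2 : ∀ᶠ y in 𝓝 x, e.symm y ∈ U :=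
      hsc.continuousAt.eventually_mem (by rw [hsx]; exact hU.mem_nhds hx)
    have h3 : ∀ᶠ y in 𝓝 x, DifferentiableAt ℝ e.symm y := by
      filter_upwards [hsc.eventually (by simp)] with y hy using hy.differentiableAt (by simp)
    filter_upwards [h1, h2, h3] with y a b c using ⟨a, b, c⟩
  obtain ⟨r, hr, hB⟩ := Metric.eventually_nhds_iff_ball.1 hball
  have hcont : ContinuousAt e x := e.continuousAt hxs
  have hnear : ∀ᶠ y in 𝓝 x, y ∈ e.source ∧ e y ∈ Metric.ball x r := by
    have h1 : ∀ᶠ y in 𝓝 x, y ∈ e.source := e.open_source.mem_nhds hxs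
    have h2 : ∀ᶠ y in 𝓝 x, e y ∈ Metric.ball x r :=
      hcont.eventually_mem (by rw [hex]; exact Metric.ball_mem_nhds x hr)
    filter_upwards [h1, h2] with y a b using ⟨a, b⟩
  filter_upwards [hnear] with y hy hFy
  -- along the segment from `x` to `e y`, which stays in the hyperplane `ℓ = 0`, the function
  -- `k ∘ e.symm` has derivative zero, because `F ∘ e.symm` is constant there
  set d := e y - x with hd
  have hℓd : ℓ d = 0 := by rw [hd, hecoe, hℓΨ, hFy, sub_self]
  have hmem : ∀ t ∈ Set.Icc (0 : ℝ) 1, x + t • d ∈ Metric.ball x r := fun t ht => by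
    have h1 : ‖d‖ < r := by
      have := hy.2
      rwa [Metric.mem_ball, dist_eq_norm] at this
    rw [Metric.mem_ball, dist_eq_norm, add_sub_cancel_left, norm_smul, Real.norm_eq_abs,
      abs_of_nonneg ht.1]
    exact lt_of_le_of_lt (mul_le_of_le_one_left (norm_nonneg d) ht.2) h1
  have hγ : ∀ t ∈ Set.Icc (0 : ℝ) 1,
      HasDerivAt (fun s : ℝ => e.symm (x + s • d)) (fderiv ℝ e.symm (x + t • d) d) t :=
    fun t ht => by
      have h1 : HasDerivAt (fun s : ℝ => x + s • d) d t := by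
        simpa using ((hasDerivAt_id t).smul_const d).const_add x
      exact (hB _ (hmem t ht)).2.2.hasFDerivAt.comp_hasDerivAt t h1
  have hFγ : ∀ z ∈ Metric.ball x r, F (e.symm z) = F x + ℓ (z - x) := fun z hz => by
    have h1 := hℓΨ (e.symm z)
    rw [← hecoe, e.right_inv (hB z hz).1] at h1
    linarith
  have hkd : ∀ t ∈ Set.Icc (0 : ℝ) 1,
      HasDerivAt (fun s : ℝ => k (e.symm (x + s • d))) 0 t := fun t ht => by
    have hzU := (hB _ (hmem t ht)).2.1
    have h1 : HasDerivAt (fun s : ℝ => k (e.symm (x + s • d))) _ t :=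
      (differentiableAt_of_contDiffOn hU hk hzU).hasFDerivAt.comp_hasDerivAt t (hγ t ht)
    have h2 : HasDerivAt (fun s : ℝ => F (e.symm (x + s • d))) _ t :=
      (differentiableAt_of_contDiffOn hU hF hzU).hasFDerivAt.comp_hasDerivAt t (hγ t ht)
    have h3 : HasDerivAt (fun s : ℝ => F (e.symm (x + s • d))) 0 t := by
      have hev : (fun s : ℝ => F (e.symm (x + s • d))) =ᶠ[𝓝 t] fun _ => F x := by
        have hc : ContinuousAt (fun s : ℝ => x + s • d) t := by fun_prop
        filter_upwards [hc.eventually_mem (Metric.isOpen_ball.mem_nhds (hmem t ht))] with s hs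
        rw [hFγ _ hs, add_sub_cancel_left, map_smul, hℓd, smul_zero, add_zero]
      exact (hasDerivAt_const t (F x)).congr_of_eventuallyEq hev
    have h4 := h2.unique h3
    obtain ⟨v, hv⟩ := hne _ hzU
    have h5 := hw _ hzU (fderiv ℝ e.symm (x + t • d) d) v
    have h6 : dir F (e.symm (x + t • d)) (fderiv ℝ e.symm (x + t • d) d) = 0 := h4
    rw [h6, mul_zero] at h5
    have h7 := (mul_eq_zero.1 h5).resolve_right hv
    exact h1.congr_deriv h7
  have hconst := constant_of_has_deriv_right_zero
    (f := fun s : ℝ => k (e.symm (x + s • d))) (a := 0) (b := 1)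
    (fun t ht => (hkd t ht).continuousAt.continuousWithinAt)
    (fun t ht => (hkd t ⟨ht.1, ht.2.le⟩).hasDerivWithinAt) 1 (by simp)
  simpa [hd, e.left_inv hy.1, hsx] using hconst

/-! ### The Ricci eigenvalues of a soliton as functions on the coordinate domain -/

namespace IsSolitonOn

/-- The regular points of the potential in a coordinate domain. -/
theorem isOpen_regular (h : IsSolitonOn U G F ρ lam) : IsOpen {y ∈ U | grad G F y ≠ 0} :=
  (h.metric.smooth_grad h.smooth).continuousOn.isOpen_inter_preimage h.metric.isOpen
    isOpen_compl_singleton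

theorem exists_dir_ne_zero (h : IsSolitonOn U G F ρ lam) (hx : x ∈ U) (hN : grad G F x ≠ 0) :
    ∃ v, dir F x v ≠ 0 :=
  ⟨grad G F x, by
    rw [← h.metric.inner_grad h.smooth hx]
    exact (h.metric.pos x hx _ hN).ne'⟩

theorem smooth_radialRic (h : IsSolitonOn U G F ρ lam) :
    ContDiffOn ℝ ∞ (radialRic G F) {y ∈ U | grad G F y ≠ 0} := by
  have hG := h.metric
  have hN := hG.smooth_grad h.smooth
  have h1 : ContDiffOn ℝ ∞ (fun y => ric G y (grad G F y) (grad G F y)) U :=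
    (hG.isTensor₂_ric.apply_right hN).smooth_apply_field hN
  have h2 : ContDiffOn ℝ ∞ (fun y => G y (grad G F y) (grad G F y)) U :=
    (hG.tensor.apply_right hN).smooth_apply_field hN
  exact (h1.mono fun y hy => hy.1).div (h2.mono fun y hy => hy.1)
    fun y hy => (hG.pos y hy.1 _ hy.2).ne'

/-- The differential of the radial Ricci eigenvalue is a multiple of `dF`: differentiate
`ξ₁ dF = (1 - 2 (n - 1) ρ) / 2 dR`. -/
theorem dir_radialRic_comm (h : IsSolitonOn U G F ρ lam) (hx : x ∈ {y ∈ U | grad G F y ≠ 0})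
    (u v : Coord n) : dir (radialRic G F) x u * dir F x v
      = dir (radialRic G F) x v * dir F x u := by
  have hsub : {y ∈ U | grad G F y ≠ 0} ⊆ U := fun y hy => hy.1
  refine dir_mul_dir_comm_of_mul_dir_eq h.isOpen_regular
    (H := fun y => (1 - 2 * ((n : ℝ) - 1) * ρ) / 2 * scal G y) h.smooth_radialRic
    (h.smooth.mono hsub) (contDiffOn_const.mul (h.metric.smooth_scal.mono hsub)) ?_ hx u v
  intro y hy u
  rw [h.radialRic_mul_dir hy.1 hy.2, dir_const_mul]

/-- Both Ricci eigenvalues are locally constant along the level sets of the potential. -/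
theorem eventually_eigenvalues_eq (h : IsSolitonOn U G F ρ lam) (hx : x ∈ U)
    (hN : grad G F x ≠ 0) : ∀ᶠ y in 𝓝 x, F y = F x →
      radialRic G F y = radialRic G F x ∧ scal G y = scal G x := by
  have hsub : {y ∈ U | grad G F y ≠ 0} ⊆ U := fun y hy => hy.1
  have hx' : x ∈ {y ∈ U | grad G F y ≠ 0} := ⟨hx, hN⟩
  have hne : ∀ y ∈ {y ∈ U | grad G F y ≠ 0}, ∃ v, dir F y v ≠ 0 := fun y hy =>
    h.exists_dir_ne_zero hy.1 hy.2
  filter_upwards [eventually_eq_of_level_eq h.isOpen_regular hx' h.smooth_radialRic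
      (h.smooth.mono hsub) hne fun y hy => h.dir_radialRic_comm hy,
    eventually_eq_of_level_eq h.isOpen_regular hx' (h.metric.smooth_scal.mono hsub)
      (h.smooth.mono hsub) hne fun y hy => h.rect hy.1] with y h1 h2 hy
  exact ⟨h1 hy, h2 hy⟩

end IsSolitonOn

end

section

variable {n : ℕ} {M : Type*} [TopologicalSpace M] [ChartedSpace (Coord n) M]
  [IsManifold (𝓡 n) ∞ M]

/-! ### The metric in charts -/

omit [IsManifold (𝓡 n) ∞ M] in
theorem mem_chartAt_source_iff {p q : M} :
    q ∈ (chartAt (Coord n) p).source ↔ q ∈ (extChartAt (𝓡 n) p).source := by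
  rw [extChartAt_source]

theorem mdifferentiableAt_extChartAt_symm {p : M} {x : Coord n}
    (hx : x ∈ (extChartAt (𝓡 n) p).target) :
    MDifferentiableAt 𝓘(ℝ, Coord n) (𝓡 n) (extChartAt (𝓡 n) p).symm x := by
  have : IsManifold (𝓡 n) 1 M := IsManifold.of_le (n := ∞) (by exact_mod_cast le_top)
  have h := mdifferentiableWithinAt_extChartAt_symm (I := 𝓡 n) hx
  rwa [ModelWithCorners.range_eq_univ, mdifferentiableWithinAt_univ] at h

/-- The metric does not see the identification of a tangent space with the one at an equal base
point. -/
theorem inner_congr_base (g : Metric n M) {m m' : M} (hm : m' = m) (u v : Coord n) :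
    g.inner m' (show TangentSpace (𝓡 n) m' from u) (show TangentSpace (𝓡 n) m' from v)
      = g.inner m (show TangentSpace (𝓡 n) m from u) (show TangentSpace (𝓡 n) m from v) := by
  subst hm; rfl

theorem chartVec_mfderiv {p q : M} (hq : q ∈ (extChartAt (𝓡 n) p).source)
    (u : TangentSpace (𝓡 n) q) :
    (show Coord n from chartVec p (extChartAt (𝓡 n) p q)
      (mfderiv (𝓡 n) 𝓘(ℝ, Coord n) (extChartAt (𝓡 n) p) q u)) = (show Coord n from u) := by
  have : IsManifold (𝓡 n) 1 M := IsManifold.of_le (n := ∞) (by exact_mod_cast le_top)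
  have h := mfderivWithin_extChartAt_symm_comp_mfderiv_extChartAt' (I := 𝓡 n) hq
  rw [ModelWithCorners.range_eq_univ, mfderivWithin_univ] at h
  exact congrArg (fun L : Coord n →L[ℝ] Coord n => L u) h

theorem mfderiv_chartVec {p : M} {x : Coord n} (hx : x ∈ (extChartAt (𝓡 n) p).target)
    (u : Coord n) : mfderiv (𝓡 n) 𝓘(ℝ, Coord n) (extChartAt (𝓡 n) p)
      ((extChartAt (𝓡 n) p).symm x) (chartVec p x u) = u := by
  have : IsManifold (𝓡 n) 1 M := IsManifold.of_le (n := ∞) (by exact_mod_cast le_top)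
  have h := mfderiv_extChartAt_comp_mfderivWithin_extChartAt_symm (I := 𝓡 n) hx
  rw [ModelWithCorners.range_eq_univ, mfderivWithin_univ] at h
  exact congrArg (fun L : Coord n →L[ℝ] Coord n => L u) h

omit [IsManifold (𝓡 n) ∞ M] in
theorem chartVec_add (p : M) (x u v : Coord n) :
    chartVec p x (u + v) = chartVec p x u + chartVec p x v :=
  (mfderiv 𝓘(ℝ, Coord n) (𝓡 n) (extChartAt (𝓡 n) p).symm x).map_add u v

omit [IsManifold (𝓡 n) ∞ M] in
theorem chartVec_smul (p : M) (x : Coord n) (c : ℝ) (u : Coord n) :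
    chartVec p x (c • u) = c • chartVec p x u :=
  (mfderiv 𝓘(ℝ, Coord n) (𝓡 n) (extChartAt (𝓡 n) p).symm x).map_smul c u

theorem inner_eq_chartMetric (g : Metric n M) {p q : M} (hq : q ∈ (extChartAt (𝓡 n) p).source)
    (u v : TangentSpace (𝓡 n) q) : g.inner q u v = chartMetric g p (extChartAt (𝓡 n) p q)
      (mfderiv (𝓡 n) 𝓘(ℝ, Coord n) (extChartAt (𝓡 n) p) q u)
      (mfderiv (𝓡 n) 𝓘(ℝ, Coord n) (extChartAt (𝓡 n) p) q v) := by
  have h := inner_congr_base g ((extChartAt (𝓡 n) p).left_inv hq) u v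
  rw [← chartVec_mfderiv hq u, ← chartVec_mfderiv hq v] at h
  have hu := chartVec_mfderiv hq u
  have hv := chartVec_mfderiv hq v
  refine Eq.trans ?_ h.symm
  rw [hu, hv]

theorem smooth_chartMetric (g : Metric n M) (p : M) (u v : Coord n) :
    ContDiffOn ℝ ∞ (fun x => chartMetric g p x u v) (extChartAt (𝓡 n) p).target := by
  have hopen := isOpen_extChartAt_target (I := 𝓡 n) p
  have hsymm : ContMDiffOn 𝓘(ℝ, Coord n) (𝓡 n) ∞ (extChartAt (𝓡 n) p).symm
      (extChartAt (𝓡 n) p).target := contMDiffOn_extChartAt_symm p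
  have : IsManifold (𝓡 n) 1 M := IsManifold.of_le (n := ∞) (by exact_mod_cast le_top)
  have hvec : ∀ u : Coord n, ContMDiffOn 𝓘(ℝ, Coord n) ((𝓡 n).prod 𝓘(ℝ, Coord n)) ∞
      (fun x => Bundle.TotalSpace.mk' (Coord n) (E := fun m : M => TangentSpace (𝓡 n) m)
        ((extChartAt (𝓡 n) p).symm x) (chartVec p x u)) (extChartAt (𝓡 n) p).target := by
    intro u
    have h1 := hsymm.contMDiffOn_tangentMapWithin (m := ∞) (by simp) hopen.uniqueMDiffOn
    have h2 : ContMDiff 𝓘(ℝ, Coord n) (𝓘(ℝ, Coord n).tangent) ∞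
        (fun x : Coord n => (⟨x, u⟩ : TangentBundle 𝓘(ℝ, Coord n) (Coord n))) := by
      intro x
      rw [Bundle.contMDiffAt_totalSpace]
      refine ⟨contMDiffAt_id, ?_⟩
      simpa using contMDiffAt_const
    refine (h1.comp h2.contMDiffOn fun x hx => hx).congr fun x hx => ?_
    simp only [Function.comp, tangentMapWithin, chartVec]
    rw [mfderivWithin_of_isOpen hopen hx]
  rw [← contMDiffOn_iff_contDiffOn]
  intro x hx
  have h : ContMDiffWithinAt 𝓘(ℝ, Coord n) ((𝓡 n).prod 𝓘(ℝ, ℝ)) ∞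
      (fun x => Bundle.TotalSpace.mk' ℝ (E := Bundle.Trivial M ℝ) ((extChartAt (𝓡 n) p).symm x)
        (g.inner ((extChartAt (𝓡 n) p).symm x) (chartVec p x u) (chartVec p x v)))
      (extChartAt (𝓡 n) p).target x := by
    apply ContMDiffWithinAt.clm_bundle_apply₂ (F₁ := Coord n) (F₂ := Coord n)
    · exact ContMDiffAt.comp_contMDiffWithinAt x g.contMDiff.contMDiffAt (hsymm x hx)
    · exact hvec u x hx
    · exact hvec v x hx
  simp only [Bundle.contMDiffWithinAt_totalSpace] at h
  exact h.2

theorem isMetricOn_chartMetric (g : Metric n M) (p : M) :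
    IsMetricOn (extChartAt (𝓡 n) p).target (chartMetric g p) where
  isOpen := isOpen_extChartAt_target p
  tensor := by
    refine ⟨fun v => ⟨fun x _ => ?_, fun u => smooth_chartMetric g p u v⟩,
      fun u => ⟨fun x _ => ?_, fun v => smooth_chartMetric g p u v⟩⟩
    · constructor <;> intros <;>
        simp only [chartMetric, chartVec_add, chartVec_smul, map_add, map_smul, add_apply,
          smul_apply]
    · constructor <;> intros <;>
        simp only [chartMetric, chartVec_add, chartVec_smul, map_add, map_smul]
  symm x _ u v := g.symm _ _ _
  pos x hx v hv := by
    refine g.pos _ _ fun h => hv ?_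
    have hv' := mfderiv_chartVec hx v
    rw [h] at hv'
    exact hv'.symm.trans (ContinuousLinearMap.map_zero _)

/-! ### Transition maps -/

/-- The transition map from the chart at `p` to the chart at `q`. -/
def transition (p q : M) (x : Coord n) : Coord n :=
  extChartAt (𝓡 n) q ((extChartAt (𝓡 n) p).symm x)

/-- The domain of the transition map from the chart at `p` to the chart at `q`. -/
def overlap (p q : M) : Set (Coord n) :=
  (extChartAt (𝓡 n) p).target ∩ (extChartAt (𝓡 n) p).symm ⁻¹' (extChartAt (𝓡 n) q).source

theorem mfderiv_extChartAt_chartVec {p q : M} {x : Coord n} (hx : x ∈ overlap p q)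
    (u : Coord n) : mfderiv (𝓡 n) 𝓘(ℝ, Coord n) (extChartAt (𝓡 n) q)
      ((extChartAt (𝓡 n) p).symm x) (chartVec p x u) = fderiv ℝ (transition p q) x u := by
  have : IsManifold (𝓡 n) 1 M := IsManifold.of_le (n := ∞) (by exact_mod_cast le_top)
  have h1 : MDifferentiableAt (𝓡 n) 𝓘(ℝ, Coord n) (extChartAt (𝓡 n) q)
      ((extChartAt (𝓡 n) p).symm x) :=
    mdifferentiableAt_extChartAt (mem_chartAt_source_iff.2 hx.2)
  have h := mfderiv_comp x h1 (mdifferentiableAt_extChartAt_symm hx.1)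
  rw [mfderiv_eq_fderiv] at h
  exact (congrArg (fun L : Coord n →L[ℝ] Coord n => L u) h).symm

theorem isIsometryOn_transition (g : Metric n M) (p q : M) :
    IsIsometryOn (transition p q) (overlap p q) (chartMetric g p) (extChartAt (𝓡 n) q).target
      (chartMetric g q) := by
  have hopen : IsOpen (overlap (n := n) p q) :=
    (continuousOn_extChartAt_symm p).isOpen_inter_preimage (isOpen_extChartAt_target p)
      (isOpen_extChartAt_source q)
  have hG := isMetricOn_chartMetric g p
  have hsub : overlap (n := n) p q ⊆ (extChartAt (𝓡 n) p).target := Set.inter_subset_left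
  refine ⟨⟨hopen, ⟨fun v => ?_, fun u => ?_⟩, fun x hx => hG.symm x hx.1,
    fun x hx => hG.pos x hx.1⟩, isMetricOn_chartMetric g q, ?_, fun x hx => ?_, fun x hx u v => ?_⟩
  · exact ⟨fun x hx => (hG.tensor.left v).lin x hx.1, fun u => ((hG.tensor.left v).smooth u).mono hsub⟩
  · exact ⟨fun x hx => (hG.tensor.right u).lin x hx.1, fun v => ((hG.tensor.right u).smooth v).mono hsub⟩
  · rw [← contMDiffOn_iff_contDiffOn]
    refine (contMDiffOn_extChartAt (I := 𝓡 n) (x := q)).comp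
      ((contMDiffOn_extChartAt_symm (I := 𝓡 n) p).mono hsub) fun x hx => ?_
    exact mem_chartAt_source_iff.2 hx.2
  · exact (extChartAt (𝓡 n) q).map_source hx.2
  · rw [← mfderiv_extChartAt_chartVec hx, ← mfderiv_extChartAt_chartVec hx]
    exact inner_eq_chartMetric g hx.2 _ _

omit [IsManifold (𝓡 n) ∞ M] in
theorem mem_overlap_self {p : M} {x : Coord n} (hx : x ∈ (extChartAt (𝓡 n) p).target) :
    x ∈ overlap p ((extChartAt (𝓡 n) p).symm x) :=
  ⟨hx, mem_extChartAt_source _⟩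

theorem Ricci_chartVec (g : Metric n M) {p : M} {x : Coord n}
    (hx : x ∈ (extChartAt (𝓡 n) p).target) (u v : Coord n) :
    Ricci g ((extChartAt (𝓡 n) p).symm x) (chartVec p x u) (chartVec p x v)
      = ric (chartMetric g p) x u v := by
  have ho := mem_overlap_self hx
  rw [(isIsometryOn_transition g p _).ric_eq ho, ← mfderiv_extChartAt_chartVec ho,
    ← mfderiv_extChartAt_chartVec ho]
  rfl

theorem scalarCurv_symm (g : Metric n M) {p : M} {x : Coord n}
    (hx : x ∈ (extChartAt (𝓡 n) p).target) :
    scalarCurv g ((extChartAt (𝓡 n) p).symm x) = scal (chartMetric g p) x := by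
  rw [(isIsometryOn_transition g p _).scal_eq (mem_overlap_self hx)]
  rfl

/-- A function on `M` written in the chart at `p`. -/
def chartFun (f : M → ℝ) (p : M) (x : Coord n) : ℝ := f ((extChartAt (𝓡 n) p).symm x)

theorem smooth_chartFun {f : M → ℝ} (hf : ContMDiff (𝓡 n) 𝓘(ℝ, ℝ) ∞ f) (p : M) :
    ContDiffOn ℝ ∞ (chartFun (n := n) f p) (extChartAt (𝓡 n) p).target := by
  rw [← contMDiffOn_iff_contDiffOn]
  exact hf.comp_contMDiffOn (contMDiffOn_extChartAt_symm p)

omit [IsManifold (𝓡 n) ∞ M] in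
theorem chartFun_transition (f : M → ℝ) (p q : M) {x : Coord n} (hx : x ∈ overlap p q) :
    chartFun (n := n) f q (transition p q x) = chartFun f p x := by
  simp only [chartFun, transition]
  rw [(extChartAt (𝓡 n) q).left_inv hx.2]

theorem hess_congr {G : Coord n → Coord n → Coord n → ℝ} {U : Set (Coord n)} (hU : IsOpen U)
    {x : Coord n} (hx : x ∈ U) {F H : Coord n → ℝ} (h : ∀ y ∈ U, F y = H y) :
    hess G F x = hess G H x := by
  funext u v
  have h1 : ∀ y ∈ U, dir F y v = dir H y v := fun y hy => by rw [dir_congr hU hy h]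
  rw [hess, hess, dir_congr hU hx h1, dir_congr hU hx h]

theorem Hessian_chartVec (g : Metric n M) {f : M → ℝ} (hf : ContMDiff (𝓡 n) 𝓘(ℝ, ℝ) ∞ f) {p : M}
    {x : Coord n} (hx : x ∈ (extChartAt (𝓡 n) p).target) (u v : Coord n) :
    Hessian g f ((extChartAt (𝓡 n) p).symm x) (chartVec p x u) (chartVec p x v)
      = hess (chartMetric g p) (chartFun f p) x u v := by
  have ho := mem_overlap_self hx
  have hi := isIsometryOn_transition g p ((extChartAt (𝓡 n) p).symm x)
  rw [← hess_congr hi.dom.isOpen ho fun y hy => chartFun_transition f p _ hy,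
    hi.hess_eq (smooth_chartFun hf _) ho, ← mfderiv_extChartAt_chartVec ho,
    ← mfderiv_extChartAt_chartVec ho]
  rfl

theorem differential_chartVec {f : M → ℝ} {p : M} {x : Coord n}
    (hx : x ∈ (extChartAt (𝓡 n) p).target)
    (hf : MDifferentiableAt (𝓡 n) 𝓘(ℝ, ℝ) f ((extChartAt (𝓡 n) p).symm x)) (u : Coord n) :
    differential f ((extChartAt (𝓡 n) p).symm x) (chartVec p x u) = dir (chartFun f p) x u := by
  have h := mfderiv_comp x hf (mdifferentiableAt_extChartAt_symm hx)
  rw [mfderiv_eq_fderiv] at h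
  exact (congrArg (fun L : Coord n →L[ℝ] ℝ => L u) h).symm

/-- A function that is smooth in the coordinates of the chart at `p` is smooth near the
corresponding point. -/
theorem contMDiffAt_of_chartFun {h : M → ℝ} {p : M} {x : Coord n}
    (hx : x ∈ (extChartAt (𝓡 n) p).target) {k : Coord n → ℝ} (hk : ContDiffAt ℝ ∞ k x)
    (hhk : ∀ y ∈ (extChartAt (𝓡 n) p).target, chartFun (n := n) h p y = k y) :
    ContMDiffAt (𝓡 n) 𝓘(ℝ, ℝ) ∞ h ((extChartAt (𝓡 n) p).symm x) := by
  have hs : (extChartAt (𝓡 n) p).symm x ∈ (extChartAt (𝓡 n) p).source :=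
    (extChartAt (𝓡 n) p).map_target hx
  have h1 : ContMDiffAt (𝓡 n) 𝓘(ℝ, Coord n) ∞ (extChartAt (𝓡 n) p)
      ((extChartAt (𝓡 n) p).symm x) := contMDiffAt_extChartAt' (mem_chartAt_source_iff.2 hs)
  have h2 : ContMDiffAt 𝓘(ℝ, Coord n) 𝓘(ℝ, ℝ) ∞ k
      (extChartAt (𝓡 n) p ((extChartAt (𝓡 n) p).symm x)) := by
    rw [(extChartAt (𝓡 n) p).right_inv hx]
    exact hk.contMDiffAt
  refine (h2.comp _ h1).congr_of_eventuallyEq ?_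
  filter_upwards [(isOpen_extChartAt_source (I := 𝓡 n) p).mem_nhds hs] with q hq
  have := hhk _ ((extChartAt (𝓡 n) p).map_source hq)
  rw [chartFun, (extChartAt (𝓡 n) p).left_inv hq] at this
  exact this

theorem contMDiff_scalarCurv (g : Metric n M) : ContMDiff (𝓡 n) 𝓘(ℝ, ℝ) ∞ (scalarCurv g) := by
  intro p
  have hG := isMetricOn_chartMetric g p
  have hx := mem_extChartAt_target (I := 𝓡 n) p
  have h := contMDiffAt_of_chartFun (h := scalarCurv g) hx
    (hG.smooth_scal.contDiffAt (hG.isOpen.mem_nhds hx)) fun y hy => scalarCurv_symm g hy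
  rwa [extChartAt_to_inv] at h

/-- A gradient `ρ`-Einstein soliton satisfies the soliton equation in every chart. -/
theorem isSolitonOn_chart {g : Metric n M} {f : M → ℝ} {ρ lam : ℝ}
    (hsol : IsGradientRhoEinsteinSoliton g f ρ lam)
    (hrect : ρ = 0 → ∀ (p : M) (u v : TangentSpace (𝓡 n) p),
      differential (scalarCurv g) p u * differential f p v
        - differential (scalarCurv g) p v * differential f p u = 0) (p : M) :
    IsSolitonOn (extChartAt (𝓡 n) p).target (chartMetric g p) (chartFun f p) ρ lam where
  metric := isMetricOn_chartMetric g p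
  smooth := smooth_chartFun hsol.1 p
  eq x hx u v := by
    have h := hsol.2 ((extChartAt (𝓡 n) p).symm x) (chartVec p x u) (chartVec p x v)
    rw [Ricci_chartVec g hx, Hessian_chartVec g hsol.1 hx, scalarCurv_symm g hx] at h
    exact h
  rectifiable hρ x hx u v := by
    have h := hrect hρ ((extChartAt (𝓡 n) p).symm x) (chartVec p x u) (chartVec p x v)
    have hR := (contMDiff_scalarCurv g).mdifferentiable (by simp) ((extChartAt (𝓡 n) p).symm x)
    have hf := hsol.1.mdifferentiable (by simp) ((extChartAt (𝓡 n) p).symm x)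
    rw [differential_chartVec hx hR, differential_chartVec hx hR, differential_chartVec hx hf,
      differential_chartVec hx hf] at h
    have hd : dir (chartFun (scalarCurv g) p) x = dir (scal (chartMetric g p)) x :=
      dir_congr (isOpen_extChartAt_target p) hx fun y hy => scalarCurv_symm g hy
    rwa [hd] at h

end

section

variable {n : ℕ} {M : Type*} [TopologicalSpace M] [ChartedSpace (Coord n) M]
  [IsManifold (𝓡 n) ∞ M]

/-! ### Tensors at a point in the preferred chart -/

omit [IsManifold (𝓡 n) ∞ M] in
theorem coordPt_mem (p : M) : (coordPt p : Coord n) ∈ (extChartAt (𝓡 n) p).target :=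
  mem_extChartAt_target p

omit [IsManifold (𝓡 n) ∞ M] in
theorem symm_coordPt (p : M) : (extChartAt (𝓡 n) p).symm (coordPt (n := n) p) = p :=
  extChartAt_to_inv p

theorem inner_eq_coord (g : Metric n M) (p : M) (u v : TangentSpace (𝓡 n) p) :
    g.inner p u v = chartMetric g p (coordPt p) (coordVec p u) (coordVec p v) :=
  inner_eq_chartMetric g (mem_extChartAt_source p) u v

omit [IsManifold (𝓡 n) ∞ M] in
theorem coordVec_add (p : M) (u v : TangentSpace (𝓡 n) p) :
    coordVec p (u + v) = coordVec p u + coordVec p v :=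
  (mfderiv (𝓡 n) 𝓘(ℝ, Coord n) (extChartAt (𝓡 n) p) p).map_add u v

omit [IsManifold (𝓡 n) ∞ M] in
theorem coordVec_smul (p : M) (c : ℝ) (u : TangentSpace (𝓡 n) p) :
    coordVec p (c • u) = c • coordVec p u :=
  (mfderiv (𝓡 n) 𝓘(ℝ, Coord n) (extChartAt (𝓡 n) p) p).map_smul c u

theorem coordVec_surjective (p : M) :
    Function.Surjective (coordVec (n := n) p) := by
  have : IsManifold (𝓡 n) 1 M := IsManifold.of_le (n := ∞) (by exact_mod_cast le_top)
  exact (isInvertible_mfderiv_extChartAt (I := 𝓡 n) (mem_extChartAt_source p)).bijective.surjective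

theorem differential_eq_coord {f : M → ℝ} (hf : ContMDiff (𝓡 n) 𝓘(ℝ, ℝ) ∞ f) (p : M)
    (v : TangentSpace (𝓡 n) p) :
    differential f p v = dir (chartFun f p) (coordPt p) (coordVec p v) := by
  have : IsManifold (𝓡 n) 1 M := IsManifold.of_le (n := ∞) (by exact_mod_cast le_top)
  have h1 : MDifferentiableAt (𝓡 n) 𝓘(ℝ, Coord n) (extChartAt (𝓡 n) p) p :=
    mdifferentiableAt_extChartAt (mem_chart_source _ p)
  have h2 : MDifferentiableAt 𝓘(ℝ, Coord n) 𝓘(ℝ, ℝ) (chartFun (n := n) f p)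
      (extChartAt (𝓡 n) p p) :=
    (differentiableAt_of_contDiffOn (isOpen_extChartAt_target p) (smooth_chartFun hf p)
      (coordPt_mem p)).mdifferentiableAt
  have h := mfderiv_comp p h2 h1
  have e : chartFun f p ∘ extChartAt (𝓡 n) p =ᶠ[𝓝 p] f := by
    filter_upwards [(isOpen_extChartAt_source (I := 𝓡 n) p).mem_nhds (mem_extChartAt_source p)]
      with q hq
    simp only [Function.comp, chartFun, (extChartAt (𝓡 n) p).left_inv hq]
  rw [e.mfderiv_eq, mfderiv_eq_fderiv] at h
  exact congrArg (fun L : Coord n →L[ℝ] ℝ => L v) h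

theorem coordVec_gradient (g : Metric n M) {f : M → ℝ} (hf : ContMDiff (𝓡 n) 𝓘(ℝ, ℝ) ∞ f)
    (p : M) : coordVec p (gradient g f p) = grad (chartMetric g p) (chartFun f p) (coordPt p) := by
  refine ((isMetricOn_chartMetric g p).sharp_eq (coordPt_mem p) fun w => ?_).symm
  obtain ⟨v, rfl⟩ := coordVec_surjective p w
  rw [← inner_eq_coord, inner_gradient, differential_eq_coord hf]

theorem grad_ne_zero {g : Metric n M} {f : M → ℝ} (hf : ContMDiff (𝓡 n) 𝓘(ℝ, ℝ) ∞ f)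
    {p : M} (hp : p ∈ regularSet n f) :
    grad (chartMetric g p) (chartFun f p) (coordPt p) ≠ 0 := by
  intro h0
  refine hp (ContinuousLinearMap.ext fun v => ?_)
  have h := inner_gradient g f p v
  rw [inner_eq_coord, coordVec_gradient g hf, h0,
    (((isMetricOn_chartMetric g p).isBilin (coordPt_mem p)).left _).map_zero] at h
  exact h.symm

/-- The Ricci eigenvalue of the gradient direction on `M`. -/
def radialEigenvalue (g : Metric n M) (f : M → ℝ) (p : M) : ℝ :=
  radialRic (chartMetric g p) (chartFun f p) (coordPt p)

/-- The Ricci eigenvalue on the orthogonal complement of the gradient when `Ric` is a multiple of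
the metric there. -/
def tangentialEigenvalue (g : Metric n M) (f : M → ℝ) (p : M) : ℝ :=
  (scalarCurv g p - radialEigenvalue g f p) / ((n : ℝ) - 1)

theorem bachMu_eq (g : Metric n M) {f : M → ℝ} (hf : ContMDiff (𝓡 n) 𝓘(ℝ, ℝ) ∞ f) (p : M) :
    bachMu g f p = n * radialEigenvalue g f p ^ 2 - 2 * scalarCurv g p * radialEigenvalue g f p
      - (((n : ℝ) - 1) * RicciNormSq g p - scalarCurv g p ^ 2) := by
  simp only [bachMu, radialEigenvalue, radialRic, Ricci, inner_eq_coord, coordVec_gradient g hf]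

/-- The radial eigenvalue is defined in the preferred chart at each point; invariance under
transition maps lets one chart compute it at all of its points. -/
theorem radialEigenvalue_symm (g : Metric n M) {f : M → ℝ}
    (hf : ContMDiff (𝓡 n) 𝓘(ℝ, ℝ) ∞ f) {p : M} {x : Coord n}
    (hx : x ∈ (extChartAt (𝓡 n) p).target) :
    radialEigenvalue g f ((extChartAt (𝓡 n) p).symm x)
      = radialRic (chartMetric g p) (chartFun f p) x := by
  have ho := mem_overlap_self hx
  have hi := isIsometryOn_transition g p ((extChartAt (𝓡 n) p).symm x)
  have h1 := hi.radialRic_eq (smooth_chartFun hf _) ho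
  have h2 : dir (fun y => chartFun f ((extChartAt (𝓡 n) p).symm x)
      (transition p ((extChartAt (𝓡 n) p).symm x) y)) x = dir (chartFun f p) x :=
    dir_congr hi.dom.isOpen ho fun y hy => chartFun_transition f p _ hy
  simp only [radialRic, grad, h2] at h1 ⊢
  exact h1.symm

section AdaptedBasis

variable {g : Metric n M} {f : M → ℝ} {ρ lam : ℝ} {p : M}

theorem Ricci_gradient (hf : ContMDiff (𝓡 n) 𝓘(ℝ, ℝ) ∞ f)
    (h : IsSolitonOn (extChartAt (𝓡 n) p).target (chartMetric g p) (chartFun f p) ρ lam)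
    (hp : p ∈ regularSet n f) (v : TangentSpace (𝓡 n) p) :
    Ricci g p (gradient g f p) v = radialEigenvalue g f p * g.inner p (gradient g f p) v := by
  rw [inner_eq_coord, Ricci, coordVec_gradient g hf]
  exact h.ric_grad_eq (coordPt_mem p) (grad_ne_zero hf hp) _

theorem gradient_ne_zero (hf : ContMDiff (𝓡 n) 𝓘(ℝ, ℝ) ∞ f) (hp : p ∈ regularSet n f) :
    gradient g f p ≠ 0 := by
  intro h0
  apply grad_ne_zero (g := g) hf hp
  rw [← coordVec_gradient g hf, h0]
  exact ContinuousLinearMap.map_zero (mfderiv (𝓡 n) 𝓘(ℝ, Coord n) (extChartAt (𝓡 n) p) p)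

theorem exists_isAdaptedRicciBasis (hf : ContMDiff (𝓡 n) 𝓘(ℝ, ℝ) ∞ f)
    (h : IsSolitonOn (extChartAt (𝓡 n) p).target (chartMetric g p) (chartFun f p) ρ lam)
    (hp : p ∈ regularSet n f) (i₁ : Fin n) : ∃ e ξ, IsAdaptedRicciBasis g f p i₁ e ξ := by
  have hr := h.metric.isTensor₂_ric.isBilin (coordPt_mem p)
  let S : LinearMap.BilinForm ℝ (TangentSpace (𝓡 n) p) := LinearMap.mk₂ ℝ (Ricci g p)
    (fun u v w => by simp only [Ricci, coordVec_add]; exact (hr.left _).map_add _ _)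
    (fun c u w => by simp only [Ricci, coordVec_smul]; exact (hr.left _).map_smul _ _)
    (fun u v w => by simp only [Ricci, coordVec_add]; exact (hr.right _).map_add _ _)
    (fun c u w => by simp only [Ricci, coordVec_smul]; exact (hr.right _).map_smul _ _)
  have hfin : Module.finrank ℝ (TangentSpace (𝓡 n) p) = n :=
    (finrank_euclideanSpace_fin : Module.finrank ℝ (Coord n) = n)
  obtain ⟨e, ξ, h1, h2, h3⟩ := exists_orthonormal_eigenbasis (metricForm g p) S
    (g.symm p) (g.pos p) (fun u v => h.metric.ric_comm (coordPt_mem p) _ _)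
    (gradient_ne_zero hf hp) (fun v => Ricci_gradient hf h hp v) hfin i₁
  exact ⟨e, ξ, ⟨h1, h2, h3⟩⟩

namespace IsAdaptedRicciBasis

variable {i₁ : Fin n} {e : Fin n → TangentSpace (𝓡 n) p} {ξ : Fin n → ℝ}

theorem coord_orthonormal (hb : IsAdaptedRicciBasis g f p i₁ e ξ) (i j : Fin n) :
    chartMetric g p (coordPt p) (coordVec p (e i)) (coordVec p (e j)) = if i = j then 1 else 0 := by
  rw [← inner_eq_coord, hb.orthonormal]

theorem ric_eq (hb : IsAdaptedRicciBasis g f p i₁ e ξ) (i j : Fin n) :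
    ric (chartMetric g p) (coordPt p) (coordVec p (e i)) (coordVec p (e j))
      = if i = j then ξ i else 0 := by
  have h := hb.eigen i (e j)
  rw [hb.orthonormal] at h
  rw [Ricci] at h
  rw [h, mul_ite, mul_one, mul_zero]

theorem scalarCurv_eq (hb : IsAdaptedRicciBasis g f p i₁ e ξ) : scalarCurv g p = ∑ i, ξ i := by
  rw [scalarCurv, (isMetricOn_chartMetric g p).scal_eq_sum (coordPt_mem p) hb.coord_orthonormal]
  simp [hb.ric_eq]

theorem RicciNormSq_eq (hb : IsAdaptedRicciBasis g f p i₁ e ξ) :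
    RicciNormSq g p = ∑ i, ξ i ^ 2 := by
  rw [RicciNormSq,
    (isMetricOn_chartMetric g p).ricNormSq_eq_sum (coordPt_mem p) hb.coord_orthonormal]
  simp [hb.ric_eq, sq]

theorem eigenvalue_first (hf : ContMDiff (𝓡 n) 𝓘(ℝ, ℝ) ∞ f) (hp : p ∈ regularSet n f)
    (h : IsSolitonOn (extChartAt (𝓡 n) p).target (chartMetric g p) (chartFun f p) ρ lam)
    (hb : IsAdaptedRicciBasis g f p i₁ e ξ) : ξ i₁ = radialEigenvalue g f p := by
  have hpos := g.pos p _ (gradient_ne_zero (g := g) hf hp)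
  have h1 := hb.eigen i₁ (gradient g f p)
  have h2 := Ricci_gradient hf h hp (e i₁)
  have h3 : Ricci g p (e i₁) (gradient g f p) = Ricci g p (gradient g f p) (e i₁) :=
    h.metric.ric_comm (coordPt_mem p) _ _
  have h4 : g.inner p (e i₁) (gradient g f p) ≠ 0 := by
    rw [hb.first, map_smul, smul_apply, smul_eq_mul]
    exact mul_ne_zero (inv_ne_zero (Real.sqrt_pos.2 hpos).ne') hpos.ne'
  rw [h3, h2, g.symm p (gradient g f p)] at h1
  exact (mul_right_cancel₀ h4 h1).symm

theorem bachMu_eq_sum (hf : ContMDiff (𝓡 n) 𝓘(ℝ, ℝ) ∞ f) (hp : p ∈ regularSet n f)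
    (h : IsSolitonOn (extChartAt (𝓡 n) p).target (chartMetric g p) (chartFun f p) ρ lam)
    (hb : IsAdaptedRicciBasis g f p i₁ e ξ) : bachMu g f p
      = (∑ i ∈ Finset.univ.erase i₁, ξ i) ^ 2
        - ((n : ℝ) - 1) * ∑ i ∈ Finset.univ.erase i₁, ξ i ^ 2 := by
  have h1 := Finset.add_sum_erase Finset.univ ξ (Finset.mem_univ i₁)
  have h2 := Finset.add_sum_erase Finset.univ (fun i => ξ i ^ 2) (Finset.mem_univ i₁)
  rw [bachMu_eq g hf, hb.scalarCurv_eq, hb.RicciNormSq_eq, ← h1, ← h2,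
    ← hb.eigenvalue_first hf hp h]
  ring

end IsAdaptedRicciBasis

/-- Cauchy-Schwarz for the eigenvalues on the orthogonal complement of the gradient. -/
theorem sq_sum_erase_le (ξ : Fin n → ℝ) (i₁ : Fin n) :
    (∑ i ∈ Finset.univ.erase i₁, ξ i) ^ 2
      - ((n : ℝ) - 1) * ∑ i ∈ Finset.univ.erase i₁, ξ i ^ 2 ≤ 0 := by
  have h := sq_sum_le_card_mul_sum_sq (s := Finset.univ.erase i₁) (f := ξ)
  rw [Finset.card_erase_of_mem (Finset.mem_univ i₁), Finset.card_univ, Fintype.card_fin,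
    Nat.cast_sub (by have := i₁.2; omega)] at h
  push_cast at h
  linarith

/-- The equality case of Cauchy-Schwarz: the deviations from the mean have vanishing square sum. -/
theorem eq_div_of_sq_sum_erase_eq {ξ : Fin n → ℝ} {i₁ : Fin n} (hn : 3 ≤ n)
    (h0 : (∑ i ∈ Finset.univ.erase i₁, ξ i) ^ 2
      - ((n : ℝ) - 1) * ∑ i ∈ Finset.univ.erase i₁, ξ i ^ 2 = 0) {j : Fin n} (hj : j ≠ i₁) :
    ξ j = (∑ i ∈ Finset.univ.erase i₁, ξ i) / ((n : ℝ) - 1) := by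
  have hn' : (3 : ℝ) ≤ n := by exact_mod_cast hn
  have hn1 : (n : ℝ) - 1 ≠ 0 := by linarith
  set s := ∑ i ∈ Finset.univ.erase i₁, ξ i with hs
  have hcard : ((Finset.univ.erase i₁).card : ℝ) = (n : ℝ) - 1 := by
    rw [Finset.card_erase_of_mem (Finset.mem_univ i₁), Finset.card_univ, Fintype.card_fin,
      Nat.cast_sub (by omega)]
    simp
  have hsum : ∑ i ∈ Finset.univ.erase i₁, (ξ i - s / ((n : ℝ) - 1)) ^ 2 = 0 := by
    have e : ∀ i, (ξ i - s / ((n : ℝ) - 1)) ^ 2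
        = ξ i ^ 2 - 2 * (s / ((n : ℝ) - 1)) * ξ i + (s / ((n : ℝ) - 1)) ^ 2 := fun i => by ring
    simp only [e, Finset.sum_add_distrib, Finset.sum_sub_distrib, ← Finset.mul_sum, ← hs,
      Finset.sum_const, nsmul_eq_mul, hcard]
    field_simp
    linarith
  have h1 := (Finset.sum_eq_zero_iff_of_nonneg fun i _ => sq_nonneg _).1 hsum j (by simp [hj])
  have h2 := pow_eq_zero_iff (two_ne_zero) |>.1 h1
  linarith

/-- If `μ = 0`, the Ricci tensor is a multiple of the metric on the orthogonal complement of the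
gradient. -/
theorem Ricci_of_bachMu_eq_zero (hn : 3 ≤ n) (hf : ContMDiff (𝓡 n) 𝓘(ℝ, ℝ) ∞ f)
    (h : IsSolitonOn (extChartAt (𝓡 n) p).target (chartMetric g p) (chartFun f p) ρ lam)
    (hp : p ∈ regularSet n f) (hμ : bachMu g f p = 0) (u v : TangentSpace (𝓡 n) p)
    (hu : g.inner p (gradient g f p) u = 0) :
    Ricci g p u v = tangentialEigenvalue g f p * g.inner p u v := by
  obtain ⟨e, ξ, hb⟩ := exists_isAdaptedRicciBasis hf h hp ⟨0, by omega⟩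
  set i₁ : Fin n := ⟨0, by omega⟩
  have hG := isMetricOn_chartMetric g p
  have hx := coordPt_mem (n := n) p
  have hr := hG.isTensor₂_ric.isBilin hx
  have hμ' := hb.bachMu_eq_sum hf hp h
  rw [hμ] at hμ'
  have hξ : ∀ j, j ≠ i₁ → ξ j = tangentialEigenvalue g f p := fun j hj => by
    have h1 := Finset.add_sum_erase Finset.univ ξ (Finset.mem_univ i₁)
    rw [eq_div_of_sq_sum_erase_eq hn hμ'.symm hj, tangentialEigenvalue, hb.scalarCurv_eq,
      ← hb.eigenvalue_first hf hp h, ← h1, add_sub_cancel_left]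
  have hu1 : g.inner p u (e i₁) = 0 := by
    rw [hb.first, map_smul, g.symm p u, hu, smul_zero]
  rw [Ricci, inner_eq_coord,
    ← hG.sum_mul_inner hx hb.coord_orthonormal (hr.left (coordVec p v)) (coordVec p u),
    ← hG.sum_mul_inner hx hb.coord_orthonormal ((hG.isBilin hx).left (coordVec p v))
      (coordVec p u), Finset.mul_sum]
  refine Finset.sum_congr rfl fun i _ => ?_
  have h1 := hb.eigen i v
  rw [Ricci, inner_eq_coord] at h1
  rw [h1, ← inner_eq_coord g p u (e i)]
  by_cases hi : i = i₁
  · rw [hi, hu1, mul_zero, mul_zero, mul_zero]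
  · rw [hξ i hi]
    ring

end AdaptedBasis

/-! ### The Ricci eigenvalues as functions on the manifold -/

section Global

variable {g : Metric n M} {f : M → ℝ} {ρ lam : ℝ}

theorem contMDiffAt_radialEigenvalue (hf : ContMDiff (𝓡 n) 𝓘(ℝ, ℝ) ∞ f) {p : M}
    (h : IsSolitonOn (extChartAt (𝓡 n) p).target (chartMetric g p) (chartFun f p) ρ lam)
    (hp : p ∈ regularSet n f) :
    ContMDiffAt (𝓡 n) 𝓘(ℝ, ℝ) ∞ (radialEigenvalue g f) p := by
  have hx := coordPt_mem (n := n) p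
  have h1 := contMDiffAt_of_chartFun (h := radialEigenvalue g f) hx
    (h.smooth_radialRic.contDiffAt
      (h.isOpen_regular.mem_nhds ⟨hx, grad_ne_zero hf hp⟩))
    fun y hy => radialEigenvalue_symm g hf hy
  rwa [symm_coordPt] at h1

theorem contMDiffAt_tangentialEigenvalue (hf : ContMDiff (𝓡 n) 𝓘(ℝ, ℝ) ∞ f) {p : M}
    (h : IsSolitonOn (extChartAt (𝓡 n) p).target (chartMetric g p) (chartFun f p) ρ lam)
    (hp : p ∈ regularSet n f) :
    ContMDiffAt (𝓡 n) 𝓘(ℝ, ℝ) ∞ (tangentialEigenvalue g f) p := by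
  have h1 := ((contMDiff_scalarCurv g) p).sub (contMDiffAt_radialEigenvalue hf h hp)
  have h2 : ContDiff ℝ ∞ fun t : ℝ => t / ((n : ℝ) - 1) := contDiff_id.div_const _
  exact h2.contMDiff.contMDiffAt.comp p h1

theorem eventually_eigenvalues_eq_of_eq (hf : ContMDiff (𝓡 n) 𝓘(ℝ, ℝ) ∞ f) {p : M}
    (h : IsSolitonOn (extChartAt (𝓡 n) p).target (chartMetric g p) (chartFun f p) ρ lam)
    (hp : p ∈ regularSet n f) : ∀ᶠ q in 𝓝 p, f q = f p →
      radialEigenvalue g f q = radialEigenvalue g f p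
        ∧ tangentialEigenvalue g f q = tangentialEigenvalue g f p := by
  have hx := coordPt_mem (n := n) p
  have h1 := h.eventually_eigenvalues_eq hx (grad_ne_zero hf hp)
  have hc : ContinuousAt (extChartAt (𝓡 n) p) p := continuousAt_extChartAt p
  filter_upwards [hc.eventually h1,
    (isOpen_extChartAt_source (I := 𝓡 n) p).mem_nhds (mem_extChartAt_source p)] with q hq hqs hfq
  have hy := (extChartAt (𝓡 n) p).map_source hqs
  have e1 : chartFun (n := n) f p (extChartAt (𝓡 n) p q) = f q := by
    rw [chartFun, (extChartAt (𝓡 n) p).left_inv hqs]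
  have e2 : chartFun (n := n) f p (coordPt p) = f p := by
    rw [chartFun, symm_coordPt]
  have e3 := radialEigenvalue_symm g hf hy
  have e4 := scalarCurv_symm g hy
  rw [(extChartAt (𝓡 n) p).left_inv hqs] at e3 e4
  obtain ⟨h2, h3⟩ := hq (by rw [e1, e2, hfq])
  have h4 : radialEigenvalue g f q = radialEigenvalue g f p := e3.trans h2
  have h5 : scalarCurv g q = scalarCurv g p := e4.trans h3
  exact ⟨h4, by rw [tangentialEigenvalue, tangentialEigenvalue, h4, h5]⟩

end Global

end

end RhoSoliton

end

theorem mainTheorem5 {n : ℕ} (hn : 3 ≤ n) {M : Type*} [TopologicalSpace M] [T2Space M]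
    [SecondCountableTopology M] [ChartedSpace (RhoSoliton.Coord n) M] [IsManifold (𝓡 n) ∞ M]
    (g : RhoSoliton.Metric n M) (f : M → ℝ) (ρ lam : ℝ)
    (hsol : RhoSoliton.IsGradientRhoEinsteinSoliton g f ρ lam)
    (hnontrivial : ¬ ∃ c : ℝ, ∀ p, f p = c)
    (hrect : ρ = 0 → ∀ (p : M) (u v : TangentSpace (𝓡 n) p),
      RhoSoliton.differential (RhoSoliton.scalarCurv g) p u * RhoSoliton.differential f p v
        - RhoSoliton.differential (RhoSoliton.scalarCurv g) p v * RhoSoliton.differential f p u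
          = 0) :
    (∀ p ∈ RhoSoliton.regularSet n f,
      (∀ v : TangentSpace (𝓡 n) p,
        RhoSoliton.Bach g p (RhoSoliton.gradient g f p) v
          = RhoSoliton.bachMu g f p / (((n : ℝ) - 1) * ((n : ℝ) - 2) ^ 2)
              * g.inner p (RhoSoliton.gradient g f p) v) ∧
      (∀ i₁ : Fin n, ∃ e ξ, RhoSoliton.IsAdaptedRicciBasis g f p i₁ e ξ) ∧
      (∀ (i₁ : Fin n) (e : Fin n → TangentSpace (𝓡 n) p) (ξ : Fin n → ℝ),
        RhoSoliton.IsAdaptedRicciBasis g f p i₁ e ξ →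
          RhoSoliton.bachMu g f p
            = (∑ i ∈ Finset.univ.erase i₁, ξ i) ^ 2
                - ((n : ℝ) - 1) * ∑ i ∈ Finset.univ.erase i₁, ξ i ^ 2) ∧
      RhoSoliton.bachMu g f p ≤ 0) ∧
    ((∀ p : M,
        0 ≤ RhoSoliton.Bach g p (RhoSoliton.gradient g f p) (RhoSoliton.gradient g f p)) →
      ∃ ξ₁ ξ₂ : M → ℝ,
        (∀ p ∈ RhoSoliton.regularSet n f,
          (∀ v : TangentSpace (𝓡 n) p,
            RhoSoliton.Ricci g p (RhoSoliton.gradient g f p) v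
              = ξ₁ p * g.inner p (RhoSoliton.gradient g f p) v) ∧
          (∀ u v : TangentSpace (𝓡 n) p, g.inner p (RhoSoliton.gradient g f p) u = 0 →
            RhoSoliton.Ricci g p u v = ξ₂ p * g.inner p u v)) ∧
        ContMDiffOn (𝓡 n) 𝓘(ℝ, ℝ) ∞ ξ₁ (RhoSoliton.regularSet n f) ∧
        ContMDiffOn (𝓡 n) 𝓘(ℝ, ℝ) ∞ ξ₂ (RhoSoliton.regularSet n f) ∧
        (∀ p ∈ RhoSoliton.regularSet n f,
          ∀ q ∈ connectedComponentIn (f ⁻¹' {f p} ∩ RhoSoliton.regularSet n f) p,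
            ξ₁ q = ξ₁ p ∧ ξ₂ q = ξ₂ p)) := by
  open RhoSoliton in
  have hn' : (3 : ℝ) ≤ n := by exact_mod_cast hn
  have hf := hsol.1
  have h := isSolitonOn_chart hsol hrect
  have hbach : ∀ p ∈ regularSet n f, ∀ v : TangentSpace (𝓡 n) p, Bach g p (gradient g f p) v
      = bachMu g f p / (((n : ℝ) - 1) * ((n : ℝ) - 2) ^ 2) * g.inner p (gradient g f p) v :=
    fun p hp v => by
      rw [bachMu_eq g hf, inner_eq_coord, Bach, coordVec_gradient g hf]
      exact (h p).bachCoord_grad (coordPt_mem p) hn (grad_ne_zero hf hp) _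
  have hle : ∀ p ∈ regularSet n f, bachMu g f p ≤ 0 := fun p hp => by
    obtain ⟨e, ξ, hb⟩ := exists_isAdaptedRicciBasis hf (h p) hp ⟨0, by omega⟩
    rw [hb.bachMu_eq_sum hf hp (h p)]
    exact sq_sum_erase_le ξ _
  refine ⟨fun p hp => ⟨hbach p hp, exists_isAdaptedRicciBasis hf (h p) hp,
    fun i₁ e ξ hb => hb.bachMu_eq_sum hf hp (h p), hle p hp⟩, fun hB => ?_⟩
  have hμ : ∀ p ∈ regularSet n f, bachMu g f p = 0 := fun p hp => by
    refine le_antisymm (hle p hp) ?_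
    have h1 := hB p
    rw [hbach p hp] at h1
    have hpos := g.pos p _ (gradient_ne_zero (g := g) hf hp)
    have hden : 0 < ((n : ℝ) - 1) * ((n : ℝ) - 2) ^ 2 :=
      mul_pos (by linarith) (pow_pos (by linarith) 2)
    have h2 := nonneg_of_mul_nonneg_left h1 hpos
    have h3 := mul_nonneg h2 hden.le
    rwa [div_mul_cancel₀ _ hden.ne'] at h3
  refine ⟨radialEigenvalue g f, tangentialEigenvalue g f, fun p hp =>
    ⟨Ricci_gradient hf (h p) hp, Ricci_of_bachMu_eq_zero hn hf (h p) hp (hμ p hp)⟩,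
    fun p hp => (contMDiffAt_radialEigenvalue hf (h p) hp).contMDiffWithinAt,
    fun p hp => (contMDiffAt_tangentialEigenvalue hf (h p) hp).contMDiffWithinAt,
    fun p hp q hq => ?_⟩
  have hsub := connectedComponentIn_subset (f ⁻¹' {f p} ∩ regularSet n f) p
  have hpmem : p ∈ connectedComponentIn (f ⁻¹' {f p} ∩ regularSet n f) p :=
    mem_connectedComponentIn ⟨rfl, hp⟩
  -- a relation that holds locally on a connected set holds between any two of its points
  refine isPreconnected_connectedComponentIn.induction₂
    (fun a b => radialEigenvalue g f a = radialEigenvalue g f b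
      ∧ tangentialEigenvalue g f a = tangentialEigenvalue g f b) (fun a ha => ?_)
    (fun a b c _ _ _ hab hbc => ⟨hab.1.trans hbc.1, hab.2.trans hbc.2⟩)
    (fun a b _ _ hab => ⟨hab.1.symm, hab.2.symm⟩) hq hpmem
  filter_upwards [mem_nhdsWithin_of_mem_nhds
    (eventually_eigenvalues_eq_of_eq hf (h a) (hsub ha).2), self_mem_nhdsWithin] with b hb hbC
  have hba : f b = f a := (hsub hbC).1.trans (hsub ha).1.symm
  exact ⟨(hb hba).1.symm, (hb hba).2.symm⟩
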